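/- There is a universal constant $C>0$ such that the following holds. Let $d,n\ge 1$, let $\mathcal X\subseteq\mathbb R^d$ be closed and convex with $\mathbf 0\in\mathcal X$, let $\delta\in(0,1/2]$, and let $\hat L\in\mathbb R$, $\hat\ell\in\mathbb R^d$. Then there exists a parameter-free algorithm, that is, a map $\mathcal A$ sending $n$ functions $\mathbb R^d\to\mathbb R$ to a point of $\mathcal X$, which depends only on $d,n,\mathcal X,\delta,\hat L,\hat\ell$, with the following property. Let $S$ be a random variable and let $f(x;S)$ be a random loss such that $F(x):=\mathbb E[f(x;S)]$ is well defined on $\mathcal X$ with $F^\star:=\inf_{x\in\mathcal X}F(x)>-\infty$. Suppose that almost surely $f(\cdot\,;S)$ is convex on $\mathcal X$ and differentiable at every $x\in\mathcal X$, and that for some $L\in\mathbb R$ and $\ell\in\mathbb R^d$, almost surely, for all $x\in\mathcal X$ and all $j\le d$, \[ \|\nabla f(x;S)\|_2\le L\le\hat L,\qquad |\nabla_j f(x;S)|\le \ell_j\le\hat\ell_j . \] Suppose moreover that \[ \hat L\le L\sqrt{\frac{n}{\ln(1/\delta)}}\qquad\text{and}\qquad \hat\ell_j\le \ell_j\sqrt{\frac{n}{\ln(d/\delta)}}\quad\text{for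 all } j\le d . \] Let $S_1,\dots,S_n$ be independent copies of $S$ and let $z:=\mathcal A\big(f(\cdot\,;S_1),\dots,f(\cdot\,;S_n)\big)$. Then, with probability at least $1-\delta$, for every $x^\star\in\mathcal X^\star:=\operatorname{argmin}_{x\in\mathcal X}F(x)$, \[ F(z)-F^\star\le C\,\min\left\{\frac{L\|x^\star\|_2\sqrt{\ln\frac1\delta}}{\sqrt n},\ \frac{\|\ell\|_\infty\|x^\star\|_1\sqrt{\ln\frac d\delta}}{\sqrt n},\ \frac{\|\ell\|_1\|x^\star\|_\infty\sqrt{\ln\frac1\delta}}{\sqrt n}\right\}. \] -/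

import Mathlib

open MeasureTheory

noncomputable section

namespace StochOpt

/-- `ℝ^d` with the Euclidean norm. -/
abbrev Vec (d : ℕ) : Type := EuclideanSpace ℝ (Fin d)

/-- The `1`-norm of a coordinate vector. -/
def norm1 {d : ℕ} (v : Fin d → ℝ) : ℝ := ∑ j, |v j|

/-- The `∞`-norm of a coordinate vector (the norm of Mathlib on `Fin d → ℝ`). -/
def normInf {d : ℕ} (v : Fin d → ℝ) : ℝ := ‖v‖

variable {d : ℕ} {𝒮 : Type*} [MeasurableSpace 𝒮]

/-- The population risk `F(x) = 𝔼[f(x; S)]`, where `S` has law `P`. -/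
def risk (P : Measure 𝒮) (f : Vec d → 𝒮 → ℝ) (x : Vec d) : ℝ := ∫ s, f x s ∂P

/-- The optimal value `F⋆ = inf_{x ∈ X} F(x)`. -/
def optValue (X : Set (Vec d)) (P : Measure 𝒮) (f : Vec d → 𝒮 → ℝ) : ℝ :=
  sInf (risk P f '' X)

/-- The set of minimizers `X⋆ = argmin_{x ∈ X} F(x)` (possibly empty). -/
def minimizers (X : Set (Vec d)) (P : Measure 𝒮) (f : Vec d → 𝒮 → ℝ) : Set (Vec d) :=
  {x | x ∈ X ∧ ∀ y ∈ X, risk P f x ≤ risk P f y}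

/-- A stochastic convex problem on `X`: the losses are convex in `x` on `X`, the population risk
is well defined on `X`, and it is bounded below there (`F⋆ > -∞`). -/
structure IsStochConvex (X : Set (Vec d)) (P : Measure 𝒮) (f : Vec d → 𝒮 → ℝ) : Prop where
  measurable : ∀ x, Measurable (f x)
  integrable : ∀ x ∈ X, Integrable (f x) P
  convex : ∀ᵐ s ∂P, ConvexOn ℝ X (fun x => f x s)
  bddBelow : BddBelow (risk P f '' X)

/-- Upper bounds on the Lipschitz constants: `f` is differentiable in `x` and almost surely, for
all `x ∈ X` and all `j`, `‖∇f(x;S)‖₂ ≤ L ≤ Lhat` and `|∇ⱼ f(x;S)| ≤ ℓ j ≤ ℓhat j`. -/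
structure LipschitzEstimates (X : Set (Vec d)) (P : Measure 𝒮) (f : Vec d → 𝒮 → ℝ)
    (L Lhat : ℝ) (ℓ ℓhat : Fin d → ℝ) : Prop where
  differentiable : ∀ᵐ s ∂P, ∀ x ∈ X, DifferentiableAt ℝ (fun y => f y s) x
  norm_gradient_le : ∀ᵐ s ∂P, ∀ x ∈ X, ‖gradient (fun y => f y s) x‖ ≤ L
  le_Lhat : L ≤ Lhat
  abs_gradient_le : ∀ᵐ s ∂P, ∀ x ∈ X, ∀ j, |gradient (fun y => f y s) x j| ≤ ℓ j
  le_ℓhat : ∀ j, ℓ j ≤ ℓhat j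

/-- The minimum of the three known-parameter rates, for the minimizer `x` and sample size `n`. -/
def rate (n : ℕ) (δ L : ℝ) (ℓ : Fin d → ℝ) (x : Vec d) : ℝ :=
  min (L * ‖x‖ * √(Real.log (1 / δ)) / √(n : ℝ))
    (min (normInf ℓ * norm1 x * √(Real.log ((d : ℝ) / δ)) / √(n : ℝ))
      (norm1 ℓ * normInf x * √(Real.log (1 / δ)) / √(n : ℝ)))

end StochOpt

end

/-!
The samples are split into three blocks of equal length. The first one serves to measure the true
sizes of the gradients; the estimates `Lhat` and `ℓhat` only fix the resolution of that measurement.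
In units of these scales, follow-the-regularized-leader at radius `ρ`, with one regularizer for each
of the three geometries (the hyperbolic entropy for the `1`-norm), has regret of order `ρ * n`
against all points of size at most `ρ` in any of the geometries. Run on the second block, it yields
a candidate for every radius `2 ^ k`.

The third block selects a candidate by minimizing the empirical risk plus a penalty proportional to
the radius. By the regret bound for a fictitious run on the third block, started near a minimizer,
no candidate of radius `ρ` gains more than order `ρ * n` over that point, so the penalty rules out
all radii that are too large. For the small radii, the deviation bounds can be summed, since the
radii decay geometrically while the confidence has to grow only linearly.

All points are taken from a dense sequence and all gradients are rounded to a lattice, so the state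
of the algorithm is countable and no measurable selection of the leaders is needed.
-/

noncomputable section

namespace StochOpt

open scoped ENNReal

section Predictable

variable {𝒮 : Type*} [MeasurableSpace 𝒮] {n : ℕ} {β β' α : Type*}

/-- A function of `n` samples is predictable at time `t` if it depends only on the samples with
index below `t` and has measurable fibres. This is used for countable codomains only, where
measurability of the fibres makes all further measurability questions trivial. -/
structure Predictable (t : ℕ) (h : (Fin n → 𝒮) → β) : Prop where
  congr : ∀ S S' : Fin n → 𝒮, (∀ i : Fin n, (i : ℕ) < t → S i = S' i) → h S = h S'
  measurableSet_fiber : ∀ b, MeasurableSet {S | h S = b}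

namespace Predictable

lemma const (t : ℕ) (b : β) : Predictable t (fun _ : Fin n → 𝒮 => b) :=
  ⟨fun _ _ _ => rfl, fun _ => MeasurableSet.const _⟩

lemma mono {t t' : ℕ} {h : (Fin n → 𝒮) → β} (H : Predictable t h) (ht : t ≤ t') :
    Predictable t' h :=
  ⟨fun S S' hS => H.congr S S' fun i hi => hS i (hi.trans_le ht), H.measurableSet_fiber⟩

lemma map₂ [Countable β] [Countable β'] {t : ℕ} {h : (Fin n → 𝒮) → β} {h' : (Fin n → 𝒮) → β'}
    (H : Predictable t h) (H' : Predictable t h') (φ : β → β' → α) :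
    Predictable t (fun S => φ (h S) (h' S)) := by
  refine ⟨fun S S' hS => by rw [H.congr S S' hS, H'.congr S S' hS], fun b => ?_⟩
  have : {S | φ (h S) (h' S) = b} =
      ⋃ c, ⋃ c', ({S | h S = c} ∩ {S | h' S = c'} ∩ {_S | φ c c' = b}) := by
    ext S; simp
  rw [this]
  exact MeasurableSet.iUnion fun c => MeasurableSet.iUnion fun c' =>
    ((H.measurableSet_fiber c).inter (H'.measurableSet_fiber c')).inter (MeasurableSet.const _)

lemma map [Countable β] {t : ℕ} {h : (Fin n → 𝒮) → β} (H : Predictable t h) (φ : β → β') :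
    Predictable t (fun S => φ (h S)) :=
  H.map₂ (const t ()) fun b _ => φ b

lemma pi {ι : Type*} [Countable ι] {t : ℕ} {h : (Fin n → 𝒮) → ι → β}
    (H : ∀ i, Predictable t (fun S => h S i)) : Predictable t h := by
  refine ⟨fun S S' hS => funext fun i => (H i).congr S S' hS, fun b => ?_⟩
  have : {S | h S = b} = ⋂ i, {S | h S i = b i} := by
    ext S; simp [funext_iff]
  rw [this]
  exact MeasurableSet.iInter fun i => (H i).measurableSet_fiber _

lemma apply_update {t : ℕ} {h : (Fin n → 𝒮) → β} (H : Predictable t h) {i : Fin n}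
    (hi : t ≤ i) (S : Fin n → 𝒮) (s : 𝒮) : h (Function.update S i s) = h S :=
  H.congr _ _ fun j hj => Function.update_of_ne (fun hji => by subst hji; omega) _ _

lemma measurable_eval [Countable β] {t : ℕ} {h : (Fin n → 𝒮) → β} (H : Predictable t h)
    {E : Type*} [MeasurableSpace E] (i : Fin n) {φ : β → 𝒮 → E} (hφ : ∀ b, Measurable (φ b)) :
    Measurable (fun S => φ (h S) (S i)) := by
  intro A hA
  have : (fun S => φ (h S) (S i)) ⁻¹' A = ⋃ b, ({S | h S = b} ∩ {S | φ b (S i) ∈ A}) := by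
    ext S; simp
  rw [this]
  exact MeasurableSet.iUnion fun b => (H.measurableSet_fiber b).inter
    (measurableSet_preimage ((hφ b).comp (measurable_pi_apply (X := fun _ : Fin n => 𝒮) i)) hA)

lemma succ [NeZero n] [Countable β] {t : ℕ} (ht : t < n) {h : (Fin n → 𝒮) → β}
    (H : Predictable t h) {φ : β → 𝒮 → β'} (hφ : ∀ b b', MeasurableSet {s | φ b s = b'}) :
    Predictable (t + 1) (fun S => φ (h S) (S (Fin.ofNat n t))) := by
  refine ⟨fun S S' hS => ?_, fun b' => ?_⟩
  · rw [H.congr S S' fun i hi => hS i (by omega), hS (Fin.ofNat n t)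
      (by simp [Fin.ofNat, Nat.mod_eq_of_lt ht])]
  · have : {S | φ (h S) (S (Fin.ofNat n t)) = b'} =
        ⋃ b, ({S | h S = b} ∩ {S | φ b (S (Fin.ofNat n t)) = b'}) := by
      ext S; simp
    rw [this]
    exact MeasurableSet.iUnion fun b => (H.measurableSet_fiber b).inter
      (measurableSet_preimage (measurable_pi_apply (X := fun _ : Fin n => 𝒮) (Fin.ofNat n t))
        (hφ b b'))

end Predictable

variable (P : Measure 𝒮) [IsProbabilityMeasure P]

lemma lintegral_prod_predictable_le_one [NeZero n] [Countable β] {lo N : ℕ} (hN : lo + N ≤ n)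
    {h : ℕ → (Fin n → 𝒮) → β} (H : ∀ i < N, Predictable (lo + i) (h i))
    {ζ : β → 𝒮 → ℝ≥0∞} (hζ : ∀ b, Measurable (ζ b)) (hζ1 : ∀ b, ∫⁻ s, ζ b s ∂P ≤ 1) :
    ∫⁻ S, ∏ i ∈ Finset.range N, ζ (h i S) (S (Fin.ofNat n (lo + i)))
      ∂(Measure.pi fun _ : Fin n => P) ≤ 1 := by
  induction N with
  | zero => simp
  | succ m ih =>
    refine le_trans ?_ (ih (by omega) fun i hi => H i (by omega))
    have hmeas : ∀ k ≤ m + 1, Measurable fun S : Fin n → 𝒮 =>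
        ∏ i ∈ Finset.range k, ζ (h i S) (S (Fin.ofNat n (lo + i))) := fun k hk =>
      Finset.measurable_prod _ fun i hi =>
        (H i (by simp at hi; omega)).measurable_eval _ hζ
    have hval : ∀ i ≤ m, (Fin.ofNat n (lo + i) : ℕ) = lo + i := fun i hi =>
      Nat.mod_eq_of_lt (by omega)
    set last : Fin n := Fin.ofNat n (lo + m) with hlast
    -- Integrating out the last sample first leaves all the earlier factors untouched.
    refine lintegral_le_of_lmarginal_le {last} (hmeas _ le_rfl) (hmeas m (by omega)) fun S => ?_
    rw [lmarginal_singleton, lmarginal_singleton]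
    have hstate : ∀ s, ∀ i ≤ m, h i (Function.update S last s) = h i S := fun s i hi =>
      (H i (by omega)).apply_update (by rw [hlast, hval m le_rfl]; omega) S s
    have hprod : ∀ s, (∏ i ∈ Finset.range m, ζ (h i (Function.update S last s))
          (Function.update S last s (Fin.ofNat n (lo + i)))) =
        ∏ i ∈ Finset.range m, ζ (h i S) (S (Fin.ofNat n (lo + i))) := fun s => by
      refine Finset.prod_congr rfl fun i hi => ?_
      have him : i < m := by simpa using hi
      rw [hstate s i him.le, Function.update_of_ne]
      intro heq
      have := congrArg Fin.val heq
      rw [hlast, hval m le_rfl, hval i him.le] at this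
      omega
    simp only [Finset.prod_range_succ, hprod, ← hlast, hstate _ m le_rfl, Function.update_self]
    rw [lintegral_const_mul _ (hζ _), lintegral_const, measure_univ]
    gcongr
    exact hζ1 _

lemma measure_le_sum_predictable_le [NeZero n] [Countable β] {lo N : ℕ} (hN : lo + N ≤ n)
    {h : ℕ → (Fin n → 𝒮) → β} (H : ∀ i < N, Predictable (lo + i) (h i))
    {ξ : β → 𝒮 → ℝ} (hξ : ∀ b, Measurable (ξ b))
    (hξ1 : ∀ b, ∫⁻ s, ENNReal.ofReal (Real.exp (ξ b s)) ∂P ≤ 1) (c : ℝ) :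
    (Measure.pi fun _ : Fin n => P)
      {S | c ≤ ∑ i ∈ Finset.range N, ξ (h i S) (S (Fin.ofNat n (lo + i)))} ≤
      ENNReal.ofReal (Real.exp (-c)) := by
  let ζ : β → 𝒮 → ℝ≥0∞ := fun b s => ENNReal.ofReal (Real.exp (ξ b s))
  have hζ : ∀ b, Measurable (ζ b) := fun b => (hξ b).exp.ennreal_ofReal
  have hmean := lintegral_prod_predictable_le_one P hN H hζ hξ1
  have hsub : {S : Fin n → 𝒮 |
      c ≤ ∑ i ∈ Finset.range N, ξ (h i S) (S (Fin.ofNat n (lo + i)))} ⊆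
      {S | ENNReal.ofReal (Real.exp c) ≤ ∏ i ∈ Finset.range N,
        ζ (h i S) (S (Fin.ofNat n (lo + i)))} := by
    intro S hS
    simp only [Set.mem_ofPred_eq, ζ] at hS ⊢
    rw [← ENNReal.ofReal_prod_of_nonneg (fun i _ => (Real.exp_pos _).le), ← Real.exp_sum]
    exact ENNReal.ofReal_le_ofReal (Real.exp_le_exp.2 hS)
  have hmeas : AEMeasurable (fun S : Fin n → 𝒮 => ∏ i ∈ Finset.range N,
      ζ (h i S) (S (Fin.ofNat n (lo + i)))) (Measure.pi fun _ : Fin n => P) :=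
    (Finset.measurable_prod _ fun i hi =>
      (H i (by simpa using hi)).measurable_eval _ hζ).aemeasurable
  refine (measure_mono hsub).trans ((meas_ge_le_lintegral_div hmeas ?_ ?_).trans ?_)
  · simp [Real.exp_pos]
  · simp
  · rw [Real.exp_neg, ENNReal.ofReal_inv_of_pos (Real.exp_pos _), ← one_div]
    gcongr

open Classical in
lemma measure_forall_and_le_sum_predictable_le [NeZero n] [Countable β] {lo N : ℕ}
    (hN : lo + N ≤ n) {h : ℕ → (Fin n → 𝒮) → β} (H : ∀ i < N, Predictable (lo + i) (h i))
    {ξ : β → 𝒮 → ℝ} (hξ : ∀ b, Measurable (ξ b)) {p : β → Prop}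
    (hξ1 : ∀ b, p b → ∫⁻ s, ENNReal.ofReal (Real.exp (ξ b s)) ∂P ≤ 1) (c : ℝ) :
    (Measure.pi fun _ : Fin n => P)
      {S | (∀ i < N, p (h i S)) ∧
        c ≤ ∑ i ∈ Finset.range N, ξ (h i S) (S (Fin.ofNat n (lo + i)))} ≤
      ENNReal.ofReal (Real.exp (-c)) := by
  have hξ' : ∀ b, Measurable fun s => if p b then ξ b s else 0 := fun b => by
    split_ifs
    exacts [hξ b, measurable_const]
  have hξ1' : ∀ b, ∫⁻ s, ENNReal.ofReal (Real.exp (if p b then ξ b s else 0)) ∂P ≤ 1 := fun b => by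
    split_ifs with hb
    exacts [hξ1 b hb, by simp]
  refine (measure_mono ?_).trans (measure_le_sum_predictable_le P hN H hξ' hξ1' c)
  rintro S ⟨hp, hc⟩
  refine hc.trans_eq (Finset.sum_congr rfl fun i hi => ?_)
  rw [if_pos (hp i (Finset.mem_range.1 hi))]

end Predictable

section ExpMoment

variable {𝒮 : Type*} [MeasurableSpace 𝒮] (P : Measure 𝒮)

lemma integrable_of_abs_le [IsFiniteMeasure P] {X : 𝒮 → ℝ} (hX : Measurable X) {b : ℝ}
    (hb : ∀ s, |X s| ≤ b) : Integrable X P :=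
  Integrable.of_bound hX.aestronglyMeasurable b (ae_of_all _ hb)

variable [IsProbabilityMeasure P]

lemma lintegral_exp_sub_le_one {X Y : 𝒮 → ℝ} (hXY : ∀ s, Real.exp (X s) ≤ 1 + Y s)
    (hY : Integrable Y P) {c : ℝ} (hc : ∫ s, Y s ∂P ≤ c) :
    ∫⁻ s, ENNReal.ofReal (Real.exp (X s - c)) ∂P ≤ 1 := by
  have hint : Integrable (fun s => (1 + Y s) * Real.exp (-c)) P :=
    ((integrable_const 1).add hY).mul_const _
  calc ∫⁻ s, ENNReal.ofReal (Real.exp (X s - c)) ∂P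
      ≤ ∫⁻ s, ENNReal.ofReal ((1 + Y s) * Real.exp (-c)) ∂P := by
        refine lintegral_mono fun s => ENNReal.ofReal_le_ofReal ?_
        rw [sub_eq_add_neg, Real.exp_add]
        exact mul_le_mul_of_nonneg_right (hXY s) (Real.exp_pos _).le
    _ = ENNReal.ofReal (∫ s, (1 + Y s) * Real.exp (-c) ∂P) := by
        rw [ofReal_integral_eq_lintegral_ofReal hint]
        exact ae_of_all _ fun s =>
          mul_nonneg ((Real.exp_pos _).le.trans (hXY s)) (Real.exp_pos _).le
    _ ≤ 1 := by
        rw [ENNReal.ofReal_le_one, integral_mul_const, integral_add (integrable_const 1) hY]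
        simp only [integral_const, probReal_univ, smul_eq_mul, one_mul]
        calc (1 + ∫ s, Y s ∂P) * Real.exp (-c) ≤ Real.exp c * Real.exp (-c) := by
              gcongr
              linarith [Real.add_one_le_exp c]
          _ = 1 := by rw [← Real.exp_add, add_neg_cancel, Real.exp_zero]

lemma exp_le_one_add_add_sq {x : ℝ} (hx : |x| ≤ 1) : Real.exp x ≤ 1 + (x + x ^ 2) := by
  linarith [(abs_le.1 (Real.abs_exp_sub_one_sub_id_le hx)).2]

lemma lintegral_exp_centered_le_one {X : 𝒮 → ℝ} (hX : Measurable X) (hb : ∀ s, |X s| ≤ 1)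
    {v : ℝ} (hv : ∫ s, X s ^ 2 ∂P ≤ v) :
    ∫⁻ s, ENNReal.ofReal (Real.exp (X s - ∫ s, X s ∂P - v)) ∂P ≤ 1 := by
  have hX1 := integrable_of_abs_le P hX hb
  have hX2 : Integrable (fun s => X s ^ 2) P :=
    integrable_of_abs_le P (hX.pow_const 2) (b := 1) fun s => by
      rw [abs_of_nonneg (sq_nonneg _)]; exact (sq_le_one_iff_abs_le_one _).2 (hb s)
  simpa only [sub_sub] using lintegral_exp_sub_le_one P (X := X) (Y := fun s => X s + X s ^ 2)
    (c := ∫ s, X s ∂P + v) (fun s => exp_le_one_add_add_sq (hb s)) (hX1.add hX2)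
    (by rw [integral_add hX1 hX2]; linarith)

variable {X : 𝒮 → ℝ} (hX : Measurable X) (h0 : ∀ s, 0 ≤ X s) (h1 : ∀ s, X s ≤ 1)
include hX h0 h1

lemma lintegral_exp_sub_two_mul_le_one {v : ℝ} (hv : ∫ s, X s ∂P ≤ v) :
    ∫⁻ s, ENNReal.ofReal (Real.exp (X s - 2 * v)) ∂P ≤ 1 := by
  have hb : ∀ s, |X s| ≤ 1 := fun s => by rw [abs_of_nonneg (h0 s)]; exact h1 s
  refine lintegral_exp_sub_le_one P (Y := fun s => 2 * X s) (fun s => ?_)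
    ((integrable_of_abs_le P hX hb).const_mul 2) (by rw [integral_const_mul]; linarith)
  nlinarith [exp_le_one_add_add_sq (hb s), h0 s, h1 s]

lemma lintegral_exp_integral_sub_le_one :
    ∫⁻ s, ENNReal.ofReal (Real.exp ((∫ s, X s ∂P) / 4 - X s / 2)) ∂P ≤ 1 := by
  have hb : ∀ s, |X s| ≤ 1 := fun s => by rw [abs_of_nonneg (h0 s)]; exact h1 s
  have hexp : ∀ s, Real.exp (-X s / 2) ≤ 1 + -(1 / 4) * X s := fun s => by
    have hhalf : |(-X s / 2)| ≤ 1 := abs_le.2 ⟨by linarith [h1 s], by linarith [h0 s]⟩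
    nlinarith [exp_le_one_add_add_sq hhalf, h0 s, h1 s]
  refine (lintegral_congr fun s => ?_).trans_le
    (lintegral_exp_sub_le_one P (c := -(∫ s, X s ∂P) / 4) hexp
      ((integrable_of_abs_le P hX hb).const_mul _) (by rw [integral_const_mul]; linarith))
  congr 2; ring

end ExpMoment

section Hypentropy

/-- The defect of convexity of `ψ` at the midpoint of `v` and `w`. A lower bound on it is how strong
convexity enters the analysis of the algorithm, as no derivative of `ψ` is needed then. -/
def midpointGap {E : Type*} [AddCommGroup E] [Module ℝ E] (ψ : E → ℝ) (v w : E) : ℝ :=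
  1 / 2 * ψ v + 1 / 2 * ψ w - ψ ((1 / 2 : ℝ) • v + (1 / 2 : ℝ) • w)

/-- The hyperbolic entropy, which is the primitive of `arsinh` that vanishes at `0`. Its second
derivative `1 / √(1 + t ^ 2)` is comparable to that of the entropy `|t| log |t|` for large `t`, and
there is no singularity at `0`. -/
def hypentropy (t : ℝ) : ℝ := t * Real.arsinh t - √(1 + t ^ 2) + 1

lemma hasDerivAt_hypentropy (t : ℝ) : HasDerivAt hypentropy (Real.arsinh t) t := by
  have hpos : 0 < 1 + t ^ 2 := by positivity
  have hsqrt : HasDerivAt (fun t : ℝ => √(1 + t ^ 2)) (2 * t / (2 * √(1 + t ^ 2))) t :=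
    HasDerivAt.sqrt (by simpa using (hasDerivAt_pow 2 t).const_add 1) hpos.ne'
  have hderiv : 1 * Real.arsinh t + id t * (√(1 + t ^ 2))⁻¹ - 2 * t / (2 * √(1 + t ^ 2)) =
      Real.arsinh t := by
    rw [mul_div_mul_left _ _ two_ne_zero, div_eq_mul_inv, id]
    ring
  exact hderiv ▸ (((hasDerivAt_id t).mul (Real.hasDerivAt_arsinh t)).sub hsqrt).add_const 1

lemma continuous_hypentropy : Continuous hypentropy :=
  continuous_iff_continuousAt.2 fun t => (hasDerivAt_hypentropy t).continuousAt

lemma hypentropy_zero : hypentropy 0 = 0 := by simp [hypentropy]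

lemma monotoneOn_arsinh_sub_mul (R : ℝ) :
    MonotoneOn (fun t => Real.arsinh t - 1 / (R + 1) * t) (Set.Icc (-R) R) := by
  refine monotoneOn_of_deriv_nonneg (convex_Icc _ _) ?_ ?_ fun t ht => ?_
  · exact (Real.continuous_arsinh.sub (continuous_const.mul continuous_id)).continuousOn
  · exact (Real.differentiable_arsinh.sub
      ((differentiable_const _).mul differentiable_id)).differentiableOn
  · rw [interior_Icc] at ht
    have hR : 0 < R := by linarith [ht.1, ht.2]
    have hderiv : HasDerivAt (fun t => Real.arsinh t - 1 / (R + 1) * t)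
        ((√(1 + t ^ 2))⁻¹ - 1 / (R + 1) * 1) t :=
      (Real.hasDerivAt_arsinh t).sub ((hasDerivAt_id t).const_mul _)
    rw [hderiv.deriv, mul_one, sub_nonneg, one_div]
    refine inv_anti₀ (Real.sqrt_pos.2 (by positivity)) ?_
    rw [Real.sqrt_le_left (by linarith)]
    nlinarith [ht.1, ht.2]

lemma convexOn_hypentropy_sub_sq (R : ℝ) :
    ConvexOn ℝ (Set.Icc (-R) R) (fun t => hypentropy t - 1 / (R + 1) * (t ^ 2 / 2)) := by
  have hderiv : ∀ t, HasDerivAt (fun t => hypentropy t - 1 / (R + 1) * (t ^ 2 / 2))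
      (Real.arsinh t - 1 / (R + 1) * t) t := fun t => by
    refine (hasDerivAt_hypentropy t).sub (HasDerivAt.const_mul _ ?_)
    simpa using (hasDerivAt_pow 2 t).div_const 2
  refine MonotoneOn.convexOn_of_deriv (convex_Icc _ _)
    (fun t _ => (hderiv t).continuousAt.continuousWithinAt)
    (fun t _ => (hderiv t).differentiableAt.differentiableWithinAt) fun a ha b hb hab => ?_
  rw [(hderiv a).deriv, (hderiv b).deriv]
  exact monotoneOn_arsinh_sub_mul R (interior_subset ha) (interior_subset hb) hab

lemma sq_sub_div_le_midpointGap_hypentropy (x y : ℝ) :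
    (x - y) ^ 2 / (8 * (|x| + |y| + 1)) ≤ midpointGap hypentropy x y := by
  set R := |x| + |y| with hR
  have hR0 : 0 ≤ R := by positivity
  have hx : x ∈ Set.Icc (-R) R := abs_le.1 (by rw [hR]; linarith [abs_nonneg y])
  have hy : y ∈ Set.Icc (-R) R := abs_le.1 (by rw [hR]; linarith [abs_nonneg x])
  have hconvex := (convexOn_hypentropy_sub_sq R).2 hx hy (show (0 : ℝ) ≤ 1 / 2 by norm_num)
    (show (0 : ℝ) ≤ 1 / 2 by norm_num) (by norm_num)
  simp only [smul_eq_mul] at hconvex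
  have hgap : (x - y) ^ 2 / (8 * (R + 1)) = 1 / 2 * (1 / (R + 1) * (x ^ 2 / 2)) +
      1 / 2 * (1 / (R + 1) * (y ^ 2 / 2)) -
      1 / (R + 1) * ((1 / 2 * x + 1 / 2 * y) ^ 2 / 2) := by
    field_simp
    ring
  simp only [midpointGap, smul_eq_mul]
  linarith

lemma hypentropy_nonneg (t : ℝ) : 0 ≤ hypentropy t := by
  have hneg : hypentropy (-t) = hypentropy t := by simp [hypentropy, Real.arsinh_neg]
  have hgap := sq_sub_div_le_midpointGap_hypentropy t (-t)
  rw [midpointGap, smul_eq_mul, smul_eq_mul, hneg, show 1 / 2 * t + 1 / 2 * -t = 0 by ring,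
    hypentropy_zero] at hgap
  have : 0 ≤ (t - -t) ^ 2 / (8 * (|t| + |(-t)| + 1)) := by positivity
  linarith

lemma arsinh_le_two_mul_log {t : ℝ} (ht : 0 ≤ t) : Real.arsinh t ≤ 2 * Real.log (1 + t) := by
  have hsqrt : √(1 + t ^ 2) ≤ 1 + t := by
    rw [Real.sqrt_le_left (by linarith)]; nlinarith
  have hpos : 0 < √(1 + t ^ 2) := Real.sqrt_pos.2 (by positivity)
  calc Real.arsinh t ≤ Real.log ((1 + t) ^ 2) :=
        Real.log_le_log (by linarith) (by nlinarith)
    _ = 2 * Real.log (1 + t) := by rw [Real.log_pow, Nat.cast_two]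

lemma hypentropy_le (t : ℝ) : hypentropy t ≤ |t| * (2 * Real.log (1 + |t|)) := by
  have hsqrt : (1 : ℝ) ≤ √(1 + t ^ 2) := by
    rw [Real.one_le_sqrt]; nlinarith [sq_nonneg t]
  have habs : t * Real.arsinh t ≤ |t| * Real.arsinh |t| := by
    rcases le_total 0 t with h | h
    · rw [abs_of_nonneg h]
    · rw [abs_of_nonpos h, Real.arsinh_neg]; linarith
  have hlog := mul_le_mul_of_nonneg_left (arsinh_le_two_mul_log (abs_nonneg t)) (abs_nonneg t)
  unfold hypentropy
  linarith

/-- The rescaled sum of the hyperbolic entropies of the coordinates, which is strongly convex with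
respect to the `1`-norm on the unit ball of that norm and at most logarithmic in `d` there. -/
def vecHypentropy {d : ℕ} (v : Fin d → ℝ) : ℝ := ∑ j, hypentropy (d * v j) / d

variable {d : ℕ}

lemma continuous_vecHypentropy : Continuous (vecHypentropy (d := d)) :=
  continuous_finsetSum _ fun j _ =>
    (continuous_hypentropy.comp (continuous_const.mul (continuous_apply j))).div_const _

lemma vecHypentropy_nonneg (v : Fin d → ℝ) : 0 ≤ vecHypentropy v :=
  Finset.sum_nonneg fun _ _ => div_nonneg (hypentropy_nonneg _) (Nat.cast_nonneg _)

lemma vecHypentropy_le {v : Fin d → ℝ} (hv : ∑ j, |v j| ≤ 1) :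
    vecHypentropy v ≤ 2 * Real.log (1 + d) := by
  have hlog : 0 ≤ Real.log (1 + d) := Real.log_nonneg (by linarith [d.cast_nonneg (α := ℝ)])
  have hterm : ∀ j, hypentropy (d * v j) / d ≤ |v j| * (2 * Real.log (1 + d)) := fun j => by
    have hd : (0 : ℝ) < d := Nat.cast_pos.2 j.pos
    have hj : |v j| ≤ 1 :=
      (Finset.single_le_sum (f := fun j => |v j|) (fun _ _ => abs_nonneg _)
        (Finset.mem_univ j)).trans hv
    have habs : |(d : ℝ) * v j| = d * |v j| := by rw [abs_mul, abs_of_pos hd]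
    rw [div_le_iff₀ hd]
    calc hypentropy (d * v j) ≤ d * |v j| * (2 * Real.log (1 + d * |v j|)) :=
          habs ▸ hypentropy_le (d * v j)
      _ ≤ d * |v j| * (2 * Real.log (1 + d)) := by
          gcongr
          exact mul_le_of_le_one_right hd.le hj
      _ = _ := by ring
  calc vecHypentropy v ≤ ∑ j, |v j| * (2 * Real.log (1 + d)) :=
        Finset.sum_le_sum fun j _ => hterm j
    _ = (∑ j, |v j|) * (2 * Real.log (1 + d)) := by rw [Finset.sum_mul]
    _ ≤ 2 * Real.log (1 + d) := mul_le_of_le_one_left (by positivity) hv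

lemma sq_sub_div_le_midpointGap_hypentropy_mul {D : ℝ} (hD : 0 < D) (x y : ℝ) :
    |x - y| ^ 2 / (8 * (|x| + |y| + 1 / D)) ≤
      midpointGap (fun x => hypentropy (D * x) / D) x y := by
  have hgap := sq_sub_div_le_midpointGap_hypentropy (D * x) (D * y)
  rw [abs_mul, abs_mul, abs_of_pos hD] at hgap
  calc |x - y| ^ 2 / (8 * (|x| + |y| + 1 / D))
      = (D * x - D * y) ^ 2 / (8 * (D * |x| + D * |y| + 1)) / D := by
        rw [sq_abs]; field_simp
    _ ≤ midpointGap hypentropy (D * x) (D * y) / D := by gcongr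
    _ = _ := by
        simp only [midpointGap, smul_eq_mul, mul_add, mul_left_comm D]
        ring

lemma sq_sum_abs_sub_le_midpointGap_vecHypentropy {v w : Fin d → ℝ} (hv : ∑ j, |v j| ≤ 1)
    (hw : ∑ j, |w j| ≤ 1) :
    (∑ j, |v j - w j|) ^ 2 / 24 ≤ midpointGap vecHypentropy v w := by
  rcases Nat.eq_zero_or_pos d with rfl | hd
  · simp [midpointGap, vecHypentropy]
  have : Nonempty (Fin d) := ⟨⟨0, hd⟩⟩
  have hcauchy := Finset.sq_sum_div_le_sum_sq_div Finset.univ (fun j => |v j - w j|)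
    (g := fun j => 8 * (|v j| + |w j| + 1 / d)) (fun _ _ => by positivity)
  have hden : ∑ j, 8 * (|v j| + |w j| + 1 / (d : ℝ)) ≤ 24 := by
    have hone : ∑ _j : Fin d, 1 / (d : ℝ) = 1 := by simp; field_simp
    rw [← Finset.mul_sum, Finset.sum_add_distrib, Finset.sum_add_distrib]
    linarith
  have hden_pos : 0 < ∑ j, 8 * (|v j| + |w j| + 1 / (d : ℝ)) :=
    Finset.sum_pos (fun j _ => by positivity) Finset.univ_nonempty
  calc (∑ j, |v j - w j|) ^ 2 / 24
      ≤ (∑ j, |v j - w j|) ^ 2 / ∑ j, 8 * (|v j| + |w j| + 1 / (d : ℝ)) :=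
        div_le_div_of_nonneg_left (sq_nonneg _) hden_pos hden
    _ ≤ ∑ j, |v j - w j| ^ 2 / (8 * (|v j| + |w j| + 1 / (d : ℝ))) := hcauchy
    _ ≤ _ := Finset.sum_le_sum fun j _ =>
        sq_sub_div_le_midpointGap_hypentropy_mul (Nat.cast_pos.2 hd) (v j) (w j)
    _ = _ := by
      simp only [midpointGap, vecHypentropy, Pi.add_apply, Pi.smul_apply,
        Finset.sum_sub_distrib, Finset.sum_add_distrib, ← Finset.mul_sum]

end Hypentropy

section Gauges

variable {d : ℕ}

lemma inner_eq_sum (g x : Vec d) : inner ℝ g x = ∑ j, g j * x j := by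
  rw [PiLp.inner_apply]
  exact Finset.sum_congr rfl fun j _ => by simp [mul_comm]

lemma abs_le_normInf (v : Fin d → ℝ) (j : Fin d) : |v j| ≤ normInf v := norm_le_pi_norm v j

lemma norm1_nonneg (v : Fin d → ℝ) : 0 ≤ norm1 v := Finset.sum_nonneg fun j _ => abs_nonneg (v j)

lemma normInf_nonneg (v : Fin d → ℝ) : 0 ≤ normInf v := norm_nonneg v

lemma normInf_le {v : Fin d → ℝ} {r : ℝ} (hr : 0 ≤ r) (h : ∀ j, |v j| ≤ r) : normInf v ≤ r :=
  (pi_norm_le_iff_of_nonneg hr).2 h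

/-- Index set of the sizes of gradients that the algorithm monitors: `none` stands for the `2`-norm,
`some none` for the `∞`-norm and `some (some j)` for the `j`-th coordinate. -/
abbrev GaugeIdx (d : ℕ) : Type := Option (Option (Fin d))

/-- The size of a gradient with the given index. -/
def gaugeVal : GaugeIdx d → Vec d → ℝ
  | none, g => ‖g‖
  | some none, g => normInf g
  | some (some j), g => |g j|

lemma gaugeVal_nonneg : ∀ (i : GaugeIdx d) (g : Vec d), 0 ≤ gaugeVal i g
  | none, g => norm_nonneg g
  | some none, g => normInf_nonneg g
  | some (some j), g => abs_nonneg (g j)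

lemma gaugeVal_add_le : ∀ (i : GaugeIdx d) (g h : Vec d),
    gaugeVal i (g + h) ≤ gaugeVal i g + gaugeVal i h
  | none, g, h => norm_add_le g h
  | some none, g, h => norm_add_le (g : Fin d → ℝ) h
  | some (some j), g, h => abs_add_le (g j) (h j)

lemma gaugeVal_le_mul {τ : ℝ} (hτ : 0 ≤ τ) {g : Vec d} (hg : ∀ j, |g j| ≤ τ) :
    ∀ i : GaugeIdx d, gaugeVal i g ≤ (1 + √d) * τ
  | none => by
    have hsq : ‖g‖ ^ 2 ≤ (√d * τ) ^ 2 := by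
      rw [EuclideanSpace.norm_sq_eq, mul_pow, Real.sq_sqrt d.cast_nonneg]
      refine (Finset.sum_le_sum (g := fun _ => τ ^ 2) fun j _ => ?_).trans (by simp)
      exact pow_le_pow_left₀ (norm_nonneg _) (hg j) 2
    change ‖g‖ ≤ _
    linarith [abs_le_of_sq_le_sq' hsq (by positivity)]
  | some none => (normInf_le hτ hg).trans (by nlinarith [Real.sqrt_nonneg d])
  | some (some j) => (hg j).trans (by nlinarith [Real.sqrt_nonneg d])

/-- The weights of the squared sizes of a gradient in the squared dual norm of the geometry with
scales `s`. They are such that the total of the squared scales is at most `3`. -/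
def gaugeWeight (s : GaugeIdx d → ℝ) : GaugeIdx d → ℝ
  | none => 1 / s none ^ 2
  | some none => 1 / s (some none) ^ 2
  | some (some j) => 1 / (s (some (some j)) * ∑ i, s (some (some i)))

/-- The total of the squared sizes `m` in units of the scales `s`. -/
def weightedSum (s m : GaugeIdx d → ℝ) : ℝ := ∑ i, gaugeWeight s i * m i

variable {s : GaugeIdx d → ℝ}

lemma gaugeWeight_nonneg (hs : ∀ i, 0 < s i) : ∀ i, 0 ≤ gaugeWeight s i
  | none => by rw [gaugeWeight]; positivity
  | some none => by rw [gaugeWeight]; positivity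
  | some (some j) => one_div_nonneg.2 <|
      mul_nonneg (hs _).le (Finset.sum_nonneg fun _ _ => (hs _).le)

lemma weightedSum_eq (s m : GaugeIdx d → ℝ) :
    weightedSum s m = gaugeWeight s none * m none + (gaugeWeight s (some none) * m (some none) +
      ∑ j, gaugeWeight s (some (some j)) * m (some (some j))) := by
  rw [weightedSum, Fintype.sum_option, Fintype.sum_option]

lemma weightedSum_mono (hs : ∀ i, 0 < s i) {m m' : GaugeIdx d → ℝ} (h : ∀ i, m i ≤ m' i) :
    weightedSum s m ≤ weightedSum s m' :=
  Finset.sum_le_sum fun i _ => mul_le_mul_of_nonneg_left (h i) (gaugeWeight_nonneg hs i)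

lemma weightedSum_nonneg (hs : ∀ i, 0 < s i) {m : GaugeIdx d → ℝ} (hm : ∀ i, 0 ≤ m i) :
    0 ≤ weightedSum s m :=
  Finset.sum_nonneg fun i _ => mul_nonneg (gaugeWeight_nonneg hs i) (hm i)

lemma weightedSum_const_mul (s : GaugeIdx d → ℝ) (c : ℝ) (m : GaugeIdx d → ℝ) :
    weightedSum s (fun i => c * m i) = c * weightedSum s m := by
  simp only [weightedSum, Finset.mul_sum, mul_left_comm]

lemma weightedSum_sq_le (hs : ∀ i, 0 < s i) : weightedSum s (fun i => s i ^ 2) ≤ 3 := by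
  have hcoord (j : Fin d) : gaugeWeight s (some (some j)) * s (some (some j)) ^ 2 =
      s (some (some j)) / ∑ i, s (some (some i)) := by
    have := hs (some (some j))
    rw [gaugeWeight, one_div_mul_eq_div, sq, mul_div_mul_left _ _ this.ne']
  rw [weightedSum_eq, gaugeWeight, gaugeWeight, one_div_mul_cancel (pow_pos (hs _) 2).ne',
    one_div_mul_cancel (pow_pos (hs _) 2).ne', Finset.sum_congr rfl fun j _ => hcoord j,
    ← Finset.sum_div]
  linarith [div_self_le_one (∑ j, s (some (some j)))]

lemma weightedSum_le (hs : ∀ i, 0 < s i) {c : ℝ} (hc : 0 ≤ c) {m : GaugeIdx d → ℝ}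
    (hm : ∀ i, m i ≤ c * s i ^ 2) : weightedSum s m ≤ 3 * c := by
  calc weightedSum s m ≤ c * weightedSum s (fun i => s i ^ 2) :=
        weightedSum_const_mul s c _ ▸ weightedSum_mono hs hm
    _ ≤ c * 3 := by gcongr; exact weightedSum_sq_le hs
    _ = 3 * c := mul_comm _ _

end Gauges

section UnitBlocks

variable {d : ℕ}

/-- The space of parameters of the algorithm, with one block for each of the three geometries. -/
abbrev Blocks (d : ℕ) : Type := (Fin d → ℝ) × (Fin d → ℝ) × (Fin d → ℝ)

/-- The product of the unit balls of the `2`-norm, the `1`-norm and the `2`-norm. -/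
def unitBlocks (d : ℕ) : Set (Blocks d) :=
  {v | ∑ j, v.1 j ^ 2 ≤ 1 ∧ ∑ j, |v.2.1 j| ≤ 1 ∧ ∑ j, v.2.2 j ^ 2 ≤ 1}

lemma zero_mem_unitBlocks : (0 : Blocks d) ∈ unitBlocks d := by
  simp [unitBlocks]

lemma neg_mem_unitBlocks {v : Blocks d} (hv : v ∈ unitBlocks d) : -v ∈ unitBlocks d := by
  simpa [unitBlocks] using hv

lemma convexOn_sum_apply {φ : ℝ → ℝ} (hφ : ConvexOn ℝ Set.univ φ) :
    ConvexOn ℝ Set.univ fun v : Fin d → ℝ => ∑ j, φ (v j) := by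
  refine ⟨convex_univ, fun v _ w _ a b ha hb hab => ?_⟩
  simp only [Finset.smul_sum, ← Finset.sum_add_distrib]
  exact Finset.sum_le_sum fun j _ => hφ.2 (Set.mem_univ (v j)) (Set.mem_univ (w j)) ha hb hab

lemma convex_unitBlocks : Convex ℝ (unitBlocks d) := by
  have hsq : Convex ℝ {x : Fin d → ℝ | ∑ j, x j ^ 2 ≤ 1} := by
    simpa using (convexOn_sum_apply (even_two.convexOn_pow (𝕜 := ℝ))).convex_le 1
  have habs : Convex ℝ {x : Fin d → ℝ | ∑ j, |x j| ≤ 1} := by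
    simpa using (convexOn_sum_apply (convexOn_norm (E := ℝ) convex_univ)).convex_le 1
  exact hsq.prod (habs.prod hsq)

lemma norm_le_one_of_sum_sq_le_one {x : Fin d → ℝ} (hx : ∑ j, x j ^ 2 ≤ 1) : ‖x‖ ≤ 1 :=
  (pi_norm_le_iff_of_nonneg zero_le_one).2 fun j => (sq_le_one_iff_abs_le_one _).1 <|
    (Finset.single_le_sum (f := fun j => x j ^ 2) (fun _ _ => sq_nonneg _)
      (Finset.mem_univ j)).trans hx

lemma norm_le_one_of_sum_abs_le_one {x : Fin d → ℝ} (hx : ∑ j, |x j| ≤ 1) : ‖x‖ ≤ 1 :=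
  (pi_norm_le_iff_of_nonneg zero_le_one).2 fun j =>
    (Finset.single_le_sum (f := fun j => |x j|) (fun _ _ => abs_nonneg _)
      (Finset.mem_univ j)).trans hx

lemma isCompact_unitBlocks : IsCompact (unitBlocks d) := by
  refine Metric.isCompact_of_isClosed_isBounded ?_
    ((Metric.isBounded_closedBall (x := (0 : Blocks d)) (r := 1)).subset fun v hv => ?_)
  · exact (isClosed_le (f := fun v : Blocks d => ∑ j, v.1 j ^ 2) (by fun_prop)
      continuous_const).inter <| (isClosed_le (f := fun v : Blocks d => ∑ j, |v.2.1 j|)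
      (by fun_prop) continuous_const).inter <| isClosed_le
      (f := fun v : Blocks d => ∑ j, v.2.2 j ^ 2) (by fun_prop) continuous_const
  · exact mem_closedBall_zero_iff.2 <| max_le (norm_le_one_of_sum_sq_le_one hv.1) <|
      max_le (norm_le_one_of_sum_abs_le_one hv.2.1) (norm_le_one_of_sum_sq_le_one hv.2.2)

end UnitBlocks

/-- The data of the geometry in which the algorithm works with `n` samples at confidence level
`exp (-lam)`: the scales of the gradients and the logarithmic factor `lamd` of the `∞`-norm. -/
structure MirrorGeometry (d : ℕ) (n lam : ℝ) where
  lamd : ℝ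
  scale : GaugeIdx d → ℝ
  n_pos : 0 < n
  half_le : 1 / 2 ≤ lam
  lam_le : lam ≤ lamd
  log_le : Real.log (1 + d) ≤ lamd
  scale_pos : ∀ i, 0 < scale i

namespace MirrorGeometry

variable {d : ℕ} {n lam : ℝ} (M : MirrorGeometry d n lam)

include M in
lemma lam_pos : 0 < lam := by linarith [M.half_le]

lemma lamd_pos : 0 < M.lamd := M.lam_pos.trans_le M.lam_le

/-- The linear parametrization of `ℝ^d`. A point of size `1` in one of the three geometries is the
image of a parameter in the corresponding unit ball, up to the factor `√(n / lam)` or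
`√(n / lamd)`. -/
def toVec : Blocks d →ₗ[ℝ] Vec d where
  toFun v := WithLp.toLp 2 fun j => √(n / lam) / M.scale none * v.1 j +
    √(n / M.lamd) / M.scale (some none) * v.2.1 j +
    √(n / lam) / (√(M.scale (some (some j))) * √(∑ i, M.scale (some (some i)))) * v.2.2 j
  map_add' v v' := by ext j; simp; ring
  map_smul' c v := by ext j; simp; ring

/-- The regularizer of the three geometries. -/
def regularizer (v : Blocks d) : ℝ :=
  n * (∑ j, v.1 j ^ 2 + vecHypentropy v.2.1 / M.lamd + ∑ j, v.2.2 j ^ 2)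

/-- The squared dual norm of gradients, up to constants. -/
def dualSq (g : Vec d) : ℝ := weightedSum M.scale fun i => gaugeVal i g ^ 2

/-- The mesh of the quantization of gradients. -/
def mesh : ℝ := √(lam / n / (1 + weightedSum M.scale fun _ => (1 + √d) ^ 2))

lemma dualSq_nonneg (g : Vec d) : 0 ≤ M.dualSq g :=
  weightedSum_nonneg M.scale_pos fun _ => sq_nonneg _

lemma dualSq_add_le (g h : Vec d) : M.dualSq (g + h) ≤ 2 * M.dualSq g + 2 * M.dualSq h := by
  have hgauge (i : GaugeIdx d) :
      gaugeVal i (g + h) ^ 2 ≤ 2 * gaugeVal i g ^ 2 + 2 * gaugeVal i h ^ 2 := by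
    nlinarith [gaugeVal_add_le i g h, gaugeVal_nonneg i (g + h),
      sq_nonneg (gaugeVal i g - gaugeVal i h)]
  refine (weightedSum_mono M.scale_pos hgauge).trans_eq ?_
  simp only [dualSq, weightedSum, Finset.mul_sum, ← Finset.sum_add_distrib]
  exact Finset.sum_congr rfl fun i _ => by ring

lemma norm_sq_le (g : Vec d) : ‖g‖ ^ 2 ≤ M.scale none ^ 2 * M.dualSq g := by
  have hsingle := Finset.single_le_sum (fun i _ => mul_nonneg (gaugeWeight_nonneg M.scale_pos i)
    (sq_nonneg (gaugeVal i g))) (Finset.mem_univ none)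
  change 1 / M.scale none ^ 2 * ‖g‖ ^ 2 ≤ M.dualSq g at hsingle
  rwa [one_div_mul_eq_div, div_le_iff₀' (pow_pos (M.scale_pos _) 2)] at hsingle

lemma mesh_pos : 0 < M.mesh := by
  have hw : 0 ≤ weightedSum M.scale fun _ => (1 + √d) ^ 2 :=
    weightedSum_nonneg M.scale_pos fun _ => sq_nonneg _
  have hlam := M.lam_pos
  have hn := M.n_pos
  exact Real.sqrt_pos.2 (by positivity)

lemma dualSq_le_of_abs_le_mesh {e : Vec d} (he : ∀ j, |e j| ≤ M.mesh) :
    M.dualSq e ≤ lam / n := by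
  set W := weightedSum M.scale fun _ => (1 + √d) ^ 2
  have hW : 0 ≤ W := weightedSum_nonneg M.scale_pos fun _ => sq_nonneg _
  have hlamn : 0 < lam / n := div_pos M.lam_pos M.n_pos
  have hsq (i : GaugeIdx d) : gaugeVal i e ^ 2 ≤ M.mesh ^ 2 * (1 + √d) ^ 2 := by
    rw [← mul_pow, mul_comm]
    exact pow_le_pow_left₀ (gaugeVal_nonneg i e) (gaugeVal_le_mul M.mesh_pos.le he i) 2
  calc M.dualSq e ≤ M.mesh ^ 2 * W :=
        (weightedSum_mono M.scale_pos hsq).trans_eq (weightedSum_const_mul _ _ _)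
    _ = lam / n * (W / (1 + W)) := by
        rw [mesh, Real.sq_sqrt (by positivity), div_mul_eq_mul_div, mul_div_assoc]
    _ ≤ lam / n := mul_le_of_le_one_right hlamn.le ((div_le_one (by linarith)).2 (by linarith))

lemma continuous_regularizer : Continuous M.regularizer := by
  have := continuous_vecHypentropy (d := d)
  unfold regularizer
  fun_prop

lemma regularizer_nonneg (v : Blocks d) : 0 ≤ M.regularizer v := by
  have hn := M.n_pos
  have hlamd := M.lamd_pos
  have hent := vecHypentropy_nonneg v.2.1
  unfold regularizer
  positivity

lemma regularizer_le {v : Blocks d} (hv : v ∈ unitBlocks d) : M.regularizer v ≤ 4 * n := by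
  have hent : vecHypentropy v.2.1 / M.lamd ≤ 2 := by
    rw [div_le_iff₀ M.lamd_pos]
    exact (vecHypentropy_le hv.2.1).trans (by linarith [M.log_le])
  unfold regularizer
  nlinarith [hv.1, hv.2.2, M.n_pos]

lemma midpointGap_sum_sq (x y : Fin d → ℝ) :
    midpointGap (fun z : Fin d → ℝ => ∑ j, z j ^ 2) x y = (∑ j, (x j - y j) ^ 2) / 4 := by
  simp only [midpointGap, Finset.mul_sum, Finset.sum_div, ← Finset.sum_add_distrib,
    ← Finset.sum_sub_distrib, Pi.add_apply, Pi.smul_apply, smul_eq_mul]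
  exact Finset.sum_congr rfl fun j _ => by ring

lemma le_midpointGap_regularizer {v w : Blocks d} (hv : v ∈ unitBlocks d)
    (hw : w ∈ unitBlocks d) :
    n * ((∑ j, (v - w).1 j ^ 2) / 4 + (∑ j, |(v - w).2.1 j|) ^ 2 / 24 / M.lamd +
      (∑ j, (v - w).2.2 j ^ 2) / 4) ≤ midpointGap M.regularizer v w := by
  have hsplit : midpointGap M.regularizer v w = n *
      (midpointGap (fun z => ∑ j, z j ^ 2) v.1 w.1 +
        midpointGap vecHypentropy v.2.1 w.2.1 / M.lamd +
        midpointGap (fun z => ∑ j, z j ^ 2) v.2.2 w.2.2) := by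
    simp only [midpointGap, regularizer, Prod.fst_add, Prod.snd_add, Prod.smul_fst, Prod.smul_snd]
    ring
  rw [hsplit, midpointGap_sum_sq, midpointGap_sum_sq]
  have hent := sq_sum_abs_sub_le_midpointGap_vecHypentropy hv.2.1 hw.2.1
  exact mul_le_mul_of_nonneg_left (add_le_add_left (add_le_add_right
    (div_le_div_of_nonneg_right hent M.lamd_pos.le) _) _) M.n_pos.le

lemma midpointGap_regularizer_nonneg {v w : Blocks d} (hv : v ∈ unitBlocks d)
    (hw : w ∈ unitBlocks d) : 0 ≤ midpointGap M.regularizer v w := by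
  refine le_trans ?_ (M.le_midpointGap_regularizer hv hw)
  have hn := M.n_pos
  have hlamd := M.lamd_pos
  positivity

lemma inner_toVec (g : Vec d) (v : Blocks d) :
    inner ℝ g (M.toVec v) = √(n / lam) / M.scale none * (∑ j, g j * v.1 j) +
      √(n / M.lamd) / M.scale (some none) * (∑ j, g j * v.2.1 j) +
      √(n / lam) * ∑ j, g j / (√(M.scale (some (some j))) * √(∑ i, M.scale (some (some i)))) *
        v.2.2 j := by
  rw [inner_eq_sum, Finset.mul_sum, Finset.mul_sum, Finset.mul_sum, ← Finset.sum_add_distrib,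
    ← Finset.sum_add_distrib]
  refine Finset.sum_congr rfl fun j _ => ?_
  simp only [toVec, LinearMap.coe_mk, AddHom.coe_mk]
  ring

lemma sq_sum_mul_le_normInf (g x : Fin d → ℝ) :
    (∑ j, g j * x j) ^ 2 ≤ normInf g ^ 2 * (∑ j, |x j|) ^ 2 := by
  rw [← mul_pow, ← sq_abs]
  refine pow_le_pow_left₀ (abs_nonneg _) ((Finset.abs_sum_le_sum_abs _ _).trans ?_) 2
  rw [Finset.mul_sum]
  refine Finset.sum_le_sum fun j _ => ?_
  rw [abs_mul]
  exact mul_le_mul_of_nonneg_right (abs_le_normInf g j) (abs_nonneg _)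

lemma sq_toVec_fst_le {x : Fin d → ℝ} {c : ℝ} (hx : n / lam * ∑ j, x j ^ 2 ≤ c) (g : Vec d) :
    (√(n / lam) / M.scale none * ∑ j, g j * x j) ^ 2 ≤
      gaugeWeight M.scale none * ‖g‖ ^ 2 * c := by
  have hnl := div_pos M.n_pos M.lam_pos
  rw [mul_pow, div_pow, Real.sq_sqrt hnl.le]
  calc _ ≤ n / lam / M.scale none ^ 2 * (‖g‖ ^ 2 * ∑ j, x j ^ 2) := by
        rw [EuclideanSpace.real_norm_sq_eq]
        gcongr
        exact Finset.sum_mul_sq_le_sq_mul_sq _ _ _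
    _ = gaugeWeight M.scale none * ‖g‖ ^ 2 * (n / lam * ∑ j, x j ^ 2) := by
        rw [gaugeWeight]; ring
    _ ≤ _ := mul_le_mul_of_nonneg_left hx
        (mul_nonneg (gaugeWeight_nonneg M.scale_pos _) (sq_nonneg _))

lemma sq_toVec_snd_le {x : Fin d → ℝ} {c : ℝ} (hx : n / M.lamd * (∑ j, |x j|) ^ 2 ≤ c)
    (g : Vec d) : (√(n / M.lamd) / M.scale (some none) * ∑ j, g j * x j) ^ 2 ≤
      gaugeWeight M.scale (some none) * normInf g ^ 2 * c := by
  have hnl := div_pos M.n_pos M.lamd_pos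
  rw [mul_pow, div_pow, Real.sq_sqrt hnl.le]
  calc _ ≤ n / M.lamd / M.scale (some none) ^ 2 * (normInf g ^ 2 * (∑ j, |x j|) ^ 2) := by
        gcongr
        exact sq_sum_mul_le_normInf _ _
    _ = gaugeWeight M.scale (some none) * normInf g ^ 2 *
          (n / M.lamd * (∑ j, |x j|) ^ 2) := by
        rw [gaugeWeight]; ring
    _ ≤ _ := mul_le_mul_of_nonneg_left hx
        (mul_nonneg (gaugeWeight_nonneg M.scale_pos _) (sq_nonneg _))

lemma sq_toVec_thd_le {x : Fin d → ℝ} {c : ℝ} (hx : n / lam * ∑ j, x j ^ 2 ≤ c) (g : Vec d) :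
    (√(n / lam) * ∑ j, g j / (√(M.scale (some (some j))) * √(∑ i, M.scale (some (some i)))) *
      x j) ^ 2 ≤ (∑ j, gaugeWeight M.scale (some (some j)) * g j ^ 2) * c := by
  have hnl := div_pos M.n_pos M.lam_pos
  have hnonneg : 0 ≤ ∑ j, gaugeWeight M.scale (some (some j)) * g j ^ 2 :=
    Finset.sum_nonneg fun j _ => mul_nonneg (gaugeWeight_nonneg M.scale_pos _) (sq_nonneg _)
  have hcauchy : (∑ j, g j / (√(M.scale (some (some j))) * √(∑ i, M.scale (some (some i)))) *
      x j) ^ 2 ≤ (∑ j, gaugeWeight M.scale (some (some j)) * g j ^ 2) * ∑ j, x j ^ 2 := by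
    refine (Finset.sum_mul_sq_le_sq_mul_sq _ _ _).trans_eq (congrArg (· * _) ?_)
    refine Finset.sum_congr rfl fun j _ => ?_
    rw [div_pow, mul_pow, Real.sq_sqrt (M.scale_pos _).le,
      Real.sq_sqrt (Finset.sum_nonneg fun _ _ => (M.scale_pos _).le), gaugeWeight,
      one_div_mul_eq_div]
  rw [mul_pow, Real.sq_sqrt hnl.le]
  calc _ ≤ n / lam * ((∑ j, gaugeWeight M.scale (some (some j)) * g j ^ 2) * ∑ j, x j ^ 2) := by
        gcongr
    _ = (∑ j, gaugeWeight M.scale (some (some j)) * g j ^ 2) * (n / lam * ∑ j, x j ^ 2) := by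
        ring
    _ ≤ _ := by gcongr

lemma inner_toVec_sq_le {v : Blocks d} {c : ℝ} (h₁ : n / lam * ∑ j, v.1 j ^ 2 ≤ c)
    (h₂ : n / M.lamd * (∑ j, |v.2.1 j|) ^ 2 ≤ c) (h₃ : n / lam * ∑ j, v.2.2 j ^ 2 ≤ c)
    (g : Vec d) : (inner ℝ g (M.toVec v)) ^ 2 ≤ 3 * c * M.dualSq g := by
  have hdual : M.dualSq g = gaugeWeight M.scale none * ‖g‖ ^ 2 +
      (gaugeWeight M.scale (some none) * normInf g ^ 2 +
        ∑ j, gaugeWeight M.scale (some (some j)) * g j ^ 2) := by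
    rw [dualSq, weightedSum_eq]
    simp only [gaugeVal, sq_abs]
  have hsq (x y z : ℝ) : (x + y + z) ^ 2 ≤ 3 * (x ^ 2 + y ^ 2 + z ^ 2) := by
    nlinarith [sq_nonneg (x - y), sq_nonneg (y - z), sq_nonneg (x - z)]
  rw [M.inner_toVec, hdual]
  refine (hsq _ _ _).trans ?_
  linarith [M.sq_toVec_fst_le h₁ g, M.sq_toVec_snd_le h₂ g, M.sq_toVec_thd_le h₃ g]

lemma inner_toVec_sub_sq_le (g : Vec d) {v w : Blocks d} (hv : v ∈ unitBlocks d)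
    (hw : w ∈ unitBlocks d) : (inner ℝ g (M.toVec (v - w))) ^ 2 ≤
      72 * M.dualSq g * midpointGap M.regularizer v w := by
  have hn := M.n_pos
  have hlam := M.lam_pos
  have hlamd := M.lamd_pos
  have hgap := M.le_midpointGap_regularizer hv hw
  set G := midpointGap M.regularizer v w
  set x₁ := ∑ j, (v - w).1 j ^ 2
  set x₂ := (∑ j, |(v - w).2.1 j|) ^ 2
  set x₃ := ∑ j, (v - w).2.2 j ^ 2
  have hx₁ : 0 ≤ n * x₁ := by positivity
  have hx₂ : 0 ≤ n * (x₂ / 24 / M.lamd) := by positivity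
  have hx₃ : 0 ≤ n * x₃ := by positivity
  have hsq {x : ℝ} (hx : n * x ≤ 4 * G) : n / lam * x ≤ 24 * G := by
    rw [div_mul_eq_mul_div, div_le_iff₀ hlam]
    nlinarith [M.half_le, M.midpointGap_regularizer_nonneg hv hw]
  have habs : n / M.lamd * x₂ ≤ 24 * G := by
    have : n / M.lamd * x₂ = 24 * (n * (x₂ / 24 / M.lamd)) := by ring
    linarith
  refine (M.inner_toVec_sq_le (hsq ?_) habs (hsq ?_) g).trans_eq (by ring) <;> linarith

lemma inner_toVec_sq_le_of_mem (g : Vec d) {v : Blocks d} (hv : v ∈ unitBlocks d) :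
    (inner ℝ g (M.toVec v)) ^ 2 ≤ 4 * (n / lam) * M.dualSq g := by
  have hn := M.n_pos
  have hlam := M.lam_pos
  have hlamd : n / M.lamd ≤ n / lam := by gcongr; exact M.lam_le
  have hsnd : n / M.lamd * (∑ j, |v.2.1 j|) ^ 2 ≤ n / lam :=
    (mul_le_of_le_one_right (div_pos hn M.lamd_pos).le
      (pow_le_one₀ (by positivity) hv.2.1)).trans hlamd
  refine (M.inner_toVec_sq_le (mul_le_of_le_one_right (by positivity) hv.1) hsnd
    (mul_le_of_le_one_right (by positivity) hv.2.2) g).trans ?_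
  exact mul_le_mul_of_nonneg_right (by linarith [div_pos hn hlam]) (M.dualSq_nonneg g)

end MirrorGeometry

section Gradient

variable {E : Type*} [NormedAddCommGroup E] [InnerProductSpace ℝ E] [CompleteSpace E]
  {X : Set E} {f : E → ℝ} {x u : E}

lemma convexOn_sub_le_inner_gradient (hf : ConvexOn ℝ X f) (hx : x ∈ X) (hu : u ∈ X)
    (hd : DifferentiableAt ℝ f x) : f x - f u ≤ inner ℝ (gradient f x) (x - u) := by
  have hline : ConvexOn ℝ (AffineMap.lineMap x u ⁻¹' X) (f ∘ AffineMap.lineMap (k := ℝ) x u) :=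
    hf.comp_affineMap _
  have hderiv : HasDerivAt (f ∘ AffineMap.lineMap (k := ℝ) x u)
      (inner ℝ (gradient f x) (u - x)) 0 := by
    rw [← InnerProductSpace.toDual_apply_apply]
    refine HasFDerivAt.comp_hasDerivAt (0 : ℝ) ?_ AffineMap.hasDerivAt_lineMap
    rw [AffineMap.lineMap_apply_zero]
    exact hd.hasGradientAt.hasFDerivAt
  have hslope := hline.le_slope_of_hasDerivAt (x := 0) (y := 1) (by simpa) (by simpa)
    zero_lt_one hderiv
  simp only [slope_def_field, Function.comp_apply, AffineMap.lineMap_apply_zero,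
    AffineMap.lineMap_apply_one, sub_zero, div_one] at hslope
  rw [← neg_sub u x, inner_neg_right]
  linarith

lemma convexOn_sub_le_mul_norm (hf : ConvexOn ℝ X f) (hx : x ∈ X) (hu : u ∈ X)
    (hd : DifferentiableAt ℝ f x) {L : ℝ} (hL : ‖gradient f x‖ ≤ L) :
    f x - f u ≤ L * ‖x - u‖ :=
  (convexOn_sub_le_inner_gradient hf hx hu hd).trans
    ((real_inner_le_norm _ _).trans (by gcongr))

end Gradient

/-- A closed convex set `X` with a dense sequence `D` of its points. The algorithm only plays points
of the sequence, so that its behaviour depends on countably many gradients of every loss. -/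
structure ConvexDomain (d : ℕ) where
  X : Set (Vec d)
  D : ℕ → Vec d
  closed : IsClosed X
  convex : Convex ℝ X
  D_mem : ∀ i, D i ∈ X
  D_dense : ∀ x ∈ X, ∀ ε > 0, ∃ i, ‖x - D i‖ ≤ ε

section Leader

variable {d : ℕ} {n lam : ℝ} (M : MirrorGeometry d n lam) (K : ConvexDomain d)

/-- The parameters of the points of the domain at scale `ρ` around `c`. -/
def feasible (c : Vec d) (ρ : ℝ) : Set (Blocks d) :=
  {v | v ∈ unitBlocks d ∧ c + ρ • M.toVec v ∈ K.X}

/-- The objective of follow-the-regularized-leader for the accumulated gradient `θ`. -/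
def leaderObjective (θ : Vec d) (v : Blocks d) : ℝ := inner ℝ θ (M.toVec v) + M.regularizer v

open Classical in
/-- The regularized leader for the accumulated gradient `θ`, which is `0` if there is none. -/
def leader (c : Vec d) (ρ : ℝ) (θ : Vec d) : Blocks d :=
  if h : ∃ v ∈ feasible M K c ρ, IsMinOn (leaderObjective M θ) (feasible M K c ρ) v
  then h.choose else 0

variable {M K}

lemma convex_feasible (c : Vec d) (ρ : ℝ) : Convex ℝ (feasible M K c ρ) := by
  refine convex_unitBlocks.inter (t := {v | c + ρ • M.toVec v ∈ K.X}) ?_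
  exact ((K.convex.translate_preimage_right c).smul_preimage ρ).linear_preimage M.toVec

lemma zero_mem_feasible {c : Vec d} (hc : c ∈ K.X) (ρ : ℝ) :
    (0 : Blocks d) ∈ feasible M K c ρ :=
  ⟨zero_mem_unitBlocks, by simpa using hc⟩

lemma isCompact_feasible (c : Vec d) (ρ : ℝ) : IsCompact (feasible M K c ρ) := by
  have hcont : Continuous fun v => c + ρ • M.toVec v :=
    continuous_const.add ((LinearMap.continuous_of_finiteDimensional M.toVec).const_smul ρ)
  exact isCompact_unitBlocks.inter_right (K.closed.preimage hcont)

lemma continuous_leaderObjective (θ : Vec d) : Continuous (leaderObjective M θ) :=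
  (continuous_const.inner (LinearMap.continuous_of_finiteDimensional M.toVec)).add
    M.continuous_regularizer

lemma leader_spec {c : Vec d} (hc : c ∈ K.X) (ρ : ℝ) (θ : Vec d) :
    leader M K c ρ θ ∈ feasible M K c ρ ∧
      IsMinOn (leaderObjective M θ) (feasible M K c ρ) (leader M K c ρ θ) := by
  have h : ∃ v ∈ feasible M K c ρ, IsMinOn (leaderObjective M θ) (feasible M K c ρ) v :=
    (isCompact_feasible c ρ).exists_isMinOn ⟨0, zero_mem_feasible hc ρ⟩
      (continuous_leaderObjective θ).continuousOn
  rw [leader, dif_pos h]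
  exact h.choose_spec

lemma leaderObjective_leader_le {c : Vec d} (hc : c ∈ K.X) {ρ : ℝ} (θ : Vec d) {v : Blocks d}
    (hv : v ∈ feasible M K c ρ) : leaderObjective M θ (leader M K c ρ θ) ≤
      leaderObjective M θ v - 2 * midpointGap M.regularizer (leader M K c ρ θ) v := by
  obtain ⟨hl, hmin⟩ := leader_spec (M := M) hc ρ θ
  -- The midpoint of the leader and `v` is the competitor.
  have hmid := hmin (convex_feasible c ρ hl hv (a := 1 / 2) (b := 1 / 2) (by norm_num)
    (by norm_num) (by norm_num))
  simp only [Set.mem_ofPred_eq, leaderObjective, map_add, map_smul, inner_add_right,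
    inner_smul_right] at hmid ⊢
  rw [midpointGap]
  linarith

lemma inner_toVec_sub_le (g : Vec d) {v w : Blocks d} (hv : v ∈ unitBlocks d)
    (hw : w ∈ unitBlocks d) : inner ℝ g (M.toVec v) - inner ℝ g (M.toVec w) ≤
      2 * midpointGap M.regularizer v w + 9 * M.dualSq g := by
  have hgap := M.midpointGap_regularizer_nonneg hv hw
  have hdual := M.dualSq_nonneg g
  have hsq := M.inner_toVec_sub_sq_le g hv hw
  rw [map_sub, inner_sub_right] at hsq
  refine le_of_sq_le_sq ?_ (by positivity)
  nlinarith [sq_nonneg (2 * midpointGap M.regularizer v w - 9 * M.dualSq g)]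

lemma leader_regret {c : Vec d} (hc : c ∈ K.X) {ρ : ℝ} (g : ℕ → Vec d) (N : ℕ) {v : Blocks d}
    (hv : v ∈ feasible M K c ρ) :
    ∑ t ∈ Finset.range N,
        inner ℝ (g t) (M.toVec (leader M K c ρ (∑ s ∈ Finset.range t, g s))) ≤
      leaderObjective M (∑ s ∈ Finset.range N, g s) v +
        9 * ∑ t ∈ Finset.range N, M.dualSq (g t) := by
  induction N generalizing v with
  | zero => simpa [leaderObjective] using M.regularizer_nonneg v
  | succ m ih =>
    have hl := (leader_spec (M := M) hc ρ (∑ s ∈ Finset.range m, g s)).1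
    have hmin := leaderObjective_leader_le hc (∑ s ∈ Finset.range m, g s) hv
    have hcross := inner_toVec_sub_le (M := M) (g m) hl.1 hv.1
    have hprev := ih hl
    simp only [leaderObjective, Finset.sum_range_succ, inner_add_left] at hmin hprev ⊢
    linarith

end Leader

section QuantizedLeader

variable {d : ℕ} {n lam : ℝ} (M : MirrorGeometry d n lam) (K : ConvexDomain d) (Lhat : ℝ)

open Classical in
/-- The index of a point of the dense sequence within distance `r` of `x`, which is `0` if there is
none. -/
def nearIdx (x : Vec d) (r : ℝ) : ℕ :=
  if h : ∃ i, ‖x - K.D i‖ ≤ r then h.choose else 0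

/-- The point of the lattice of mesh `τ` with coordinates `k`. -/
def unquant (τ : ℝ) (k : Fin d → ℤ) : Vec d := WithLp.toLp 2 fun j => τ * k j

/-- The coordinates of the rounding of `g` to the lattice of mesh `τ`. -/
def quant (τ : ℝ) (g : Vec d) : Fin d → ℤ := fun j => ⌊g j / τ⌋

/-- The rounding of the gradient `g` by the algorithm. -/
def rounded (g : Vec d) : Vec d := unquant M.mesh (quant M.mesh g)

/-- The leader for the accumulated rounded gradient `k`, as a point of the domain. -/
def leaderPoint (c : Vec d) (ρ : ℝ) (k : Fin d → ℤ) : Vec d :=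
  c + ρ • M.toVec (leader M K c ρ (unquant M.mesh k))

/-- The index of the point of the dense sequence that is played for the accumulated rounded
gradient `k`. -/
def playIdx (c : Vec d) (ρ : ℝ) (k : Fin d → ℤ) : ℕ :=
  nearIdx K (leaderPoint M K c ρ k) (ρ / (Lhat + M.scale none))

/-- The accumulated rounded gradients along the losses `y`, in lattice coordinates. -/
def gradState (c : Vec d) (ρ : ℝ) (y : ℕ → Vec d → ℝ) : ℕ → Fin d → ℤ
  | 0 => 0
  | t + 1 => gradState c ρ y t +
      quant M.mesh (gradient (y t) (K.D (playIdx M K Lhat c ρ (gradState c ρ y t))))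

variable {M K Lhat}

lemma norm_sub_D_nearIdx_le {x : Vec d} (hx : x ∈ K.X) {r : ℝ} (hr : 0 < r) :
    ‖x - K.D (nearIdx K x r)‖ ≤ r := by
  have h := K.D_dense x hx r hr
  rw [nearIdx, dif_pos h]
  exact h.choose_spec

lemma abs_sub_unquant_quant_le {τ : ℝ} (hτ : 0 < τ) (g : Vec d) (j : Fin d) :
    |(g - unquant τ (quant τ g)) j| ≤ τ := by
  have hfract : (g - unquant τ (quant τ g)) j = τ * Int.fract (g j / τ) := by
    simp only [unquant, quant, PiLp.sub_apply, Int.fract]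
    field_simp
  rw [hfract, abs_mul, abs_of_pos hτ, abs_of_nonneg (Int.fract_nonneg _)]
  exact mul_le_of_le_one_right hτ.le (Int.fract_lt_one _).le

lemma unquant_zero (τ : ℝ) : unquant τ (0 : Fin d → ℤ) = 0 := by
  ext j; simp [unquant]

lemma unquant_add (τ : ℝ) (k l : Fin d → ℤ) : unquant τ (k + l) = unquant τ k + unquant τ l := by
  ext j; simp [unquant, mul_add]

lemma unquant_gradState (c : Vec d) (ρ : ℝ) (y : ℕ → Vec d → ℝ) (N : ℕ) :
    unquant M.mesh (gradState M K Lhat c ρ y N) = ∑ t ∈ Finset.range N,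
      rounded M (gradient (y t) (K.D (playIdx M K Lhat c ρ (gradState M K Lhat c ρ y t)))) := by
  induction N with
  | zero => simp [gradState, unquant_zero]
  | succ m ih => rw [Finset.sum_range_succ, ← ih, gradState, unquant_add, rounded]

lemma leaderPoint_mem {c : Vec d} (hc : c ∈ K.X) (ρ : ℝ) (k : Fin d → ℤ) :
    leaderPoint M K c ρ k ∈ K.X := (leader_spec hc ρ _).1.2

lemma dualSq_sub_rounded_le (g : Vec d) : M.dualSq (g - rounded M g) ≤ lam / n :=
  M.dualSq_le_of_abs_le_mesh (abs_sub_unquant_quant_le M.mesh_pos g)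

lemma dualSq_rounded_le (hlam : lam ≤ n) (g : Vec d) :
    M.dualSq (rounded M g) ≤ 2 * M.dualSq g + 2 := by
  have hadd := M.dualSq_add_le g (-(g - rounded M g))
  have herr : M.dualSq (-(g - rounded M g)) ≤ lam / n :=
    M.dualSq_le_of_abs_le_mesh fun j => by
      rw [PiLp.neg_apply, abs_neg]
      exact abs_sub_unquant_quant_le M.mesh_pos g j
  rw [neg_sub, add_sub_cancel] at hadd
  rw [neg_sub] at herr
  linarith [(div_le_one M.n_pos).2 hlam]

lemma abs_inner_sub_rounded_le (g : Vec d) {v : Blocks d} (hv : v ∈ unitBlocks d) :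
    |inner ℝ (g - rounded M g) (M.toVec v)| ≤ 2 := by
  have hn := M.n_pos
  have hlam := M.lam_pos
  refine abs_le_of_sq_le_sq ((M.inner_toVec_sq_le_of_mem _ hv).trans ?_) zero_le_two
  calc 4 * (n / lam) * M.dualSq (g - rounded M g) ≤ 4 * (n / lam) * (lam / n) := by
        gcongr; exact dualSq_sub_rounded_le g
    _ = 2 ^ 2 := by field_simp; norm_num

lemma inner_sub_le_of_norm_sub_le {g x x' : Vec d} {ρ : ℝ} (hρ : 0 ≤ ρ) (hg : ‖g‖ ≤ Lhat)
    (hx : ‖x - x'‖ ≤ ρ / (Lhat + M.scale none)) : inner ℝ g (x' - x) ≤ ρ := by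
  have hscale := M.scale_pos none
  have hL : 0 ≤ Lhat := (norm_nonneg g).trans hg
  calc inner ℝ g (x' - x) ≤ ‖g‖ * ‖x' - x‖ := real_inner_le_norm _ _
    _ ≤ Lhat * (ρ / (Lhat + M.scale none)) := by rw [norm_sub_rev]; gcongr
    _ ≤ ρ := by
        rw [mul_div_left_comm]
        exact mul_le_of_le_one_right hρ ((div_le_one (by positivity)).2 (by linarith))

variable {c : Vec d} {ρ : ℝ}

lemma sub_D_playIdx_le (hLhat : 0 ≤ Lhat) (hc : c ∈ K.X) (hρ : 0 < ρ) {y : Vec d → ℝ}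
    (hy : ConvexOn ℝ K.X y) (hyd : ∀ x ∈ K.X, DifferentiableAt ℝ y x)
    (hyL : ∀ x ∈ K.X, ‖gradient y x‖ ≤ Lhat) {v : Blocks d} (hv : v ∈ feasible M K c ρ)
    (k : Fin d → ℤ) {g : Vec d} (hg : g = gradient y (K.D (playIdx M K Lhat c ρ k))) :
    y (K.D (playIdx M K Lhat c ρ k)) - y (c + ρ • M.toVec v) ≤
      ρ * (5 + (inner ℝ (rounded M g) (M.toVec (leader M K c ρ (unquant M.mesh k))) -
        inner ℝ (rounded M g) (M.toVec v))) := by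
  set l := leader M K c ρ (unquant M.mesh k)
  set x := K.D (playIdx M K Lhat c ρ k)
  have hlmem : l ∈ unitBlocks d := (leader_spec hc ρ _).1.1
  have hx : x ∈ K.X := K.D_mem _
  have hconv := convexOn_sub_le_inner_gradient hy hx hv.2 (hyd x hx)
  have hnear : inner ℝ g (x - leaderPoint M K c ρ k) ≤ ρ :=
    inner_sub_le_of_norm_sub_le hρ.le (hg ▸ hyL x hx) <| norm_sub_D_nearIdx_le
      (leaderPoint_mem hc ρ k) (div_pos hρ (add_pos_of_nonneg_of_pos hLhat (M.scale_pos none)))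
  have hsplit : x - (c + ρ • M.toVec v) =
      (x - leaderPoint M K c ρ k) + ρ • (M.toVec l - M.toVec v) := by
    rw [leaderPoint, smul_sub]; abel
  have hl := (abs_le.1 (abs_inner_sub_rounded_le (M := M) g hlmem)).2
  have hv' := (abs_le.1 (abs_inner_sub_rounded_le (M := M) g hv.1)).1
  rw [inner_sub_left] at hl hv'
  rw [← hg, hsplit, inner_add_right, inner_smul_right,
    inner_sub_right g (M.toVec l)] at hconv
  have hround : ρ * (inner ℝ g (M.toVec l) - inner ℝ g (M.toVec v)) ≤
      ρ * (4 + (inner ℝ (rounded M g) (M.toVec l) - inner ℝ (rounded M g) (M.toVec v))) :=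
    mul_le_mul_of_nonneg_left (by linarith) hρ.le
  linarith

lemma gradState_regret (hlam : lam ≤ n) (hLhat : 0 ≤ Lhat) (hc : c ∈ K.X) (hρ : 0 < ρ) {N : ℕ}
    {y : ℕ → Vec d → ℝ} (hy : ∀ t < N, ConvexOn ℝ K.X (y t))
    (hyd : ∀ t < N, ∀ x ∈ K.X, DifferentiableAt ℝ (y t) x)
    (hyL : ∀ t < N, ∀ x ∈ K.X, ‖gradient (y t) x‖ ≤ Lhat) {Γ : ℕ → ℝ}
    (hΓ : ∀ t < N, ∀ i, M.dualSq (gradient (y t) (K.D i)) ≤ Γ t) {v : Blocks d}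
    (hv : v ∈ feasible M K c ρ) :
    ∑ t ∈ Finset.range N, (y t (K.D (playIdx M K Lhat c ρ (gradState M K Lhat c ρ y t))) -
      y t (c + ρ • M.toVec v)) ≤ ρ * (4 * n + 23 * N + 18 * ∑ t ∈ Finset.range N, Γ t) := by
  set g : ℕ → Vec d := fun t =>
    gradient (y t) (K.D (playIdx M K Lhat c ρ (gradState M K Lhat c ρ y t)))
  have hstate (t : ℕ) : unquant M.mesh (gradState M K Lhat c ρ y t) =
      ∑ s ∈ Finset.range t, rounded M (g s) := unquant_gradState c ρ y t
  have hregret := leader_regret hc (fun t => rounded M (g t)) N hv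
  rw [leaderObjective, sum_inner] at hregret
  have hdual : ∑ t ∈ Finset.range N, M.dualSq (rounded M (g t)) ≤
      2 * ∑ t ∈ Finset.range N, Γ t + 2 * N := by
    calc _ ≤ ∑ t ∈ Finset.range N, (2 * Γ t + 2) := Finset.sum_le_sum fun t ht => by
          refine (dualSq_rounded_le hlam _).trans ?_
          gcongr
          exact hΓ t (Finset.mem_range.1 ht) _
      _ = _ := by rw [Finset.sum_add_distrib, ← Finset.mul_sum]; simp [mul_comm]
  calc _ ≤ ∑ t ∈ Finset.range N, ρ * (5 +
        (inner ℝ (rounded M (g t)) (M.toVec (leader M K c ρ (∑ s ∈ Finset.range t,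
          rounded M (g s)))) - inner ℝ (rounded M (g t)) (M.toVec v))) := by
        refine Finset.sum_le_sum fun t htN => ?_
        have ht := Finset.mem_range.1 htN
        rw [← hstate]
        exact sub_D_playIdx_le hLhat hc hρ (hy t ht) (hyd t ht) (hyL t ht) hv _ rfl
    _ = ρ * (5 * N + (∑ t ∈ Finset.range N, inner ℝ (rounded M (g t))
          (M.toVec (leader M K c ρ (∑ s ∈ Finset.range t, rounded M (g s)))) -
          ∑ t ∈ Finset.range N, inner ℝ (rounded M (g t)) (M.toVec v))) := by
        rw [← Finset.mul_sum, Finset.sum_add_distrib, Finset.sum_sub_distrib]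
        simp [mul_comm]
    _ ≤ _ := mul_le_mul_of_nonneg_left (by linarith [M.regularizer_le hv.1]) hρ.le

end QuantizedLeader

namespace MirrorGeometry

variable {d : ℕ} {n lam : ℝ} (M : MirrorGeometry d n lam)

/-- `x` has size at most `r` with respect to the norm whose dual norm is `√(n / lam * M.dualSq g)`,
which is a norm in which the image of the unit blocks is bounded. -/
def SizeLE (x : Vec d) (r : ℝ) : Prop :=
  ∀ g, (inner ℝ g x) ^ 2 ≤ r ^ 2 * (n / lam) * M.dualSq g

variable {M}

lemma SizeLE.add {x x' : Vec d} {r r' : ℝ} (hr : 0 ≤ r) (hr' : 0 ≤ r') (h : M.SizeLE x r)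
    (h' : M.SizeLE x' r') : M.SizeLE (x + x') (r + r') := by
  intro g
  have hn := M.n_pos
  have hlam := M.lam_pos
  have hdual : 0 ≤ n / lam * M.dualSq g := mul_nonneg (by positivity) (M.dualSq_nonneg g)
  have habs {z : Vec d} {q : ℝ} (hq : 0 ≤ q) (hz : M.SizeLE z q) :
      |inner ℝ g z| ≤ q * √(n / lam * M.dualSq g) := by
    refine abs_le_of_sq_le_sq ?_ (by positivity)
    rw [mul_pow, Real.sq_sqrt hdual, ← mul_assoc]
    exact hz g
  rw [inner_add_right, ← sq_abs]
  calc |inner ℝ g x + inner ℝ g x'| ^ 2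
      ≤ (r * √(n / lam * M.dualSq g) + r' * √(n / lam * M.dualSq g)) ^ 2 := by
        gcongr
        exact (abs_add_le _ _).trans (add_le_add (habs hr h) (habs hr' h'))
    _ = _ := by rw [← add_mul, mul_pow, Real.sq_sqrt hdual, mul_assoc]

lemma SizeLE.neg {x : Vec d} {r : ℝ} (h : M.SizeLE x r) : M.SizeLE (-x) r := fun g => by
  rw [inner_neg_right, neg_sq]
  exact h g

lemma sizeLE_smul_toVec (ρ : ℝ) {v : Blocks d} (hv : v ∈ unitBlocks d) :
    M.SizeLE (ρ • M.toVec v) (2 * ρ) := by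
  intro g
  rw [inner_smul_right, mul_pow]
  exact (mul_le_mul_of_nonneg_left (M.inner_toVec_sq_le_of_mem g hv) (sq_nonneg ρ)).trans_eq
    (by ring)

lemma sizeLE_of_norm_le (hlam : lam ≤ n) {Lhat : ℝ} (hLhat : 0 ≤ Lhat) {ρ : ℝ}
    {x : Vec d} (hx : ‖x‖ ≤ ρ / (Lhat + M.scale none)) : M.SizeLE x ρ := by
  intro g
  have hscale := M.scale_pos none
  have hdual := M.dualSq_nonneg g
  have hx' : ‖x‖ * M.scale none ≤ ρ :=
    (mul_le_mul_of_nonneg_left (by linarith) (norm_nonneg x)).trans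
      ((le_div_iff₀ (by positivity)).1 hx)
  calc (inner ℝ g x) ^ 2 ≤ (‖g‖ * ‖x‖) ^ 2 := by
        rw [← sq_abs]; gcongr; exact abs_real_inner_le_norm g x
    _ ≤ M.scale none ^ 2 * M.dualSq g * ‖x‖ ^ 2 := by
        rw [mul_pow]; gcongr; exact M.norm_sq_le g
    _ = (‖x‖ * M.scale none) ^ 2 * M.dualSq g := by ring
    _ ≤ ρ ^ 2 * M.dualSq g := by gcongr
    _ ≤ ρ ^ 2 * (n / lam) * M.dualSq g := by
        gcongr
        exact le_mul_of_one_le_right (sq_nonneg ρ) ((one_le_div M.lam_pos).2 hlam)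

end MirrorGeometry

namespace ConvexDomain

variable {d : ℕ} (K : ConvexDomain d)

/-- The supremum of the size with index `i` of the gradients of `y` at the points of the dense
sequence. -/
def supGauge (i : GaugeIdx d) (y : Vec d → ℝ) : ℝ := ⨆ k, gaugeVal i (gradient y (K.D k))

variable {K} {y : Vec d → ℝ} {i : GaugeIdx d} {r : ℝ}

lemma supGauge_nonneg (i : GaugeIdx d) (y : Vec d → ℝ) : 0 ≤ K.supGauge i y :=
  Real.iSup_nonneg fun _ => gaugeVal_nonneg _ _

lemma supGauge_le (h : ∀ x ∈ K.X, gaugeVal i (gradient y x) ≤ r) : K.supGauge i y ≤ r :=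
  ciSup_le fun k => h _ (K.D_mem k)

lemma gaugeVal_le_supGauge (h : ∀ x ∈ K.X, gaugeVal i (gradient y x) ≤ r) (k : ℕ) :
    gaugeVal i (gradient y (K.D k)) ≤ K.supGauge i y :=
  le_ciSup (f := fun k => gaugeVal i (gradient y (K.D k)))
    ⟨r, Set.forall_mem_range.2 fun k => h _ (K.D_mem k)⟩ k

end ConvexDomain

section Measurability

variable {d : ℕ} {𝒮 : Type*} [MeasurableSpace 𝒮] {f : Vec d → 𝒮 → ℝ}

lemma measurable_gradient_apply (hf : ∀ x, Measurable (f x)) {x : Vec d}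
    (hd : ∀ s, DifferentiableAt ℝ (fun y => f y s) x) (j : Fin d) :
    Measurable fun s => gradient (fun y => f y s) x j := by
  have hlim (s : 𝒮) : Filter.Tendsto (fun m : ℕ => ((m : ℝ) + 1) •
      (f (x + ((m : ℝ) + 1)⁻¹ • EuclideanSpace.single j 1) s - f x s)) Filter.atTop
      (nhds (gradient (fun y => f y s) x j)) := by
    have hnorm : Filter.Tendsto (fun m : ℕ => ‖(m : ℝ) + 1‖) Filter.atTop Filter.atTop :=
      tendsto_norm_atTop_atTop.comp
        (Filter.tendsto_atTop_add_const_right _ 1 tendsto_natCast_atTop_atTop)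
    have hquot := (hd s).hasGradientAt.hasFDerivAt.lim (EuclideanSpace.single j 1) hnorm
    rwa [InnerProductSpace.toDual_apply_apply, EuclideanSpace.inner_single_right, one_mul] at hquot
  exact measurable_of_tendsto_metrizable
    (fun m => ((hf _).sub (hf x)).const_mul ((m : ℝ) + 1)) (tendsto_pi_nhds.2 hlim)

lemma continuous_gaugeVal : ∀ i : GaugeIdx d, Continuous (gaugeVal i)
  | none => continuous_norm
  | some none => (PiLp.continuous_ofLp 2 _).norm
  | some (some j) => (PiLp.continuous_apply 2 _ j).abs

lemma measurable_gaugeVal_gradient (hf : ∀ x, Measurable (f x)) {x : Vec d}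
    (hd : ∀ s, DifferentiableAt ℝ (fun y => f y s) x) (i : GaugeIdx d) :
    Measurable fun s => gaugeVal i (gradient (fun y => f y s) x) :=
  (continuous_gaugeVal i).measurable.comp <| (WithLp.measurable_toLp 2 _).comp <|
    measurable_pi_lambda _ (measurable_gradient_apply hf hd)

end Measurability

/-- The data of the algorithm in the nondegenerate case. The `n` samples are split into three blocks
of length `N`, up to a remainder. -/
structure Setup (d : ℕ) extends ConvexDomain d where
  n : ℕ
  N : ℕ
  lam : ℝ
  lamd : ℝ
  Lhat : ℝ
  lhat : Fin d → ℝ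
  d_pos : 0 < d
  N_pos : 0 < N
  three_mul_le : 3 * N ≤ n
  le_five_mul : n ≤ 5 * N
  D_zero : D 0 = 0
  half_le : 1 / 2 ≤ lam
  lam_le : lam ≤ lamd
  log_le : Real.log (1 + d) ≤ lamd
  lamd_le : lamd ≤ n
  Lhat_pos : 0 < Lhat
  lhat_nonneg : ∀ j, 0 ≤ lhat j
  lhat_sum_pos : 0 < ∑ j, lhat j

namespace Setup

variable {d : ℕ} (Q : Setup d)

lemma n_pos : 0 < Q.n := by have := Q.N_pos; have := Q.three_mul_le; omega

lemma cast_n_pos : (0 : ℝ) < Q.n := by exact_mod_cast Q.n_pos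

lemma cast_N_pos : (0 : ℝ) < Q.N := by exact_mod_cast Q.N_pos

lemma three_mul_cast_le : 3 * (Q.N : ℝ) ≤ Q.n := by exact_mod_cast Q.three_mul_le

lemma cast_le_five_mul : (Q.n : ℝ) ≤ 5 * Q.N := by exact_mod_cast Q.le_five_mul

lemma lam_pos : 0 < Q.lam := by linarith [Q.half_le]

lemma lam_le_n : Q.lam ≤ Q.n := Q.lam_le.trans Q.lamd_le

lemma zero_mem : (0 : Vec d) ∈ Q.X := Q.D_zero ▸ Q.D_mem 0

/-- The a priori bounds on the sizes of gradients. The average of `lhat` keeps those of the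
coordinates positive without affecting the order of magnitude of their sum. -/
def hat : GaugeIdx d → ℝ
  | none => Q.Lhat
  | some none => normInf Q.lhat
  | some (some j) => Q.lhat j + (∑ i, Q.lhat i) / d

/-- The logarithmic factors of the sizes of gradients. -/
def logFactor : GaugeIdx d → ℝ
  | none => Q.lam
  | some _ => Q.lamd

/-- The resolution at which the sizes of gradients are measured, which is the smallest possible
scale. -/
def resolution (i : GaugeIdx d) : ℝ := Q.hat i * √(Q.logFactor i / Q.n)

/-- The scales that correspond to the statistics `p`. -/
def scale (p : GaugeIdx d → ℕ) (i : GaugeIdx d) : ℝ := Q.resolution i * √((p i : ℝ) / Q.N + 1)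

/-- The statistics of the first block of losses: the sums of the squared sizes of their gradients,
in units of the squared resolution. -/
def stat (y : ℕ → Vec d → ℝ) (i : GaugeIdx d) : ℕ :=
  ∑ t ∈ Finset.range Q.N, ⌈Q.supGauge i (y t) ^ 2 / Q.resolution i ^ 2⌉₊

lemma hat_pos : ∀ i, 0 < Q.hat i
  | none => Q.Lhat_pos
  | some none => by
    refine norm_pos_iff.2 fun h => Q.lhat_sum_pos.ne' ?_
    simp [h]
  | some (some j) => add_pos_of_nonneg_of_pos (Q.lhat_nonneg j)
      (div_pos Q.lhat_sum_pos (Nat.cast_pos.2 Q.d_pos))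

lemma lam_le_logFactor : ∀ i, Q.lam ≤ Q.logFactor i
  | none => le_rfl
  | some _ => Q.lam_le

lemma logFactor_pos (i : GaugeIdx d) : 0 < Q.logFactor i :=
  Q.lam_pos.trans_le (Q.lam_le_logFactor i)

lemma resolution_pos (i : GaugeIdx d) : 0 < Q.resolution i :=
  mul_pos (Q.hat_pos i) (Real.sqrt_pos.2 (div_pos (Q.logFactor_pos i) Q.cast_n_pos))

lemma resolution_sq (i : GaugeIdx d) :
    Q.resolution i ^ 2 = Q.hat i ^ 2 * (Q.logFactor i / Q.n) := by
  rw [resolution, mul_pow, Real.sq_sqrt (div_pos (Q.logFactor_pos i) Q.cast_n_pos).le]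

lemma scale_sq (p : GaugeIdx d → ℕ) (i : GaugeIdx d) :
    Q.scale p i ^ 2 = Q.resolution i ^ 2 * ((p i : ℝ) / Q.N + 1) := by
  rw [scale, mul_pow, Real.sq_sqrt (by positivity)]

lemma scale_pos (p : GaugeIdx d → ℕ) (i : GaugeIdx d) : 0 < Q.scale p i :=
  mul_pos (Q.resolution_pos i) (Real.sqrt_pos.2 (by positivity))

lemma resolution_sq_le_scale_sq (p : GaugeIdx d → ℕ) (i : GaugeIdx d) :
    Q.resolution i ^ 2 ≤ Q.scale p i ^ 2 := by
  rw [scale_sq]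
  exact le_mul_of_one_le_right (sq_nonneg _) (by linarith [show 0 ≤ (p i : ℝ) / Q.N by positivity])

/-- The geometry that corresponds to the statistics `p`. -/
def geom (p : GaugeIdx d → ℕ) : MirrorGeometry d Q.n Q.lam where
  lamd := Q.lamd
  scale := Q.scale p
  n_pos := Q.cast_n_pos
  half_le := Q.half_le
  lam_le := Q.lam_le
  log_le := Q.log_le
  scale_pos := Q.scale_pos p

/-- An upper bound on the squared dual norm of the gradients of `y`. -/
def dualSqBound (p : GaugeIdx d → ℕ) (y : Vec d → ℝ) : ℝ :=
  weightedSum (Q.scale p) fun i => Q.supGauge i y ^ 2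

/-- Losses that satisfy the hypotheses of the theorem everywhere rather than almost surely, with the
a priori bounds on the sizes of gradients. -/
structure Regular {𝒮 : Type*} [MeasurableSpace 𝒮] (P : Measure 𝒮) (f : Vec d → 𝒮 → ℝ) :
    Prop where
  measurable : ∀ x, Measurable (f x)
  integrable : ∀ x ∈ Q.X, Integrable (f x) P
  convexOn : ∀ s, ConvexOn ℝ Q.X (fun x => f x s)
  differentiableAt : ∀ s, ∀ x ∈ Q.X, DifferentiableAt ℝ (fun y => f y s) x
  gaugeVal_le : ∀ s, ∀ x ∈ Q.X, ∀ i, gaugeVal i (gradient (fun y => f y s) x) ≤ Q.hat i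

/-- The scales that correspond to the statistics `p` dominate the second moments of the sizes of
gradients. -/
def DominatesMoments {𝒮 : Type*} [MeasurableSpace 𝒮] (P : Measure 𝒮) (f : Vec d → 𝒮 → ℝ)
    (p : GaugeIdx d → ℕ) : Prop :=
  ∀ i, ∫ s, Q.supGauge i (fun y => f y s) ^ 2 ∂P ≤ 100 * Q.scale p i ^ 2

variable {Q}

lemma dualSqBound_nonneg (p : GaugeIdx d → ℕ) (y : Vec d → ℝ) : 0 ≤ Q.dualSqBound p y :=
  weightedSum_nonneg (Q.scale_pos p) fun _ => sq_nonneg _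

variable {𝒮 : Type*} [MeasurableSpace 𝒮] {P : Measure 𝒮} {f : Vec d → 𝒮 → ℝ}

lemma Regular.norm_gradient_le (hf : Q.Regular P f) (s : 𝒮) {x : Vec d} (hx : x ∈ Q.X) :
    ‖gradient (fun y => f y s) x‖ ≤ Q.Lhat := hf.gaugeVal_le s x hx none

lemma Regular.supGauge_sq_le (hf : Q.Regular P f) (s : 𝒮) (i : GaugeIdx d) :
    Q.supGauge i (fun y => f y s) ^ 2 ≤ Q.hat i ^ 2 :=
  pow_le_pow_left₀ (ConvexDomain.supGauge_nonneg _ _)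
    (ConvexDomain.supGauge_le fun x hx => hf.gaugeVal_le s x hx i) 2

lemma Regular.measurable_supGauge (hf : Q.Regular P f) (i : GaugeIdx d) :
    Measurable fun s => Q.supGauge i (fun y => f y s) :=
  Measurable.iSup fun k => measurable_gaugeVal_gradient hf.measurable
    (fun s => hf.differentiableAt s _ (Q.D_mem k)) i

lemma Regular.measurable_dualSqBound (hf : Q.Regular P f) (p : GaugeIdx d → ℕ) :
    Measurable fun s => Q.dualSqBound p (fun y => f y s) :=
  Finset.measurable_sum Finset.univ fun i _ =>
    ((hf.measurable_supGauge i).pow_const 2).const_mul (gaugeWeight (Q.scale p) i)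

lemma Regular.dualSq_gradient_le (hf : Q.Regular P f) (p : GaugeIdx d → ℕ) (s : 𝒮) (k : ℕ) :
    (Q.geom p).dualSq (gradient (fun y => f y s) (Q.D k)) ≤ Q.dualSqBound p (fun y => f y s) :=
  weightedSum_mono (Q.scale_pos p) fun i => pow_le_pow_left₀ (gaugeVal_nonneg _ _)
    (ConvexDomain.gaugeVal_le_supGauge (fun x hx => hf.gaugeVal_le s x hx i) k) 2

lemma Regular.dualSqBound_le (hf : Q.Regular P f) (p : GaugeIdx d → ℕ) (s : 𝒮) :
    Q.dualSqBound p (fun y => f y s) ≤ 3 * (Q.n / Q.lam) := by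
  have hn := Q.cast_n_pos
  have hlam := Q.lam_pos
  refine weightedSum_le (Q.scale_pos p) (div_pos hn hlam).le fun i => ?_
  have hlog := Q.logFactor_pos i
  calc Q.supGauge i (fun y => f y s) ^ 2 ≤ Q.hat i ^ 2 := hf.supGauge_sq_le s i
    _ = Q.n / Q.logFactor i * Q.resolution i ^ 2 := by rw [resolution_sq]; field_simp
    _ ≤ Q.n / Q.lam * Q.scale p i ^ 2 := mul_le_mul
        (div_le_div_of_nonneg_left hn.le hlam (Q.lam_le_logFactor i))
        (Q.resolution_sq_le_scale_sq p i) (sq_nonneg _) (div_pos hn hlam).le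

variable [IsProbabilityMeasure P]

lemma Regular.integrable_supGauge_sq (hf : Q.Regular P f) (i : GaugeIdx d) :
    Integrable (fun s => Q.supGauge i (fun y => f y s) ^ 2) P :=
  integrable_of_abs_le P ((hf.measurable_supGauge i).pow_const 2) (b := Q.hat i ^ 2) fun s => by
    rw [abs_of_nonneg (sq_nonneg _)]
    exact hf.supGauge_sq_le s i

lemma Regular.integrable_dualSqBound (hf : Q.Regular P f) (p : GaugeIdx d → ℕ) :
    Integrable (fun s => Q.dualSqBound p (fun y => f y s)) P :=
  integrable_finsetSum Finset.univ fun i _ =>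
    (hf.integrable_supGauge_sq i).const_mul (gaugeWeight (Q.scale p) i)

lemma Regular.integral_dualSqBound_le (hf : Q.Regular P f) {p : GaugeIdx d → ℕ}
    (hp : Q.DominatesMoments P f p) : ∫ s, Q.dualSqBound p (fun y => f y s) ∂P ≤ 300 := by
  have hswap : ∫ s, Q.dualSqBound p (fun y => f y s) ∂P =
      weightedSum (Q.scale p) fun i => ∫ s, Q.supGauge i (fun y => f y s) ^ 2 ∂P := by
    simp only [dualSqBound, weightedSum]
    rw [integral_finsetSum _ fun i _ => (hf.integrable_supGauge_sq i).const_mul _]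
    simp only [integral_const_mul]
  rw [hswap]
  exact (weightedSum_le (Q.scale_pos p) (by norm_num) hp).trans (by norm_num)

end Setup

namespace Setup

variable {d : ℕ} (Q : Setup d)

instance : NeZero Q.n := ⟨Q.n_pos.ne'⟩

/-- The sampled losses as a sequence, which repeats itself after `n` terms. -/
def sample {𝒮 : Type*} (f : Vec d → 𝒮 → ℝ) (S : Fin Q.n → 𝒮) (t : ℕ) : Vec d → ℝ :=
  fun x => f x (S (Fin.ofNat Q.n t))

/-- The accumulated rounded gradients along the losses `y lo, y (lo + 1), …` -/
def runState (p : GaugeIdx d → ℕ) (c : Vec d) (ρ : ℝ) (lo : ℕ) (y : ℕ → Vec d → ℝ) (t : ℕ) :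
    Fin d → ℤ :=
  gradState (Q.geom p) Q.toConvexDomain Q.Lhat c ρ (fun t => y (lo + t)) t

/-- The index of the point played for the accumulated rounded gradient `k`. -/
def runIdx (p : GaugeIdx d → ℕ) (c : Vec d) (ρ : ℝ) (k : Fin d → ℤ) : ℕ :=
  playIdx (Q.geom p) Q.toConvexDomain Q.Lhat c ρ k

/-- The average of the leaders for the accumulated rounded gradients `k`. -/
def avgPoint (p : GaugeIdx d → ℕ) (c : Vec d) (ρ : ℝ) (k : Fin Q.N → Fin d → ℤ) : Vec d :=
  (Q.N : ℝ)⁻¹ • ∑ t, leaderPoint (Q.geom p) Q.toConvexDomain c ρ (k t)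

/-- The index of a point of the dense sequence near the average of the leaders. -/
def avgIdx (p : GaugeIdx d → ℕ) (c : Vec d) (ρ : ℝ) (k : Fin Q.N → Fin d → ℤ) : ℕ :=
  nearIdx Q.toConvexDomain (Q.avgPoint p c ρ k) (ρ / (Q.Lhat + (Q.geom p).scale none))

/-- The index of the candidate of radius `2 ^ k`, computed from the second block of losses. -/
def candIdx (y : ℕ → Vec d → ℝ) (k : ℤ) : ℕ :=
  Q.avgIdx (Q.stat y) 0 (2 ^ k) fun t => Q.runState (Q.stat y) 0 (2 ^ k) Q.N y t

lemma sum_div_add_resolution_sq_le_scale_sq (y : ℕ → Vec d → ℝ) (i : GaugeIdx d) :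
    (∑ t ∈ Finset.range Q.N, Q.supGauge i (y t) ^ 2) / Q.N + Q.resolution i ^ 2 ≤
      Q.scale (Q.stat y) i ^ 2 := by
  have hres := Q.resolution_pos i
  have hle : (∑ t ∈ Finset.range Q.N, Q.supGauge i (y t) ^ 2) / Q.resolution i ^ 2 ≤
      Q.stat y i := by
    rw [stat, Finset.sum_div]
    push_cast
    exact Finset.sum_le_sum fun t _ => Nat.le_ceil _
  rw [div_le_iff₀ (by positivity)] at hle
  rw [scale_sq, mul_add, mul_one, mul_div_assoc']
  gcongr
  linarith

lemma le_scale_sq_of_lt {y : ℕ → Vec d → ℝ} {i : GaugeIdx d} {m : ℝ}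
    (h : Q.N * m / 4 - (∑ t ∈ Finset.range Q.N, Q.supGauge i (y t) ^ 2) / 2 <
      5 * Q.logFactor i * Q.hat i ^ 2) : m ≤ 100 * Q.scale (Q.stat y) i ^ 2 := by
  have hN := Q.cast_N_pos
  have hn := Q.cast_n_pos
  have hscale := Q.sum_div_add_resolution_sq_le_scale_sq y i
  set V := ∑ t ∈ Finset.range Q.N, Q.supGauge i (y t) ^ 2
  have hV : 0 ≤ V / Q.N := div_nonneg (Finset.sum_nonneg fun _ _ => sq_nonneg _) hN.le
  have hres : Q.logFactor i * Q.hat i ^ 2 ≤ 5 * Q.N * Q.resolution i ^ 2 := by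
    calc Q.logFactor i * Q.hat i ^ 2 = Q.n * Q.resolution i ^ 2 := by
          rw [resolution_sq]; field_simp
      _ ≤ _ := by gcongr; exact Q.cast_le_five_mul
  have hm : m ≤ 2 * (V / Q.N) + 100 * Q.resolution i ^ 2 := by
    rw [← sub_le_iff_le_add, mul_div_assoc', le_div_iff₀ hN]
    nlinarith
  linarith

variable {Q} {𝒮 : Type*} [MeasurableSpace 𝒮] {P : Measure 𝒮} {f : Vec d → 𝒮 → ℝ}

lemma Regular.predictable_stat (hf : Q.Regular P f) :
    Predictable Q.N (fun S : Fin Q.n → 𝒮 => Q.stat (Q.sample f S)) := by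
  refine Predictable.pi fun i => ?_
  have hprefix : ∀ m ≤ Q.n, Predictable m (fun S : Fin Q.n → 𝒮 => ∑ t ∈ Finset.range m,
      ⌈Q.supGauge i (Q.sample f S t) ^ 2 / Q.resolution i ^ 2⌉₊) := by
    intro m
    induction m with
    | zero => exact fun _ => Predictable.const 0 0
    | succ m ih =>
      intro hm
      simp only [Finset.sum_range_succ]
      have hmeas : Measurable fun s =>
          ⌈Q.supGauge i (fun y => f y s) ^ 2 / Q.resolution i ^ 2⌉₊ :=
        Nat.measurable_ceil.comp (((hf.measurable_supGauge i).pow_const 2).div_const _)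
      exact (ih (by omega)).succ (by omega)
        (φ := fun b s => b + ⌈Q.supGauge i (fun y => f y s) ^ 2 / Q.resolution i ^ 2⌉₊)
        fun b b' => (measurable_const.add hmeas) (measurableSet_singleton b')
  exact hprefix Q.N (by linarith [Q.three_mul_le])

lemma Regular.measurable_quant (hf : Q.Regular P f) (τ : ℝ) {x : Vec d} (hx : x ∈ Q.X) :
    Measurable fun s => quant τ (gradient (fun y => f y s) x) :=
  measurable_pi_lambda _ fun j => Int.measurable_floor.comp <|
    (measurable_gradient_apply hf.measurable (fun s => hf.differentiableAt s x hx) j).div_const τ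

lemma Regular.predictable_runState (hf : Q.Regular P f) (c : Vec d) (ρ : ℝ) {lo : ℕ}
    (hlo : Q.N ≤ lo) (t : ℕ) (ht : lo + t ≤ Q.n) :
    Predictable (lo + t) (fun S : Fin Q.n → 𝒮 => (Q.stat (Q.sample f S),
      Q.runState (Q.stat (Q.sample f S)) c ρ lo (Q.sample f S) t)) := by
  induction t with
  | zero => exact (hf.predictable_stat.mono hlo).map fun p => (p, 0)
  | succ t ih =>
    refine (ih (by omega)).succ (by omega)
      (φ := fun b s => (b.1, b.2 + quant (Q.geom b.1).mesh
        (gradient (fun y => f y s) (Q.D (Q.runIdx b.1 c ρ b.2))))) fun b b' => ?_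
    have hquant := hf.measurable_quant (Q.geom b.1).mesh (Q.D_mem (Q.runIdx b.1 c ρ b.2))
    exact (measurable_const.prodMk (measurable_const.add hquant)) (measurableSet_singleton b')

lemma Regular.predictable_runIdx (hf : Q.Regular P f) (c : Vec d) (ρ : ℝ) {lo : ℕ}
    (hlo : Q.N ≤ lo) (t : ℕ) (ht : lo + t ≤ Q.n) :
    Predictable (lo + t) (fun S : Fin Q.n → 𝒮 => (Q.stat (Q.sample f S),
      Q.runIdx (Q.stat (Q.sample f S)) c ρ
        (Q.runState (Q.stat (Q.sample f S)) c ρ lo (Q.sample f S) t))) :=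
  (hf.predictable_runState c ρ hlo t ht).map fun b => (b.1, Q.runIdx b.1 c ρ b.2)

lemma Regular.predictable_candIdx (hf : Q.Regular P f) (k : ℤ) :
    Predictable (2 * Q.N) (fun S : Fin Q.n → 𝒮 => Q.candIdx (Q.sample f S) k) := by
  have hn := Q.three_mul_le
  have hstates : Predictable (2 * Q.N) (fun S : Fin Q.n → 𝒮 => fun t : Fin Q.N =>
      Q.runState (Q.stat (Q.sample f S)) 0 (2 ^ k) Q.N (Q.sample f S) t) :=
    Predictable.pi fun t => ((hf.predictable_runState 0 (2 ^ k) le_rfl t (by omega)).map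
      Prod.snd).mono (by omega)
  exact (hf.predictable_stat.mono (by omega)).map₂ hstates fun p κ => Q.avgIdx p 0 (2 ^ k) κ

lemma Regular.sub_sq_le (hf : Q.Regular P f) {p : GaugeIdx d → ℕ} {i j : ℕ} {r : ℝ}
    (h : (Q.geom p).SizeLE (Q.D i - Q.D j) r) (s : 𝒮) :
    (f (Q.D i) s - f (Q.D j) s) ^ 2 ≤
      r ^ 2 * (Q.n / Q.lam) * Q.dualSqBound p (fun y => f y s) := by
  have hn := Q.cast_n_pos
  have hl := Q.lam_pos
  have hupper := convexOn_sub_le_inner_gradient (hf.convexOn s) (Q.D_mem i) (Q.D_mem j)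
    (hf.differentiableAt s _ (Q.D_mem i))
  have hlower := convexOn_sub_le_inner_gradient (hf.convexOn s) (Q.D_mem j) (Q.D_mem i)
    (hf.differentiableAt s _ (Q.D_mem j))
  have hbound : ∀ k, (inner ℝ (gradient (fun y => f y s) (Q.D k)) (Q.D i - Q.D j)) ^ 2 ≤
      r ^ 2 * (Q.n / Q.lam) * Q.dualSqBound p (fun y => f y s) := fun k =>
    (h _).trans (by gcongr; exact hf.dualSq_gradient_le p s k)
  rw [← neg_sub (Q.D i), inner_neg_right] at hlower
  rcases le_total 0 (f (Q.D i) s - f (Q.D j) s) with h0 | h0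
  · exact (pow_le_pow_left₀ h0 hupper 2).trans (hbound i)
  · refine le_trans ?_ (hbound j)
    rw [← neg_sq, ← neg_sq (inner ℝ _ _)]
    exact pow_le_pow_left₀ (by linarith) (by linarith) 2

variable [IsProbabilityMeasure P]

lemma Regular.measure_scale_lt_le (hf : Q.Regular P f) (i : GaugeIdx d) :
    (Measure.pi fun _ : Fin Q.n => P) {S | 100 * Q.scale (Q.stat (Q.sample f S)) i ^ 2 <
      ∫ s, Q.supGauge i (fun y => f y s) ^ 2 ∂P} ≤
      ENNReal.ofReal (Real.exp (-(5 * Q.logFactor i))) := by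
  have hhat := Q.hat_pos i
  set X : 𝒮 → ℝ := fun s => Q.supGauge i (fun y => f y s) ^ 2 / Q.hat i ^ 2
  have hX : Measurable X := ((hf.measurable_supGauge i).pow_const 2).div_const _
  have hX1 : ∀ s, X s ≤ 1 := fun s => (div_le_one (by positivity)).2 (hf.supGauge_sq_le s i)
  refine (measure_mono ?_).trans <| measure_le_sum_predictable_le P (lo := 0) (N := Q.N)
    (by have := Q.three_mul_le; omega) (h := fun _ _ => ()) (fun t _ => Predictable.const _ ())
    (ξ := fun _ s => (∫ s, X s ∂P) / 4 - X s / 2)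
    (fun _ => measurable_const.sub (hX.div_const 2))
    (fun _ => lintegral_exp_integral_sub_le_one P hX (fun s => by positivity) hX1)
    (5 * Q.logFactor i)
  intro S hS
  simp only [Set.mem_ofPred_eq, zero_add] at hS ⊢
  contrapose! hS
  refine Q.le_scale_sq_of_lt ?_
  have hmean : ∫ s, X s ∂P = (∫ s, Q.supGauge i (fun y => f y s) ^ 2 ∂P) / Q.hat i ^ 2 :=
    integral_div _ _
  have hsum : ∑ t ∈ Finset.range Q.N, X (S (Fin.ofNat Q.n t)) / 2 =
      (∑ t ∈ Finset.range Q.N, Q.supGauge i (Q.sample f S t) ^ 2) / Q.hat i ^ 2 / 2 := by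
    rw [Finset.sum_div, Finset.sum_div]
    rfl
  rw [Finset.sum_sub_distrib, Finset.sum_const, Finset.card_range, nsmul_eq_mul, hmean,
    hsum] at hS
  refine lt_of_eq_of_lt ?_ (mul_lt_mul_of_pos_right hS (show 0 < Q.hat i ^ 2 by positivity))
  field_simp

lemma Regular.lintegral_exp_dualSqBound_le_one (hf : Q.Regular P f) {p : GaugeIdx d → ℕ}
    (hp : Q.DominatesMoments P f p) : ∫⁻ s, ENNReal.ofReal (Real.exp
      (Q.lam / (3 * Q.n) * Q.dualSqBound p (fun y => f y s) - 2 * (100 * Q.lam / Q.n))) ∂P ≤ 1 := by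
  have hn := Q.cast_n_pos
  have hl := Q.lam_pos
  refine lintegral_exp_sub_two_mul_le_one P ((hf.measurable_dualSqBound p).const_mul _)
    (fun s => mul_nonneg (by positivity) (dualSqBound_nonneg _ _)) (fun s => ?_) ?_
  · calc Q.lam / (3 * Q.n) * Q.dualSqBound p (fun y => f y s)
        ≤ Q.lam / (3 * Q.n) * (3 * (Q.n / Q.lam)) := by gcongr; exact hf.dualSqBound_le p s
      _ = 1 := by field_simp
  · rw [integral_const_mul]
    calc Q.lam / (3 * Q.n) * _ ≤ Q.lam / (3 * Q.n) * 300 := by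
          gcongr; exact hf.integral_dualSqBound_le hp
      _ = 100 * Q.lam / Q.n := by field_simp; norm_num

lemma Regular.measure_sum_dualSqBound_le (hf : Q.Regular P f) {lo : ℕ} (hlo : Q.N ≤ lo)
    (hlo' : lo + Q.N ≤ Q.n) :
    (Measure.pi fun _ : Fin Q.n => P) {S | Q.DominatesMoments P f (Q.stat (Q.sample f S)) ∧
      216 * Q.n ≤ ∑ t ∈ Finset.range Q.N,
        Q.dualSqBound (Q.stat (Q.sample f S)) (Q.sample f S (lo + t))} ≤
      ENNReal.ofReal (Real.exp (-(5 * Q.lam))) := by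
  have hn := Q.cast_n_pos
  have hl := Q.lam_pos
  refine (measure_mono ?_).trans <| measure_forall_and_le_sum_predictable_le P hlo'
    (h := fun _ S => Q.stat (Q.sample f S)) (fun t _ => hf.predictable_stat.mono (by omega))
    (ξ := fun p s => Q.lam / (3 * Q.n) * Q.dualSqBound p (fun y => f y s) -
      2 * (100 * Q.lam / Q.n))
    (fun p => ((hf.measurable_dualSqBound p).const_mul _).sub_const _)
    (fun p hp => hf.lintegral_exp_dualSqBound_le_one hp) (5 * Q.lam)
  rintro S ⟨hp, hS⟩
  refine ⟨fun _ _ => hp, ?_⟩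
  rw [Finset.sum_sub_distrib, Finset.sum_const, Finset.card_range, nsmul_eq_mul,
    ← Finset.mul_sum]
  have hvariance : (Q.N : ℝ) * (2 * (100 * Q.lam / Q.n)) ≤ 67 * Q.lam := by
    rw [show (Q.N : ℝ) * (2 * (100 * Q.lam / Q.n)) = 200 * Q.lam * Q.N / Q.n by ring,
      div_le_iff₀ hn]
    nlinarith [Q.three_mul_cast_le]
  calc 5 * Q.lam ≤ Q.lam / (3 * Q.n) * (216 * Q.n) - Q.N * (2 * (100 * Q.lam / Q.n)) := by
        rw [show Q.lam / (3 * Q.n) * (216 * Q.n) = 72 * Q.lam by field_simp; norm_num]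
        linarith
    _ ≤ _ := sub_le_sub_right (mul_le_mul_of_nonneg_left hS (by positivity)) _

lemma Regular.lintegral_exp_sub_risk_le_one (hf : Q.Regular P f) {p : GaugeIdx d → ℕ}
    (hp : Q.DominatesMoments P f p) {r : ℝ} (hr : 0 < r) {i j : ℕ}
    (h : (Q.geom p).SizeLE (Q.D i - Q.D j) r) :
    ∫⁻ s, ENNReal.ofReal (Real.exp (Q.lam / (2 * r * Q.n) * ((f (Q.D i) s - f (Q.D j) s) -
      (risk P f (Q.D i) - risk P f (Q.D j))) - 75 * Q.lam / Q.n)) ∂P ≤ 1 := by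
  have hn := Q.cast_n_pos
  have hl := Q.lam_pos
  set X : 𝒮 → ℝ := fun s => Q.lam / (2 * r * Q.n) * (f (Q.D i) s - f (Q.D j) s)
  have hmean : ∫ s, X s ∂P = Q.lam / (2 * r * Q.n) * (risk P f (Q.D i) - risk P f (Q.D j)) := by
    rw [integral_const_mul, integral_sub (hf.integrable _ (Q.D_mem _))
      (hf.integrable _ (Q.D_mem _))]
    rfl
  have hsq (s : 𝒮) : X s ^ 2 ≤ Q.lam / (4 * Q.n) * Q.dualSqBound p (fun y => f y s) := by
    calc X s ^ 2 = (Q.lam / (2 * r * Q.n)) ^ 2 * (f (Q.D i) s - f (Q.D j) s) ^ 2 := mul_pow _ _ 2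
      _ ≤ (Q.lam / (2 * r * Q.n)) ^ 2 *
          (r ^ 2 * (Q.n / Q.lam) * Q.dualSqBound p (fun y => f y s)) := by
        gcongr; exact hf.sub_sq_le h s
      _ = _ := by field_simp; ring
  have habs (s : 𝒮) : |X s| ≤ 1 := by
    rw [← sq_le_one_iff_abs_le_one]
    calc X s ^ 2 ≤ Q.lam / (4 * Q.n) * (3 * (Q.n / Q.lam)) :=
          (hsq s).trans (by gcongr; exact hf.dualSqBound_le p s)
      _ = 3 / 4 := by field_simp
      _ ≤ 1 := by norm_num
  have hvariance : ∫ s, X s ^ 2 ∂P ≤ 75 * Q.lam / Q.n := by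
    calc ∫ s, X s ^ 2 ∂P ≤ ∫ s, Q.lam / (4 * Q.n) * Q.dualSqBound p (fun y => f y s) ∂P :=
          integral_mono_of_nonneg (ae_of_all _ fun s => sq_nonneg _)
            ((hf.integrable_dualSqBound p).const_mul _) (ae_of_all _ hsq)
      _ ≤ Q.lam / (4 * Q.n) * 300 := by
          rw [integral_const_mul]; gcongr; exact hf.integral_dualSqBound_le hp
      _ = 75 * Q.lam / Q.n := by field_simp; norm_num
  have hmeas : Measurable X := ((hf.measurable _).sub (hf.measurable _)).const_mul _
  have hX := lintegral_exp_centered_le_one P hmeas habs hvariance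
  rw [hmean] at hX
  simpa only [X, ← mul_sub] using hX

/-- The deviation of the sampled differences from their means on the block of losses that starts at
`lo`. -/
def deviation (P : Measure 𝒮) (f : Vec d → 𝒮 → ℝ) (S : Fin Q.n → 𝒮) (lo : ℕ) (u v : ℕ → ℕ) : ℝ :=
  ∑ t ∈ Finset.range Q.N,
    ((Q.sample f S (lo + t) (Q.D (u t)) - Q.sample f S (lo + t) (Q.D (v t))) -
      (risk P f (Q.D (u t)) - risk P f (Q.D (v t))))

lemma Regular.measure_deviation_le (hf : Q.Regular P f) {lo : ℕ} (hlo : Q.N ≤ lo)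
    (hlo' : lo + Q.N ≤ Q.n) {r : ℝ} (hr : 0 < r) {u v : ℕ → (Fin Q.n → 𝒮) → ℕ}
    (hu : ∀ t < Q.N, Predictable (lo + t) (u t)) (hv : ∀ t < Q.N, Predictable (lo + t) (v t))
    (hsize : ∀ S, ∀ t < Q.N,
      (Q.geom (Q.stat (Q.sample f S))).SizeLE (Q.D (u t S) - Q.D (v t S)) r) (c : ℝ) :
    (Measure.pi fun _ : Fin Q.n => P) {S | Q.DominatesMoments P f (Q.stat (Q.sample f S)) ∧
      2 * r * Q.n * (25 + c / Q.lam) ≤ deviation P f S lo (fun t => u t S) (fun t => v t S)} ≤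
      ENNReal.ofReal (Real.exp (-c)) := by
  have hn := Q.cast_n_pos
  have hl := Q.lam_pos
  refine (measure_mono ?_).trans <| measure_forall_and_le_sum_predictable_le P hlo'
    (h := fun t S => (Q.stat (Q.sample f S), u t S, v t S))
    (fun t ht => (hf.predictable_stat.mono (by omega)).map₂
      ((hu t ht).map₂ (hv t ht) Prod.mk) Prod.mk)
    (ξ := fun b s => Q.lam / (2 * r * Q.n) * ((f (Q.D b.2.1) s - f (Q.D b.2.2) s) -
      (risk P f (Q.D b.2.1) - risk P f (Q.D b.2.2))) - 75 * Q.lam / Q.n)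
    (fun b => ((((hf.measurable _).sub (hf.measurable _)).sub_const _).const_mul _).sub_const _)
    (p := fun b => Q.DominatesMoments P f b.1 ∧ (Q.geom b.1).SizeLE (Q.D b.2.1 - Q.D b.2.2) r)
    (fun b hb => hf.lintegral_exp_sub_risk_le_one hb.1 hr hb.2) c
  rintro S ⟨hp, hS⟩
  refine ⟨fun t ht => ⟨hp, hsize S t ht⟩, ?_⟩
  rw [Finset.sum_sub_distrib, Finset.sum_const, Finset.card_range, nsmul_eq_mul,
    ← Finset.mul_sum]
  have hvariance : (Q.N : ℝ) * (75 * Q.lam / Q.n) ≤ 25 * Q.lam := by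
    rw [show (Q.N : ℝ) * (75 * Q.lam / Q.n) = 75 * Q.lam * Q.N / Q.n by ring,
      div_le_iff₀ hn]
    nlinarith [Q.three_mul_cast_le]
  calc c ≤ Q.lam / (2 * r * Q.n) * (2 * r * Q.n * (25 + c / Q.lam)) -
        Q.N * (75 * Q.lam / Q.n) := by
        rw [show Q.lam / (2 * r * Q.n) * (2 * r * Q.n * (25 + c / Q.lam)) = 25 * Q.lam + c by
          field_simp]
        linarith
    _ ≤ _ := sub_le_sub_right (mul_le_mul_of_nonneg_left hS (by positivity)) _

end Setup

lemma exists_feasible_segment {d : ℕ} {n lam : ℝ} {M : MirrorGeometry d n lam} {K : ConvexDomain d}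
    {x : Vec d} (hx : x ∈ K.X) {ρ ρ' : ℝ} (hρ : 0 < ρ) (hρ' : ρ ≤ ρ') {v v' : Blocks d}
    (hv : v ∈ unitBlocks d) (hxv : x = ρ • M.toVec v) (hv' : v' ∈ feasible M K 0 ρ') :
    ∃ w ∈ feasible M K x ρ,
      x + ρ • M.toVec w = (1 - ρ / (2 * ρ')) • x + (ρ / (2 * ρ')) • (ρ' • M.toVec v') := by
  have hρ'pos : 0 < ρ' := hρ.trans_le hρ'
  have hratio : ρ / ρ' ≤ 1 := (div_le_one hρ'pos).2 hρ'
  have hhalf : ρ / (2 * ρ') ≤ 1 / 2 := by rw [div_le_iff₀ (by positivity)]; linarith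
  have hx' : ρ' • M.toVec v' ∈ K.X := by simpa using hv'.2
  set w : Blocks d := (1 / 2 : ℝ) • v' + (1 / 2 : ℝ) • ((ρ / ρ') • -v)
  have hw : w ∈ unitBlocks d := by
    refine convex_unitBlocks hv'.1 ?_ (by norm_num) (by norm_num) (by norm_num)
    have hshrink := convex_unitBlocks (neg_mem_unitBlocks hv) (zero_mem_unitBlocks (d := d))
      (show 0 ≤ ρ / ρ' by positivity) (sub_nonneg.2 hratio) (by ring)
    simpa using hshrink
  have hpoint : x + ρ • M.toVec w =
      (1 - ρ / (2 * ρ')) • x + (ρ / (2 * ρ')) • (ρ' • M.toVec v') := by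
    have hcoeff : ρ / (2 * ρ') * ρ' = ρ * (1 / 2) := by field_simp
    have hcoeff' : ρ * (1 / 2 * (ρ / ρ')) = ρ / (2 * ρ') * ρ := by field_simp
    simp only [w, map_add, map_smul, map_neg, smul_add, smul_neg, smul_smul, sub_smul, one_smul]
    rw [hcoeff, hcoeff', hxv, smul_smul]
    abel
  refine ⟨w, ⟨hw, ?_⟩, hpoint⟩
  rw [hpoint]
  exact K.convex hx hx' (by linarith) (by positivity) (by ring)

namespace Setup

variable {d : ℕ} (Q : Setup d)

/-- The empirical risk, up to normalization, on the third block of losses. -/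
def testLoss (y : ℕ → Vec d → ℝ) (x : Vec d) : ℝ :=
  ∑ t ∈ Finset.range Q.N, y (2 * Q.N + t) x

/-- The indices of the candidates, including the origin. -/
def choiceIdx (y : ℕ → Vec d → ℝ) : Option ℤ → ℕ
  | none => 0
  | some k => Q.candIdx y k

/-- The tolerance in the minimization of the score over the infinitely many candidates, which is
also the unit of the penalty. -/
def slack : Option ℤ → ℝ
  | none => 0
  | some k => Q.n * 2 ^ k

/-- The penalized test loss of a candidate, relative to that of the origin. -/
def score (y : ℕ → Vec d → ℝ) (v : Option ℤ) : ℝ :=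
  Q.testLoss y (Q.D (Q.choiceIdx y v)) - Q.testLoss y (Q.D 0) + 8300 * Q.slack v

open Classical in
/-- The index of the point that the algorithm returns, which is the origin if no candidate minimizes
the score up to its slack. -/
def outIdx (y : ℕ → Vec d → ℝ) : ℕ :=
  if h : ∃ w, ∀ v, Q.score y w - Q.slack w ≤ Q.score y v then Q.choiceIdx y h.choose else 0

lemma exists_forall_sub_slack_le {T : Option ℤ → ℝ} (h0 : T none = 0) {κ B : ℝ} (hκ : 0 < κ)
    (hT : ∀ k : ℤ, -(κ * 2 ^ k) ≤ T (some k)) (hB : ∀ v, B ≤ T v) :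
    ∃ w, ∀ v, T w - Q.slack w ≤ T v := by
  have hn := Q.cast_n_pos
  set m := ⨅ v, T v
  have hle : ∀ v, m ≤ T v := fun v => ciInf_le ⟨B, Set.forall_mem_range.2 hB⟩ v
  rcases (h0 ▸ hle none : m ≤ 0).eq_or_lt with hm0 | hm0
  · exact ⟨none, fun v => by simpa [slack, h0, ← hm0] using hle v⟩
  · set ε := min (-m / 2) (Q.n * (-m / (2 * κ)))
    have hε : 0 < ε := lt_min (by linarith) (mul_pos hn (div_pos (by linarith) (by linarith)))
    obtain ⟨v, hv⟩ := exists_lt_of_ciInf_lt (show ⨅ v, T v < m + ε by linarith)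
    have hhalf : T v < m / 2 := by linarith [min_le_left (-m / 2) (Q.n * (-m / (2 * κ)))]
    rcases v with _ | k
    · linarith
    · -- A negative score bounds the radius from below, hence its slack.
      have hk : -m / (2 * κ) ≤ 2 ^ k := by
        rw [div_le_iff₀ (by linarith)]
        linarith [hT k]
      have hslack : ε ≤ Q.slack (some k) :=
        (min_le_right _ _).trans (mul_le_mul_of_nonneg_left hk hn.le)
      exact ⟨some k, fun v => by linarith [hle v]⟩

variable {Q}

lemma tol_pos (p : GaugeIdx d → ℕ) {ρ : ℝ} (hρ : 0 < ρ) :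
    0 < ρ / (Q.Lhat + (Q.geom p).scale none) :=
  div_pos hρ (add_pos Q.Lhat_pos ((Q.geom p).scale_pos none))

lemma Lhat_mul_tol_le (p : GaugeIdx d → ℕ) {ρ : ℝ} (hρ : 0 < ρ) :
    Q.Lhat * (ρ / (Q.Lhat + (Q.geom p).scale none)) ≤ ρ := by
  have hscale := (Q.geom p).scale_pos none
  have hL := Q.Lhat_pos
  rw [mul_div_left_comm]
  exact mul_le_of_le_one_right hρ.le ((div_le_one (by positivity)).2 (by linarith))

lemma sizeLE_sub_of_norm_sub_le (p : GaugeIdx d → ℕ) {c : Vec d} {ρ : ℝ} (hρ : 0 < ρ) {v : Blocks d}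
    (hv : v ∈ unitBlocks d) {x : Vec d}
    (hx : ‖c + ρ • (Q.geom p).toVec v - x‖ ≤ ρ / (Q.Lhat + (Q.geom p).scale none)) :
    (Q.geom p).SizeLE (x - c) (3 * ρ) := by
  have hround := MirrorGeometry.sizeLE_of_norm_le Q.lam_le_n Q.Lhat_pos.le hx
  have hsize := (MirrorGeometry.sizeLE_smul_toVec (M := Q.geom p) ρ hv).add (by positivity) hρ.le
    hround.neg
  convert hsize using 1
  · abel
  · ring

section Run

variable (p : GaugeIdx d → ℕ) {c : Vec d} (hc : c ∈ Q.X)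
include hc

lemma norm_leaderPoint_sub_le {ρ : ℝ} (hρ : 0 < ρ) (k : Fin d → ℤ) :
    ‖leaderPoint (Q.geom p) Q.toConvexDomain c ρ k - Q.D (Q.runIdx p c ρ k)‖ ≤
      ρ / (Q.Lhat + (Q.geom p).scale none) :=
  norm_sub_D_nearIdx_le (leaderPoint_mem hc ρ k) (tol_pos p hρ)

lemma exists_feasible_avgPoint_eq (ρ : ℝ) (k : Fin Q.N → Fin d → ℤ) :
    ∃ v ∈ feasible (Q.geom p) Q.toConvexDomain c ρ,
      Q.avgPoint p c ρ k = c + ρ • (Q.geom p).toVec v := by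
  have hN := Q.cast_N_pos
  refine ⟨∑ t, (Q.N : ℝ)⁻¹ •
    leader (Q.geom p) Q.toConvexDomain c ρ (unquant (Q.geom p).mesh (k t)), ?_, ?_⟩
  · exact (convex_feasible c ρ).sum_mem (fun _ _ => by positivity)
      (by simp [hN.ne']) fun t _ => (leader_spec hc ρ _).1
  · simp only [avgPoint, leaderPoint, Finset.sum_add_distrib, Finset.sum_const, Finset.card_univ,
      Fintype.card_fin, smul_add, map_sum, map_smul, Finset.smul_sum]
    rw [← Nat.cast_smul_eq_nsmul ℝ, smul_smul, inv_mul_cancel₀ hN.ne', one_smul]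
    congr 1
    exact Finset.sum_congr rfl fun t _ => smul_comm _ _ _

lemma norm_avgPoint_sub_le {ρ : ℝ} (hρ : 0 < ρ) (k : Fin Q.N → Fin d → ℤ) :
    ‖Q.avgPoint p c ρ k - Q.D (Q.avgIdx p c ρ k)‖ ≤
      ρ / (Q.Lhat + (Q.geom p).scale none) := by
  obtain ⟨v, hv, havg⟩ := exists_feasible_avgPoint_eq p hc ρ k
  exact norm_sub_D_nearIdx_le (havg ▸ hv.2) (tol_pos p hρ)

lemma sizeLE_runIdx {ρ : ℝ} (hρ : 0 < ρ) (k : Fin d → ℤ) :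
    (Q.geom p).SizeLE (Q.D (Q.runIdx p c ρ k) - c) (3 * ρ) :=
  sizeLE_sub_of_norm_sub_le p hρ (leader_spec hc ρ _).1.1
    (norm_leaderPoint_sub_le p hc hρ k)

lemma norm_avgPoint_sub_average_le {ρ : ℝ} (hρ : 0 < ρ) (k : Fin Q.N → Fin d → ℤ) :
    ‖Q.avgPoint p c ρ k - ∑ t, (Q.N : ℝ)⁻¹ • Q.D (Q.runIdx p c ρ (k t))‖ ≤
      ρ / (Q.Lhat + (Q.geom p).scale none) := by
  have hN := Q.cast_N_pos
  rw [avgPoint, ← Finset.smul_sum, ← smul_sub, ← Finset.sum_sub_distrib, norm_smul,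
    Real.norm_eq_abs, abs_of_pos (by positivity), inv_mul_le_iff₀ hN]
  calc _ ≤ ∑ t, ‖leaderPoint (Q.geom p) Q.toConvexDomain c ρ (k t) -
        Q.D (Q.runIdx p c ρ (k t))‖ := norm_sum_le _ _
    _ ≤ ∑ _t : Fin Q.N, ρ / (Q.Lhat + (Q.geom p).scale none) :=
        Finset.sum_le_sum fun t _ => norm_leaderPoint_sub_le p hc hρ (k t)
    _ = _ := by simp

end Run

lemma sizeLE_avgIdx (p : GaugeIdx d → ℕ) {c : Vec d} (hc : c ∈ Q.X) {ρ : ℝ} (hρ : 0 < ρ)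
    (k : Fin Q.N → Fin d → ℤ) : (Q.geom p).SizeLE (Q.D (Q.avgIdx p c ρ k) - c) (3 * ρ) := by
  obtain ⟨v, hv, havg⟩ := exists_feasible_avgPoint_eq p hc ρ k
  exact sizeLE_sub_of_norm_sub_le p hρ hv.1 (havg ▸ norm_avgPoint_sub_le p hc hρ k)

lemma sizeLE_candIdx (y : ℕ → Vec d → ℝ) (k : ℤ) :
    (Q.geom (Q.stat y)).SizeLE (Q.D (Q.candIdx y k)) (3 * 2 ^ k) := by
  rw [← sub_zero (Q.D (Q.candIdx y k))]
  exact sizeLE_avgIdx (Q.stat y) Q.zero_mem (by positivity) _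

variable {𝒮 : Type*} [MeasurableSpace 𝒮] {P : Measure 𝒮} {f : Vec d → 𝒮 → ℝ}

lemma Regular.convexOn_risk (hf : Q.Regular P f) : ConvexOn ℝ Q.X (risk P f) := by
  refine ⟨Q.convex, fun x hx y hy a b ha hb hab => ?_⟩
  have hxy := Q.convex hx hy ha hb hab
  have hint := (hf.integrable x hx).const_mul a
  have hint' := (hf.integrable y hy).const_mul b
  calc risk P f (a • x + b • y) ≤ ∫ s, (a * f x s + b * f y s) ∂P :=
        integral_mono (hf.integrable _ hxy) (hint.add hint') fun s =>
          (hf.convexOn s).2 hx hy ha hb hab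
    _ = a • risk P f x + b • risk P f y := by
        rw [integral_add hint hint', integral_const_mul, integral_const_mul]
        rfl

lemma Regular.risk_sub_le [IsProbabilityMeasure P] (hf : Q.Regular P f) {x u : Vec d}
    (hx : x ∈ Q.X) (hu : u ∈ Q.X) : risk P f x - risk P f u ≤ Q.Lhat * ‖x - u‖ := by
  calc risk P f x - risk P f u = ∫ s, (f x s - f u s) ∂P :=
        (integral_sub (hf.integrable x hx) (hf.integrable u hu)).symm
    _ ≤ ∫ _s, Q.Lhat * ‖x - u‖ ∂P :=
        integral_mono ((hf.integrable x hx).sub (hf.integrable u hu)) (integrable_const _)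
          fun s => convexOn_sub_le_mul_norm (hf.convexOn s) hx hu (hf.differentiableAt s x hx)
            (hf.norm_gradient_le s hx)
    _ = _ := by simp

lemma Regular.risk_avgIdx_le [IsProbabilityMeasure P] (hf : Q.Regular P f) (p : GaugeIdx d → ℕ)
    {c : Vec d} (hc : c ∈ Q.X) {ρ : ℝ} (hρ : 0 < ρ) (k : Fin Q.N → Fin d → ℤ) :
    risk P f (Q.D (Q.avgIdx p c ρ k)) ≤
      (∑ t, risk P f (Q.D (Q.runIdx p c ρ (k t)))) / Q.N + 2 * ρ := by
  have hN := Q.cast_N_pos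
  have hweights : ∑ _t : Fin Q.N, (Q.N : ℝ)⁻¹ = 1 := by simp [hN.ne']
  set xbar : Vec d := ∑ t, (Q.N : ℝ)⁻¹ • Q.D (Q.runIdx p c ρ (k t))
  have hxbar : xbar ∈ Q.X :=
    Q.convex.sum_mem (fun _ _ => by positivity) hweights fun _ _ => Q.D_mem _
  have hjensen : risk P f xbar ≤ (∑ t, risk P f (Q.D (Q.runIdx p c ρ (k t)))) / Q.N := by
    refine (hf.convexOn_risk.map_sum_le (fun _ _ => by positivity) hweights
      fun _ _ => Q.D_mem _).trans_eq ?_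
    rw [← Finset.smul_sum, smul_eq_mul, inv_mul_eq_div]
  have hdist : ‖Q.D (Q.avgIdx p c ρ k) - xbar‖ ≤
      2 * (ρ / (Q.Lhat + (Q.geom p).scale none)) := by
    rw [two_mul]
    refine (norm_sub_le_norm_sub_add_norm_sub _ (Q.avgPoint p c ρ k) _).trans (add_le_add ?_ ?_)
    · rw [norm_sub_rev]; exact norm_avgPoint_sub_le p hc hρ k
    · exact norm_avgPoint_sub_average_le p hc hρ k
  have hlip := hf.risk_sub_le (Q.D_mem (Q.avgIdx p c ρ k)) hxbar
  linarith [mul_le_mul_of_nonneg_left hdist Q.Lhat_pos.le, Lhat_mul_tol_le (Q := Q) p hρ]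

lemma Regular.run_regret (hf : Q.Regular P f) (S : Fin Q.n → 𝒮) (p : GaugeIdx d → ℕ) {c : Vec d}
    (hc : c ∈ Q.X) {ρ : ℝ} (hρ : 0 < ρ) (lo : ℕ) {v : Blocks d}
    (hv : v ∈ feasible (Q.geom p) Q.toConvexDomain c ρ)
    (hdual : ∑ t ∈ Finset.range Q.N, Q.dualSqBound p (Q.sample f S (lo + t)) < 216 * Q.n) :
    ∑ t ∈ Finset.range Q.N,
      (Q.sample f S (lo + t) (Q.D (Q.runIdx p c ρ (Q.runState p c ρ lo (Q.sample f S) t))) -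
        Q.sample f S (lo + t) (c + ρ • (Q.geom p).toVec v)) ≤ 3900 * ρ * Q.n := by
  refine (gradState_regret (M := Q.geom p) Q.lam_le_n Q.Lhat_pos.le hc hρ (N := Q.N)
    (y := fun t => Q.sample f S (lo + t)) (fun t _ => hf.convexOn _)
    (fun t _ => hf.differentiableAt _) (fun t _ x hx => hf.norm_gradient_le _ hx)
    (Γ := fun t => Q.dualSqBound p (Q.sample f S (lo + t)))
    (fun t _ i => hf.dualSq_gradient_le p _ i) hv).trans ?_
  calc ρ * (4 * Q.n + 23 * Q.N +
        18 * ∑ t ∈ Finset.range Q.N, Q.dualSqBound p (Q.sample f S (lo + t)))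
      ≤ ρ * (3900 * Q.n) := by gcongr; linarith [Q.three_mul_cast_le]
    _ = _ := by ring

lemma Regular.risk_candIdx_le [IsProbabilityMeasure P] (hf : Q.Regular P f)
    (S : Fin Q.n → 𝒮) (k : ℤ) {m : ℕ} {p : GaugeIdx d → ℕ} (hp : Q.stat (Q.sample f S) = p)
    {v : Blocks d} (hv : v ∈ unitBlocks d) (hm : Q.D m = (2 : ℝ) ^ k • (Q.geom p).toVec v)
    (hdual : ∑ t ∈ Finset.range Q.N, Q.dualSqBound p (Q.sample f S (Q.N + t)) < 216 * Q.n)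
    (hdev : deviation P f S Q.N (fun _ => m) (fun t => Q.runIdx p 0 (2 ^ k)
      (Q.runState p 0 (2 ^ k) Q.N (Q.sample f S) t)) < 300 * 2 ^ k * Q.n) :
    risk P f (Q.D (Q.candIdx (Q.sample f S) k)) ≤ risk P f (Q.D m) + 21010 * 2 ^ k := by
  have hN := Q.cast_N_pos
  have hρ : (0 : ℝ) < 2 ^ k := by positivity
  set ρ : ℝ := 2 ^ k
  set idx : ℕ → ℕ := fun t => Q.runIdx p 0 ρ (Q.runState p 0 ρ Q.N (Q.sample f S) t)
  have hregret := hf.run_regret S p Q.zero_mem hρ Q.N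
    (v := v) ⟨hv, by rw [zero_add, ← hm]; exact Q.D_mem m⟩ hdual
  have hcand := hf.risk_avgIdx_le p Q.zero_mem hρ
    fun t => Q.runState p 0 ρ Q.N (Q.sample f S) t
  rw [Fin.sum_univ_eq_sum_range (fun t => risk P f (Q.D (idx t))) Q.N] at hcand
  have hsum : ∑ t ∈ Finset.range Q.N, risk P f (Q.D (idx t)) ≤
      Q.N * risk P f (Q.D m) + 4200 * ρ * Q.n := by
    rw [zero_add, ← hm] at hregret
    simp only [deviation, Finset.sum_sub_distrib, Finset.sum_const, Finset.card_range,
      nsmul_eq_mul] at hregret hdev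
    linarith
  have havg : (∑ t ∈ Finset.range Q.N, risk P f (Q.D (idx t))) / Q.N ≤
      risk P f (Q.D m) + 21000 * ρ := by
    rw [div_le_iff₀ hN]
    nlinarith [Q.cast_le_five_mul]
  rw [candIdx, hp]
  linarith

lemma Regular.convexOn_testLoss (hf : Q.Regular P f) (S : Fin Q.n → 𝒮) :
    ConvexOn ℝ Q.X (Q.testLoss (Q.sample f S)) := by
  refine ⟨Q.convex, fun x hx x' hx' a b ha hb hab => ?_⟩
  simp only [testLoss, Finset.smul_sum, ← Finset.sum_add_distrib]
  exact Finset.sum_le_sum fun t _ => (hf.convexOn _).2 hx hx' ha hb hab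

lemma Regular.testLoss_sub_le_of_feasible (hf : Q.Regular P f) (S : Fin Q.n → 𝒮) {m : ℕ}
    {p : GaugeIdx d → ℕ} {ρ : ℝ} (hρ : 0 < ρ)
    (hopt : ∀ x ∈ Q.X, risk P f (Q.D m) ≤ risk P f x + ρ)
    (hdual : ∑ t ∈ Finset.range Q.N, Q.dualSqBound p (Q.sample f S (2 * Q.N + t)) < 216 * Q.n)
    (hdev : deviation P f S (2 * Q.N) (fun _ => m) (fun t => Q.runIdx p (Q.D m) ρ
      (Q.runState p (Q.D m) ρ (2 * Q.N) (Q.sample f S) t)) < 180 * ρ * Q.n)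
    {v : Blocks d} (hv : v ∈ feasible (Q.geom p) Q.toConvexDomain (Q.D m) ρ) :
    Q.testLoss (Q.sample f S) (Q.D m) -
      Q.testLoss (Q.sample f S) (Q.D m + ρ • (Q.geom p).toVec v) ≤ 4100 * ρ * Q.n := by
  have hn := Q.three_mul_cast_le
  set idx : ℕ → ℕ := fun t =>
    Q.runIdx p (Q.D m) ρ (Q.runState p (Q.D m) ρ (2 * Q.N) (Q.sample f S) t)
  have hregret := hf.run_regret S p (Q.D_mem m) hρ (2 * Q.N) hv hdual
  have hrisk : ∑ t ∈ Finset.range Q.N, (risk P f (Q.D m) - risk P f (Q.D (idx t))) ≤ Q.N * ρ := by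
    calc _ ≤ ∑ _t ∈ Finset.range Q.N, ρ :=
          Finset.sum_le_sum fun t _ => by linarith [hopt _ (Q.D_mem (idx t))]
      _ = _ := by simp
  simp only [deviation, testLoss, Finset.sum_sub_distrib] at hregret hdev hrisk ⊢
  nlinarith

lemma Regular.testLoss_sub_le_of_le_radius (hf : Q.Regular P f) (S : Fin Q.n → 𝒮) {m : ℕ}
    {p : GaugeIdx d → ℕ} {ρ ρ' : ℝ} (hρ : 0 < ρ) (hρ' : ρ ≤ ρ') {v v' : Blocks d}
    (hv : v ∈ unitBlocks d) (hm : Q.D m = ρ • (Q.geom p).toVec v)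
    (hv' : v' ∈ feasible (Q.geom p) Q.toConvexDomain 0 ρ')
    (hlow : ∀ w ∈ feasible (Q.geom p) Q.toConvexDomain (Q.D m) ρ,
      Q.testLoss (Q.sample f S) (Q.D m) -
        Q.testLoss (Q.sample f S) (Q.D m + ρ • (Q.geom p).toVec w) ≤ 4100 * ρ * Q.n) :
    Q.testLoss (Q.sample f S) (Q.D m) -
      Q.testLoss (Q.sample f S) (ρ' • (Q.geom p).toVec v') ≤ 8200 * ρ' * Q.n := by
  have hρ'pos : 0 < ρ' := hρ.trans_le hρ'
  obtain ⟨w, hw, hpoint⟩ := exists_feasible_segment (Q.D_mem m) hρ hρ' hv hm hv'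
  set θ := ρ / (2 * ρ') with hθ
  have hθpos : 0 < θ := by positivity
  have hθle : θ ≤ 1 := by rw [hθ, div_le_one (by positivity)]; linarith
  have hx' : ρ' • (Q.geom p).toVec v' ∈ Q.X := by simpa using hv'.2
  have hconv := (hf.convexOn_testLoss S).2 (Q.D_mem m) hx' (sub_nonneg.2 hθle) hθpos.le (by ring)
  have hw_le := hlow w hw
  rw [hpoint] at hw_le
  simp only [smul_eq_mul] at hconv
  refine le_of_mul_le_mul_left ?_ hθpos
  calc _ ≤ 4100 * ρ * Q.n := by linarith
    _ = θ * (8200 * ρ' * Q.n) := by rw [hθ]; field_simp; ring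

end Setup

namespace Setup

variable {d : ℕ} {Q : Setup d} {𝒮 : Type*} [MeasurableSpace 𝒮] {P : Measure 𝒮}
  {f : Vec d → 𝒮 → ℝ}

lemma deviation_const (S : Fin Q.n → 𝒮) (i j : ℕ) :
    deviation P f S (2 * Q.N) (fun _ => i) (fun _ => j) =
      Q.testLoss (Q.sample f S) (Q.D i) - Q.testLoss (Q.sample f S) (Q.D j) -
        Q.N * (risk P f (Q.D i) - risk P f (Q.D j)) := by
  simp only [deviation, testLoss, Finset.sum_sub_distrib, Finset.sum_const, Finset.card_range,
    nsmul_eq_mul, mul_sub]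

lemma slack_nonneg (v : Option ℤ) : 0 ≤ Q.slack v := by
  rcases v with _ | k
  · exact le_rfl
  · simp only [slack]; positivity

lemma score_none (y : ℕ → Vec d → ℝ) : Q.score y none = 0 := by
  simp [score, choiceIdx, slack]

lemma Regular.testLoss_avgPoint_sub_le (hf : Q.Regular P f) (S : Fin Q.n → 𝒮)
    (p : GaugeIdx d → ℕ) {c : Vec d} (hc : c ∈ Q.X) {ρ : ℝ} (hρ : 0 < ρ)
    (k : Fin Q.N → Fin d → ℤ) :
    Q.testLoss (Q.sample f S) (Q.avgPoint p c ρ k) -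
      Q.testLoss (Q.sample f S) (Q.D (Q.avgIdx p c ρ k)) ≤ Q.N * ρ := by
  obtain ⟨v, hv, havg⟩ := exists_feasible_avgPoint_eq p hc ρ k
  have hmem : Q.avgPoint p c ρ k ∈ Q.X := havg ▸ hv.2
  rw [testLoss, testLoss, ← Finset.sum_sub_distrib]
  calc _ ≤ ∑ _t ∈ Finset.range Q.N, ρ := Finset.sum_le_sum fun t _ =>
        (convexOn_sub_le_mul_norm (hf.convexOn _) hmem (Q.D_mem _) (hf.differentiableAt _ _ hmem)
          (hf.norm_gradient_le _ hmem)).trans <|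
        (mul_le_mul_of_nonneg_left (norm_avgPoint_sub_le p hc hρ k) Q.Lhat_pos.le).trans
          (Lhat_mul_tol_le p hρ)
    _ = Q.N * ρ := by simp

lemma Regular.testLoss_sub_candIdx_le (hf : Q.Regular P f) (S : Fin Q.n → 𝒮) {m : ℕ} {k k' : ℤ}
    (hk : k ≤ k') {v : Blocks d} (hv : v ∈ unitBlocks d)
    (hm : Q.D m = (2 : ℝ) ^ k • (Q.geom (Q.stat (Q.sample f S))).toVec v)
    (hlow : ∀ w ∈ feasible (Q.geom (Q.stat (Q.sample f S))) Q.toConvexDomain (Q.D m) (2 ^ k),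
      Q.testLoss (Q.sample f S) (Q.D m) - Q.testLoss (Q.sample f S)
        (Q.D m + (2 : ℝ) ^ k • (Q.geom (Q.stat (Q.sample f S))).toVec w) ≤
          4100 * 2 ^ k * Q.n) :
    Q.testLoss (Q.sample f S) (Q.D m) -
      Q.testLoss (Q.sample f S) (Q.D (Q.candIdx (Q.sample f S) k')) ≤ 8201 * (Q.n * 2 ^ k') := by
  have hρ : (0 : ℝ) < 2 ^ k' := by positivity
  set p := Q.stat (Q.sample f S)
  set κ : Fin Q.N → Fin d → ℤ := fun t => Q.runState p 0 (2 ^ k') Q.N (Q.sample f S) t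
  obtain ⟨v', hv', havg⟩ := exists_feasible_avgPoint_eq p Q.zero_mem (2 ^ k') κ
  rw [zero_add] at havg
  have hpoint := hf.testLoss_sub_le_of_le_radius S (by positivity)
    (zpow_le_zpow_right₀ one_le_two hk) hv hm hv' hlow
  rw [← havg] at hpoint
  have hround : _ - Q.testLoss (Q.sample f S) (Q.D (Q.candIdx (Q.sample f S) k')) ≤ _ :=
    hf.testLoss_avgPoint_sub_le S p Q.zero_mem hρ κ
  nlinarith [Q.three_mul_cast_le, Q.cast_N_pos]

lemma Regular.abs_sample_candIdx_sub_le (hf : Q.Regular P f) (S : Fin Q.n → 𝒮) (k : ℤ) (t : ℕ) :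
    |Q.sample f S t (Q.D (Q.candIdx (Q.sample f S) k)) - Q.sample f S t (Q.D 0)| ≤
      6 * (Q.n / Q.lam) * 2 ^ k := by
  have hn := Q.cast_n_pos
  have hlam := Q.lam_pos
  have hsize := sizeLE_candIdx (Q := Q) (Q.sample f S) k
  rw [← sub_zero (Q.D (Q.candIdx (Q.sample f S) k)), ← Q.D_zero] at hsize
  refine abs_le_of_sq_le_sq ((hf.sub_sq_le hsize (S (Fin.ofNat Q.n t))).trans ?_) (by positivity)
  calc _ ≤ (3 * (2 : ℝ) ^ k) ^ 2 * (Q.n / Q.lam) * (3 * (Q.n / Q.lam)) := by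
        gcongr; exact hf.dualSqBound_le _ _
    _ = 27 * ((Q.n / Q.lam) * 2 ^ k) ^ 2 := by ring
    _ ≤ 36 * ((Q.n / Q.lam) * 2 ^ k) ^ 2 := by gcongr; norm_num
    _ = _ := by ring

lemma Regular.neg_le_score (hf : Q.Regular P f) (S : Fin Q.n → 𝒮) (k : ℤ) :
    -(Q.N * (6 * (Q.n / Q.lam)) * 2 ^ k) ≤ Q.score (Q.sample f S) (some k) := by
  have hsum : -(Q.N * (6 * (Q.n / Q.lam)) * 2 ^ k) ≤ ∑ t ∈ Finset.range Q.N,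
      (Q.sample f S (2 * Q.N + t) (Q.D (Q.candIdx (Q.sample f S) k)) -
        Q.sample f S (2 * Q.N + t) (Q.D 0)) := by
    calc _ = ∑ _t ∈ Finset.range Q.N, -(6 * (Q.n / Q.lam) * 2 ^ k) := by simp; ring
      _ ≤ _ := Finset.sum_le_sum fun t _ => (abs_le.1 (hf.abs_sample_candIdx_sub_le S k _)).1
  rw [Finset.sum_sub_distrib] at hsum
  exact le_add_of_le_of_nonneg hsum (mul_nonneg (by norm_num) (slack_nonneg _))

lemma Regular.exists_forall_score_sub_slack_le (hf : Q.Regular P f) (S : Fin Q.n → 𝒮) {a : ℝ}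
    {k : ℤ} (hlarge : ∀ k' ≥ k, a -
      Q.testLoss (Q.sample f S) (Q.D (Q.candIdx (Q.sample f S) k')) ≤ 8201 * (Q.n * 2 ^ k')) :
    ∃ w, ∀ v, Q.score (Q.sample f S) w - Q.slack w ≤ Q.score (Q.sample f S) v := by
  have hn := Q.cast_n_pos
  have hN := Q.cast_N_pos
  have hlam := Q.lam_pos
  set κ : ℝ := Q.N * (6 * (Q.n / Q.lam))
  have hκ : 0 < κ := by positivity
  refine Q.exists_forall_sub_slack_le (score_none _) hκ (hf.neg_le_score S)
    (B := min 0 (min (a - Q.testLoss (Q.sample f S) (Q.D 0)) (-(κ * 2 ^ k)))) ?_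
  rintro (_ | k')
  · exact (min_le_left _ _).trans_eq (score_none _).symm
  · refine (min_le_right _ _).trans ?_
    rcases le_total k k' with hk | hk
    · refine (min_le_left _ _).trans ?_
      have hpos : (0 : ℝ) < Q.n * 2 ^ k' := by positivity
      simp only [score, choiceIdx, slack]
      linarith [hlarge k' hk]
    · refine (min_le_right _ _).trans (le_trans ?_ (hf.neg_le_score S k'))
      gcongr
      exact one_le_two

lemma exists_outIdx_eq {y : ℕ → Vec d → ℝ}
    (h : ∃ w, ∀ v, Q.score y w - Q.slack w ≤ Q.score y v) :
    ∃ w, Q.outIdx y = Q.choiceIdx y w ∧ ∀ v, Q.score y w - Q.slack w ≤ Q.score y v :=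
  ⟨h.choose, dif_pos h, h.choose_spec⟩

variable (Q) in
/-- The index of the point that the run around `c` at radius `ρ` on the block of losses starting at
`lo` plays at its time `t`, with the scales estimated from `y`. -/
def playedIdx (y : ℕ → Vec d → ℝ) (c : Vec d) (ρ : ℝ) (lo t : ℕ) : ℕ :=
  Q.runIdx (Q.stat y) c ρ (Q.runState (Q.stat y) c ρ lo y t)

/-- The event, in the analysis relative to the point `D m` at the scale `2 ^ k`, that all the sums
of losses involved are close to their means. -/
structure Favorable (P : Measure 𝒮) (f : Vec d → 𝒮 → ℝ) (m : ℕ) (k : ℤ) (S : Fin Q.n → 𝒮) :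
    Prop where
  dominatesMoments : Q.DominatesMoments P f (Q.stat (Q.sample f S))
  sum_dualSqBound_run : ∑ t ∈ Finset.range Q.N,
    Q.dualSqBound (Q.stat (Q.sample f S)) (Q.sample f S (Q.N + t)) < 216 * Q.n
  sum_dualSqBound_test : ∑ t ∈ Finset.range Q.N,
    Q.dualSqBound (Q.stat (Q.sample f S)) (Q.sample f S (2 * Q.N + t)) < 216 * Q.n
  deviation_run : deviation P f S Q.N (fun _ => m)
    (Q.playedIdx (Q.sample f S) 0 (2 ^ k) Q.N) < 300 * 2 ^ k * Q.n
  deviation_localRun : deviation P f S (2 * Q.N) (fun _ => m)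
    (Q.playedIdx (Q.sample f S) (Q.D m) (2 ^ k) (2 * Q.N)) < 180 * 2 ^ k * Q.n
  deviation_candIdx : deviation P f S (2 * Q.N) (fun _ => Q.candIdx (Q.sample f S) k)
    (fun _ => m) < 300 * 2 ^ k * Q.n
  deviation_zero : deviation P f S (2 * Q.N) (fun _ => m) (fun _ => 0) < 120 * 2 ^ k * Q.n
  deviation_zero_candIdx : ∀ j : ℕ, deviation P f S (2 * Q.N) (fun _ => 0)
    (fun _ => Q.candIdx (Q.sample f S) (k + 8 - j)) < 6 * 2 ^ (k + 8 - j : ℤ) * Q.n * (30 + j)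

namespace Favorable

variable {S : Fin Q.n → 𝒮} {m : ℕ} {k : ℤ}

lemma risk_candIdx_sub_zero_le (F : Favorable P f m k S) {k' : ℤ} (hk' : k' ≤ k + 8) :
    Q.N * (risk P f (Q.D (Q.candIdx (Q.sample f S) k')) - risk P f (Q.D 0)) ≤
      Q.testLoss (Q.sample f S) (Q.D (Q.candIdx (Q.sample f S) k')) -
        Q.testLoss (Q.sample f S) (Q.D 0) + 47000 * (Q.n * 2 ^ k) := by
  have hn := Q.cast_n_pos
  obtain ⟨j, hj⟩ : ∃ j : ℕ, k' = k + 8 - j := ⟨(k + 8 - k').toNat, by omega⟩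
  have hdev := F.deviation_zero_candIdx j
  rw [← hj, deviation_const] at hdev
  have hpow : (2 : ℝ) ^ k' * 2 ^ j = 256 * 2 ^ k := by
    rw [← zpow_natCast (2 : ℝ) j, ← zpow_add₀ two_ne_zero, show k' + (j : ℤ) = 8 + k by omega,
      zpow_add₀ two_ne_zero]
    norm_num
  -- The radii decay geometrically in `j`, whereas the confidence grows only linearly.
  have hlin : (30 + j : ℝ) ≤ 30 * 2 ^ j := by
    have : (j : ℝ) + 1 ≤ 2 ^ j := by exact_mod_cast Nat.lt_two_pow_self
    have : (0 : ℝ) ≤ j := Nat.cast_nonneg j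
    linarith
  have hbound : 6 * (2 : ℝ) ^ k' * Q.n * (30 + j) ≤ 47000 * (Q.n * 2 ^ k) := by
    calc 6 * (2 : ℝ) ^ k' * Q.n * (30 + j) ≤ 6 * (2 : ℝ) ^ k' * Q.n * (30 * 2 ^ j) := by gcongr
      _ = 46080 * (Q.n * 2 ^ k) := by
        rw [show 6 * (2 : ℝ) ^ k' * Q.n * (30 * 2 ^ j) = 180 * Q.n * ((2 : ℝ) ^ k' * 2 ^ j) by ring,
          hpow]
        ring
      _ ≤ _ := by gcongr; norm_num
  linarith

lemma risk_choiceIdx_sub_zero_le (F : Favorable P f m k S) {w : Option ℤ}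
    (hlarge : ∀ k' ≥ k, Q.testLoss (Q.sample f S) (Q.D m) -
      Q.testLoss (Q.sample f S) (Q.D (Q.candIdx (Q.sample f S) k')) ≤ 8201 * (Q.n * 2 ^ k'))
    (hw : Q.testLoss (Q.sample f S) (Q.D (Q.choiceIdx (Q.sample f S) w)) + 8299 * Q.slack w ≤
      Q.testLoss (Q.sample f S) (Q.D m) + 15700 * (Q.n * 2 ^ k)) :
    Q.N * (risk P f (Q.D (Q.choiceIdx (Q.sample f S) w)) - risk P f (Q.D 0)) ≤
      Q.testLoss (Q.sample f S) (Q.D (Q.choiceIdx (Q.sample f S) w)) -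
        Q.testLoss (Q.sample f S) (Q.D 0) + 47000 * (Q.n * 2 ^ k) := by
  have hn := Q.cast_n_pos
  have hscale : (0 : ℝ) < Q.n * 2 ^ k := by positivity
  rcases w with _ | k'
  · simp only [choiceIdx, sub_self, mul_zero]
    linarith
  · refine F.risk_candIdx_sub_zero_le ?_
    simp only [choiceIdx, slack] at hw
    -- At a much larger radius, the penalty exceeds the possible gain.
    by_contra! hk'
    have hge : 256 * (Q.n * (2 : ℝ) ^ k) ≤ Q.n * 2 ^ k' := by
      calc 256 * (Q.n * (2 : ℝ) ^ k) = Q.n * 2 ^ (k + 8) := by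
            rw [zpow_add₀ two_ne_zero]; norm_num; ring
        _ ≤ Q.n * 2 ^ k' := by gcongr; exact one_le_two
    linarith [hlarge k' (by omega)]

lemma risk_outIdx_le_of_candIdx (F : Favorable P f m k S) (hf : Q.Regular P f)
    (hcand : risk P f (Q.D (Q.candIdx (Q.sample f S) k)) ≤ risk P f (Q.D m) + 21010 * 2 ^ k)
    (hlarge : ∀ k' ≥ k, Q.testLoss (Q.sample f S) (Q.D m) -
      Q.testLoss (Q.sample f S) (Q.D (Q.candIdx (Q.sample f S) k')) ≤ 8201 * (Q.n * 2 ^ k')) :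
    risk P f (Q.D (Q.outIdx (Q.sample f S))) ≤ risk P f (Q.D m) + 320000 * 2 ^ k := by
  have hn := Q.cast_n_pos
  have hN := Q.cast_N_pos
  have hρ : (0 : ℝ) < 2 ^ k := by positivity
  have hscale : (0 : ℝ) < Q.n * 2 ^ k := by positivity
  obtain ⟨w, hout, hw⟩ := exists_outIdx_eq (hf.exists_forall_score_sub_slack_le S hlarge)
  have hcandN : Q.N * (risk P f (Q.D (Q.candIdx (Q.sample f S) k)) - risk P f (Q.D m)) ≤
      7004 * (Q.n * 2 ^ k) := by
    have := mul_le_mul_of_nonneg_left (sub_le_iff_le_add'.2 hcand) hN.le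
    nlinarith [Q.three_mul_cast_le]
  have hval := F.deviation_candIdx
  have hzero := F.deviation_zero
  rw [deviation_const] at hval hzero
  have hupper : Q.testLoss (Q.sample f S) (Q.D (Q.choiceIdx (Q.sample f S) w)) +
      8299 * Q.slack w ≤ Q.testLoss (Q.sample f S) (Q.D m) + 15700 * (Q.n * 2 ^ k) := by
    have hwk := hw (some k)
    rw [score, score, choiceIdx, show Q.slack (some k) = Q.n * 2 ^ k from rfl] at hwk
    linarith
  have hrisk := F.risk_choiceIdx_sub_zero_le hlarge hupper
  have hslack := slack_nonneg (Q := Q) w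
  have hle : Q.N * (risk P f (Q.D (Q.choiceIdx (Q.sample f S) w)) - risk P f (Q.D m)) ≤
      Q.N * (320000 * 2 ^ k) := by
    have := mul_le_mul_of_nonneg_right Q.cast_le_five_mul hρ.le
    linarith
  rw [hout]
  linarith [le_of_mul_le_mul_left hle hN]

lemma risk_outIdx_le [IsProbabilityMeasure P] (F : Favorable P f m k S) (hf : Q.Regular P f)
    (hrep : ∃ v ∈ unitBlocks d,
      Q.D m = (2 : ℝ) ^ k • (Q.geom (Q.stat (Q.sample f S))).toVec v)
    (hopt : ∀ x ∈ Q.X, risk P f (Q.D m) ≤ risk P f x + 2 ^ k) :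
    risk P f (Q.D (Q.outIdx (Q.sample f S))) ≤ risk P f (Q.D m) + 320000 * 2 ^ k := by
  obtain ⟨v, hv, hm⟩ := hrep
  exact F.risk_outIdx_le_of_candIdx hf
    (hf.risk_candIdx_le S k rfl hv hm F.sum_dualSqBound_run F.deviation_run)
    fun k' hk' => hf.testLoss_sub_candIdx_le S hk' hv hm fun w hw =>
      hf.testLoss_sub_le_of_feasible S (by positivity) hopt F.sum_dualSqBound_test
        F.deviation_localRun hw

end Favorable

/-- The event that the algorithm's scales dominate, but that the deviation of a difference of size
at most `r` exceeds its typical order. The index `j` increases the confidence. -/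
def largeDeviation (P : Measure 𝒮) (f : Vec d → 𝒮 → ℝ) (lo : ℕ) (r : ℝ)
    (u v : ℕ → (Fin Q.n → 𝒮) → ℕ) (j : ℕ) : Set (Fin Q.n → 𝒮) :=
  {S | Q.DominatesMoments P f (Q.stat (Q.sample f S)) ∧
    2 * r * Q.n * (30 + j) ≤ deviation P f S lo (fun t => u t S) (fun t => v t S)}

lemma Favorable.of_notMem_largeDeviation {S : Fin Q.n → 𝒮} {m : ℕ} {k : ℤ}
    (hdom : Q.DominatesMoments P f (Q.stat (Q.sample f S)))
    (hdual : ∀ lo ∈ ({Q.N, 2 * Q.N} : Set ℕ), ∑ t ∈ Finset.range Q.N,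
      Q.dualSqBound (Q.stat (Q.sample f S)) (Q.sample f S (lo + t)) < 216 * Q.n)
    (hrun : S ∉ largeDeviation P f Q.N (5 * 2 ^ k) (fun _ _ => m)
      (fun t S => Q.playedIdx (Q.sample f S) 0 (2 ^ k) Q.N t) 0)
    (hlocal : S ∉ largeDeviation P f (2 * Q.N) (3 * 2 ^ k) (fun _ _ => m)
      (fun t S => Q.playedIdx (Q.sample f S) (Q.D m) (2 ^ k) (2 * Q.N) t) 0)
    (hcand : S ∉ largeDeviation P f (2 * Q.N) (5 * 2 ^ k)
      (fun _ S => Q.candIdx (Q.sample f S) k) (fun _ _ => m) 0)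
    (hzero : S ∉ largeDeviation P f (2 * Q.N) (2 * 2 ^ k) (fun _ _ => m) (fun _ _ => 0) 0)
    (hzero_cand : ∀ j : ℕ, S ∉ largeDeviation P f (2 * Q.N) (3 * 2 ^ (k + 8 - j : ℤ))
      (fun _ _ => 0) (fun _ S => Q.candIdx (Q.sample f S) (k + 8 - j)) j) :
    Favorable P f m k S := by
  have hlt {lo r u v j} (h : S ∉ largeDeviation P f lo r u v j) :
      deviation P f S lo (fun t => u t S) (fun t => v t S) < 2 * r * Q.n * (30 + j) :=
    not_le.1 fun hle => h ⟨hdom, hle⟩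
  exact
    { dominatesMoments := hdom
      sum_dualSqBound_run := hdual _ (by simp)
      sum_dualSqBound_test := hdual _ (by simp)
      deviation_run := (hlt hrun).trans_eq (by push_cast; ring)
      deviation_localRun := (hlt hlocal).trans_eq (by push_cast; ring)
      deviation_candIdx := (hlt hcand).trans_eq (by push_cast; ring)
      deviation_zero := (hlt hzero).trans_eq (by push_cast; ring)
      deviation_zero_candIdx := fun j => (hlt (hzero_cand j)).trans_eq (by ring) }

lemma measure_union_le_of_le {α : Type*} [MeasurableSpace α] {μ : Measure α} {A B : Set α}
    {a b : ℝ≥0∞} (hA : μ A ≤ a) (hB : μ B ≤ b) : μ (A ∪ B) ≤ a + b :=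
  (measure_union_le A B).trans (add_le_add hA hB)

variable [IsProbabilityMeasure P] {δ : ℝ}

lemma Regular.measure_not_dominatesMoments_le (hf : Q.Regular P f) (hlam : Real.exp (-Q.lam) = δ)
    (hlamd : Real.exp (-Q.lamd) = δ / d) :
    (Measure.pi fun _ : Fin Q.n => P) {S | ¬Q.DominatesMoments P f (Q.stat (Q.sample f S))} ≤
      ENNReal.ofReal (3 * δ ^ 5) := by
  have hδ : 0 < δ := hlam ▸ Real.exp_pos _
  have hd : (1 : ℝ) ≤ d := by exact_mod_cast Q.d_pos
  have hnorm : Real.exp (-(5 * Q.logFactor none)) = δ ^ 5 := by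
    rw [← hlam, ← Real.exp_nat_mul]
    simp [logFactor]
  have hcoord (i : Option (Fin d)) : Real.exp (-(5 * Q.logFactor (some i))) = (δ / d) ^ 5 := by
    rw [← hlamd, ← Real.exp_nat_mul]
    simp [logFactor]
  calc _ ≤ (Measure.pi fun _ : Fin Q.n => P) (⋃ i, {S | 100 * Q.scale (Q.stat (Q.sample f S)) i ^ 2
          < ∫ s, Q.supGauge i (fun y => f y s) ^ 2 ∂P}) :=
        measure_mono fun S hS => by simpa [DominatesMoments] using hS
    _ ≤ ∑ i, ENNReal.ofReal (Real.exp (-(5 * Q.logFactor i))) :=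
        (measure_iUnion_fintype_le _ _).trans
          (Finset.sum_le_sum fun i _ => hf.measure_scale_lt_le i)
    _ = ENNReal.ofReal (δ ^ 5 + (d + 1) * (δ / d) ^ 5) := by
        rw [← ENNReal.ofReal_sum_of_nonneg fun i _ => (Real.exp_pos _).le, Fintype.sum_option]
        simp [hnorm, hcoord]
    _ ≤ _ := by
        refine ENNReal.ofReal_le_ofReal ?_
        have : (d + 1) * (δ / d) ^ 5 ≤ 2 * δ ^ 5 := by
          rw [div_pow, mul_div_assoc', div_le_iff₀ (by positivity)]
          have : (d : ℝ) + 1 ≤ 2 * d ^ 5 := by linarith [le_self_pow₀ hd (show 5 ≠ 0 by norm_num)]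
          nlinarith [pow_pos hδ 5]
        linarith

lemma Regular.measure_largeDeviation_le (hf : Q.Regular P f) (hlam : Real.exp (-Q.lam) = δ)
    {lo : ℕ} (hlo : Q.N ≤ lo) (hlo' : lo + Q.N ≤ Q.n) {r : ℝ} (hr : 0 < r)
    {u v : ℕ → (Fin Q.n → 𝒮) → ℕ} (hu : ∀ t < Q.N, Predictable (lo + t) (u t))
    (hv : ∀ t < Q.N, Predictable (lo + t) (v t))
    (hsize : ∀ S, ∀ t < Q.N,
      (Q.geom (Q.stat (Q.sample f S))).SizeLE (Q.D (u t S) - Q.D (v t S)) r) (j : ℕ) :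
    (Measure.pi fun _ : Fin Q.n => P) (largeDeviation P f lo r u v j) ≤
      ENNReal.ofReal (δ ^ (5 + j)) := by
  have hdev := hf.measure_deviation_le hlo hlo' hr hu hv hsize ((5 + j) * Q.lam)
  rw [show -((5 + j) * Q.lam) = (5 + j : ℕ) * (-Q.lam) by push_cast; ring, Real.exp_nat_mul,
    hlam, mul_div_cancel_right₀ _ Q.lam_pos.ne', ← add_assoc,
    show (25 : ℝ) + 5 = 30 by norm_num] at hdev
  exact hdev

lemma Regular.measure_iUnion_largeDeviation_le (hf : Q.Regular P f) (hδ : δ ≤ 1 / 2)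
    (hlam : Real.exp (-Q.lam) = δ) (k : ℤ) :
    (Measure.pi fun _ : Fin Q.n => P) (⋃ j : ℕ, largeDeviation P f (2 * Q.N)
      (3 * 2 ^ (k - j : ℤ)) (fun _ _ => 0) (fun _ S => Q.candIdx (Q.sample f S) (k - j)) j) ≤
      ENNReal.ofReal (2 * δ ^ 5) := by
  have hδpos : 0 < δ := hlam ▸ Real.exp_pos _
  have hn := Q.three_mul_le
  have hsum : Summable fun j : ℕ => δ ^ 5 * δ ^ j :=
    (summable_geometric_of_lt_one hδpos.le (by linarith)).mul_left _
  calc _ ≤ ∑' j : ℕ, ENNReal.ofReal (δ ^ (5 + j)) :=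
        (measure_iUnion_le _).trans <| ENNReal.tsum_le_tsum fun j =>
          hf.measure_largeDeviation_le hlam (by omega) (by omega) (by positivity)
            (fun _ _ => Predictable.const _ _)
            (fun t _ => (hf.predictable_candIdx _).mono (by omega))
            (fun S t _ => by rw [Q.D_zero, zero_sub]; exact (sizeLE_candIdx _ _).neg) j
    _ = ENNReal.ofReal (δ ^ 5 * (1 - δ)⁻¹) := by
        simp only [pow_add]
        rw [← ENNReal.ofReal_tsum_of_nonneg (fun j => by positivity) hsum, tsum_mul_left,
          tsum_geometric_of_lt_one hδpos.le (by linarith)]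
    _ ≤ _ := by
        refine ENNReal.ofReal_le_ofReal ?_
        rw [mul_comm]
        gcongr
        exact inv_le_of_inv_le₀ (by norm_num) (by linarith)

lemma Regular.measure_iUnion_dualSqBound_le (hf : Q.Regular P f) (hlam : Real.exp (-Q.lam) = δ) :
    (Measure.pi fun _ : Fin Q.n => P) (⋃ lo ∈ ({Q.N, 2 * Q.N} : Set ℕ),
      {S | Q.DominatesMoments P f (Q.stat (Q.sample f S)) ∧ 216 * Q.n ≤ ∑ t ∈ Finset.range Q.N,
        Q.dualSqBound (Q.stat (Q.sample f S)) (Q.sample f S (lo + t))}) ≤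
      ENNReal.ofReal (δ ^ 5 + δ ^ 5) := by
  have hδ : 0 < δ := hlam ▸ Real.exp_pos _
  have hn := Q.three_mul_le
  have hpow : Real.exp (-(5 * Q.lam)) = δ ^ 5 := by
    rw [← hlam, ← Real.exp_nat_mul]
    simp
  rw [Set.biUnion_pair, ENNReal.ofReal_add (by positivity) (by positivity), ← hpow]
  exact (measure_union_le _ _).trans (add_le_add
    (hf.measure_sum_dualSqBound_le le_rfl (by omega))
    (hf.measure_sum_dualSqBound_le (by omega) (by omega)))

lemma Regular.measure_union_largeDeviation_le (hf : Q.Regular P f) (hlam : Real.exp (-Q.lam) = δ)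
    {m : ℕ} {k : ℤ}
    (hm : ∀ S : Fin Q.n → 𝒮, (Q.geom (Q.stat (Q.sample f S))).SizeLE (Q.D m) (2 * 2 ^ k)) :
    (Measure.pi fun _ : Fin Q.n => P)
      (largeDeviation P f Q.N (5 * 2 ^ k) (fun _ _ => m)
        (fun t S => Q.playedIdx (Q.sample f S) 0 (2 ^ k) Q.N t) 0 ∪
      largeDeviation P f (2 * Q.N) (3 * 2 ^ k) (fun _ _ => m)
        (fun t S => Q.playedIdx (Q.sample f S) (Q.D m) (2 ^ k) (2 * Q.N) t) 0 ∪
      largeDeviation P f (2 * Q.N) (5 * 2 ^ k)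
        (fun _ S => Q.candIdx (Q.sample f S) k) (fun _ _ => m) 0 ∪
      largeDeviation P f (2 * Q.N) (2 * 2 ^ k) (fun _ _ => m) (fun _ _ => 0) 0) ≤
      ENNReal.ofReal (4 * δ ^ 5) := by
  have hδ : 0 < δ := hlam ▸ Real.exp_pos _
  have hn := Q.three_mul_le
  have hρ : (0 : ℝ) < 2 ^ k := by positivity
  have hconst (t i : ℕ) : Predictable t fun _ : Fin Q.n → 𝒮 => i := Predictable.const t i
  rw [show 4 * δ ^ 5 = δ ^ (5 + 0) + δ ^ (5 + 0) + δ ^ (5 + 0) + δ ^ (5 + 0) by ring,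
    ENNReal.ofReal_add (by positivity) (by positivity),
    ENNReal.ofReal_add (by positivity) (by positivity),
    ENNReal.ofReal_add (by positivity) (by positivity)]
  refine measure_union_le_of_le (measure_union_le_of_le (measure_union_le_of_le ?_ ?_) ?_) ?_
  · refine hf.measure_largeDeviation_le hlam le_rfl (by omega) (by positivity)
      (fun t _ => hconst _ _)
      (fun t ht => (hf.predictable_runIdx 0 (2 ^ k) le_rfl t (by omega)).map Prod.snd)
      (fun S t _ => ?_) 0
    rw [show (5 : ℝ) * 2 ^ k = 2 * 2 ^ k + 3 * 2 ^ k by ring, sub_eq_add_neg]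
    exact (hm S).add (by positivity) (by positivity)
      (by simpa using (sizeLE_runIdx (Q.stat (Q.sample f S)) Q.zero_mem hρ _).neg)
  · refine hf.measure_largeDeviation_le hlam (by omega) (by omega) (by positivity)
      (fun t _ => hconst _ _)
      (fun t ht => (hf.predictable_runIdx (Q.D m) (2 ^ k) (by omega) t (by omega)).map Prod.snd)
      (fun S t _ => ?_) 0
    rw [← neg_sub]
    exact (sizeLE_runIdx (Q.stat (Q.sample f S)) (Q.D_mem m) hρ _).neg
  · refine hf.measure_largeDeviation_le hlam (by omega) (by omega) (by positivity)
      (fun t _ => (hf.predictable_candIdx k).mono (by omega)) (fun t _ => hconst _ _)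
      (fun S t _ => ?_) 0
    rw [show (5 : ℝ) * 2 ^ k = 3 * 2 ^ k + 2 * 2 ^ k by ring, sub_eq_add_neg]
    exact (sizeLE_candIdx _ k).add (by positivity) (by positivity) (hm S).neg
  · exact hf.measure_largeDeviation_le hlam (by omega) (by omega) (by positivity)
      (fun t _ => hconst _ _) (fun t _ => hconst _ _)
      (fun S t _ => by rw [Q.D_zero, sub_zero]; exact hm S) 0

lemma Regular.measure_not_favorable_le (hf : Q.Regular P f) (hδ : δ ≤ 1 / 2)
    (hlam : Real.exp (-Q.lam) = δ) (hlamd : Real.exp (-Q.lamd) = δ / d) {m : ℕ} {k : ℤ}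
    (hm : ∀ S : Fin Q.n → 𝒮, (Q.geom (Q.stat (Q.sample f S))).SizeLE (Q.D m) (2 * 2 ^ k)) :
    (Measure.pi fun _ : Fin Q.n => P) {S | ¬Favorable P f m k S} ≤ ENNReal.ofReal δ := by
  have hδpos : 0 < δ := hlam ▸ Real.exp_pos _
  refine (measure_mono fun S hS => ?_).trans <| (measure_union_le_of_le (measure_union_le_of_le
    (measure_union_le_of_le (hf.measure_not_dominatesMoments_le hlam hlamd)
      (hf.measure_iUnion_dualSqBound_le hlam)) (hf.measure_union_largeDeviation_le hlam hm))
    (hf.measure_iUnion_largeDeviation_le hδ hlam (k + 8))).trans ?_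
  · contrapose! hS
    simp only [Set.mem_union, Set.mem_iUnion, not_or, not_exists] at hS
    obtain ⟨⟨⟨hdom, hdual⟩, ⟨⟨hrun, hlocal⟩, hcand⟩, hzero⟩, hzero_cand⟩ := hS
    have hdom := not_not.1 hdom
    exact not_not.2 <| Favorable.of_notMem_largeDeviation hdom
      (fun lo hlo => not_le.1 fun hle => hdual lo hlo ⟨hdom, hle⟩) hrun hlocal hcand hzero
      hzero_cand
  · rw [← ENNReal.ofReal_add (by positivity) (by positivity),
      ← ENNReal.ofReal_add (by positivity) (by positivity),
      ← ENNReal.ofReal_add (by positivity) (by positivity)]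
    refine ENNReal.ofReal_le_ofReal ?_
    have hpow : δ ^ 4 ≤ (1 / 2) ^ 4 := pow_le_pow_left₀ hδpos.le hδ 4
    nlinarith

theorem Regular.measure_lt_risk_outIdx_le (hf : Q.Regular P f) (hδ : δ ≤ 1 / 2)
    (hlam : Real.exp (-Q.lam) = δ) (hlamd : Real.exp (-Q.lamd) = δ / d) {m : ℕ} {k : ℤ}
    (hrep : ∀ S : Fin Q.n → 𝒮, ∃ v ∈ unitBlocks d,
      Q.D m = (2 : ℝ) ^ k • (Q.geom (Q.stat (Q.sample f S))).toVec v)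
    (hopt : ∀ x ∈ Q.X, risk P f (Q.D m) ≤ risk P f x + 2 ^ k) :
    (Measure.pi fun _ : Fin Q.n => P)
      {S | risk P f (Q.D m) + 320000 * 2 ^ k < risk P f (Q.D (Q.outIdx (Q.sample f S)))} ≤
      ENNReal.ofReal δ := by
  refine (measure_mono fun S hS => ?_).trans
    (hf.measure_not_favorable_le hδ hlam hlamd (m := m) (k := k) fun S => ?_)
  · rw [Set.mem_ofPred_eq] at hS ⊢
    exact fun F => hS.not_ge (F.risk_outIdx_le hf (hrep S) hopt)
  · obtain ⟨v, hv, hm⟩ := hrep S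
    exact hm ▸ MirrorGeometry.sizeLE_smul_toVec _ hv

end Setup

namespace MirrorGeometry

variable {d : ℕ} {n lam : ℝ} (M : MirrorGeometry d n lam) {y : Vec d} {ρ : ℝ}

lemma exists_eq_smul_toVec_of_norm_le (hρ : 0 < ρ)
    (hy : M.scale none * ‖y‖ * √lam / √n ≤ ρ) : ∃ v ∈ unitBlocks d, y = ρ • M.toVec v := by
  have hn := M.n_pos
  have hlam := M.lam_pos
  have hscale := M.scale_pos none
  refine ⟨(fun j => M.scale none * √lam / √n / ρ * y j, 0, 0), ⟨?_, by simp, by simp⟩, ?_⟩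
  · simp only [mul_pow]
    rw [← Finset.mul_sum, ← EuclideanSpace.real_norm_sq_eq, ← mul_pow]
    refine pow_le_one₀ (by positivity) ?_
    rw [div_mul_eq_mul_div, div_le_one hρ]
    exact (by ring : _ = _).trans_le hy
  · ext j
    simp only [toVec, Real.sqrt_div hn.le, LinearMap.coe_mk, AddHom.coe_mk, PiLp.smul_apply,
      Pi.zero_apply, mul_zero, add_zero, smul_eq_mul]
    field_simp

lemma exists_eq_smul_toVec_of_norm1_le (hρ : 0 < ρ)
    (hy : M.scale (some none) * norm1 y * √M.lamd / √n ≤ ρ) :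
    ∃ v ∈ unitBlocks d, y = ρ • M.toVec v := by
  have hn := M.n_pos
  have hlamd := M.lamd_pos
  have hscale := M.scale_pos (some none)
  refine ⟨(0, fun j => M.scale (some none) * √M.lamd / √n / ρ * y j, 0),
    ⟨by simp, ?_, by simp⟩, ?_⟩
  · simp only [abs_mul]
    rw [← Finset.mul_sum, abs_of_pos (by positivity), div_mul_eq_mul_div, div_le_one hρ]
    exact (by rw [norm1]; ring : _ = _).trans_le hy
  · ext j
    simp only [toVec, Real.sqrt_div hn.le, LinearMap.coe_mk, AddHom.coe_mk, PiLp.smul_apply,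
      Pi.zero_apply, mul_zero, add_zero, zero_add, smul_eq_mul]
    field_simp

lemma exists_eq_smul_toVec_of_normInf_le (hρ : 0 < ρ)
    (hy : (∑ j, M.scale (some (some j))) * normInf y * √lam / √n ≤ ρ) :
    ∃ v ∈ unitBlocks d, y = ρ • M.toVec v := by
  have hn := M.n_pos
  have hlam := M.lam_pos
  have hscale (j : Fin d) := M.scale_pos (some (some j))
  set W := ∑ j, M.scale (some (some j))
  have hW : 0 ≤ W := Finset.sum_nonneg fun j _ => (hscale j).le
  have hinf := normInf_nonneg y
  refine ⟨(0, 0, fun j => √(M.scale (some (some j))) * (√W * √lam / √n / ρ) * y j),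
    ⟨by simp, by simp, ?_⟩, ?_⟩
  · calc ∑ j, (√(M.scale (some (some j))) * (√W * √lam / √n / ρ) * y j) ^ 2
        ≤ ∑ j, M.scale (some (some j)) * ((√W * √lam / √n / ρ) ^ 2 * normInf y ^ 2) := by
          refine Finset.sum_le_sum fun j _ => ?_
          rw [mul_pow, mul_pow, Real.sq_sqrt (hscale j).le, mul_assoc, ← sq_abs (y j)]
          have := hscale j
          gcongr
          exact abs_le_normInf y j
      _ = (W * normInf y * √lam / √n / ρ) ^ 2 := by
          rw [← Finset.sum_mul]
          change W * _ = _
          simp only [div_pow, mul_pow, Real.sq_sqrt hW]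
          ring
      _ ≤ 1 := pow_le_one₀ (by positivity) ((div_le_one hρ).2 hy)
  · ext j
    have hj := hscale j
    have hWpos : 0 < W := Finset.sum_pos (fun i _ => hscale i) ⟨j, Finset.mem_univ j⟩
    simp only [toVec, Real.sqrt_div hn.le, LinearMap.coe_mk, AddHom.coe_mk, PiLp.smul_apply,
      Pi.zero_apply, mul_zero, zero_add, smul_eq_mul]
    change y j = ρ * (√n / √lam / (√(M.scale (some (some j))) * √W) * _)
    field_simp

end MirrorGeometry

lemma mul_sqrt_div_le {a b u v : ℝ} (hu : 0 < u) (hv : 0 < v) (h : a ≤ b * √(u / v)) :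
    a * √(v / u) ≤ b := by
  rw [← inv_div u v, Real.sqrt_inv, ← div_eq_mul_inv]
  exact (div_le_iff₀ (Real.sqrt_pos.2 (div_pos hu hv))).2 h

namespace Setup

variable {d : ℕ} {Q : Setup d}

lemma scale_sq_le {y : ℕ → Vec d → ℝ} {i : GaugeIdx d} {c : ℝ}
    (h : ∀ t, Q.supGauge i (y t) ≤ c) :
    Q.scale (Q.stat y) i ^ 2 ≤ c ^ 2 + 2 * Q.resolution i ^ 2 := by
  have hres : 0 < Q.resolution i ^ 2 := pow_pos (Q.resolution_pos i) 2
  have hstat : (Q.stat y i : ℝ) ≤ (c ^ 2 / Q.resolution i ^ 2 + 1) * Q.N := by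
    rw [stat, Nat.cast_sum]
    refine (Finset.sum_le_card_nsmul _ _ (c ^ 2 / Q.resolution i ^ 2 + 1) fun t _ => ?_).trans_eq
      (by rw [Finset.card_range, nsmul_eq_mul, mul_comm])
    refine (Nat.ceil_lt_add_one (by positivity)).le.trans ?_
    gcongr
    · exact ConvexDomain.supGauge_nonneg _ _
    · exact h t
  rw [scale_sq]
  calc Q.resolution i ^ 2 * ((Q.stat y i : ℝ) / Q.N + 1)
      ≤ Q.resolution i ^ 2 * ((c ^ 2 / Q.resolution i ^ 2 + 1) + 1) := by
        gcongr
        exact (div_le_iff₀ Q.cast_N_pos).2 hstat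
    _ = c ^ 2 + 2 * Q.resolution i ^ 2 := by
        rw [add_assoc, mul_add, mul_div_cancel₀ _ hres.ne']
        ring

lemma scale_le_add {y : ℕ → Vec d → ℝ} {i : GaugeIdx d} {c : ℝ} (hc : 0 ≤ c)
    (h : ∀ t, Q.supGauge i (y t) ≤ c) :
    Q.scale (Q.stat y) i ≤ c + 2 * Q.resolution i := by
  have hres := Q.resolution_pos i
  refine le_of_sq_le_sq ((scale_sq_le h).trans ?_) (by positivity)
  nlinarith [mul_nonneg hc hres.le]

lemma scale_le_two_mul {y : ℕ → Vec d → ℝ} {i : GaugeIdx d} {c : ℝ} (hc : 0 ≤ c)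
    (h : ∀ t, Q.supGauge i (y t) ≤ c) (hres : Q.resolution i ≤ c) :
    Q.scale (Q.stat y) i ≤ 2 * c := by
  refine le_of_sq_le_sq ((scale_sq_le h).trans ?_) (by positivity)
  nlinarith [pow_le_pow_left₀ (Q.resolution_pos i).le hres 2]

lemma sum_resolution_eq :
    ∑ j, Q.resolution (some (some j)) = 2 * ∑ j, Q.lhat j * √(Q.lamd / Q.n) := by
  have hd : (d : ℝ) ≠ 0 := Nat.cast_ne_zero.2 Q.d_pos.ne'
  simp only [resolution, hat, logFactor]
  rw [← Finset.sum_mul, ← Finset.sum_mul, Finset.sum_add_distrib, Finset.sum_const,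
    Finset.card_univ, Fintype.card_fin, nsmul_eq_mul]
  field_simp
  ring

/-- The scales that correspond to the statistics `p` are at most of the order of the true sizes of
the gradients, which the algorithm does not know. -/
structure ScaleBounds (Q : Setup d) (p : GaugeIdx d → ℕ) (L : ℝ) (ℓ : Fin d → ℝ) : Prop where
  euclidean : Q.scale p none ≤ 2 * L
  sup : Q.scale p (some none) ≤ 2 * normInf ℓ
  coord : ∑ j, Q.scale p (some (some j)) ≤ 5 * norm1 ℓ

lemma scaleBounds_stat {y : ℕ → Vec d → ℝ} {L : ℝ} {ℓ : Fin d → ℝ}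
    (hL₀ : 0 ≤ L) (hℓ₀ : ∀ j, 0 ≤ ℓ j)
    (hL : ∀ t, ∀ x ∈ Q.X, ‖gradient (y t) x‖ ≤ L)
    (hℓ : ∀ t, ∀ x ∈ Q.X, ∀ j, |gradient (y t) x j| ≤ ℓ j)
    (hLhat : Q.Lhat ≤ L * √(Q.n / Q.lam)) (hlhat : ∀ j, Q.lhat j ≤ ℓ j * √(Q.n / Q.lamd)) :
    Q.ScaleBounds (Q.stat y) L ℓ := by
  have hn := Q.cast_n_pos
  have hlamd : 0 < Q.lamd := Q.lam_pos.trans_le Q.lam_le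
  have hle (j : Fin d) : ℓ j ≤ normInf ℓ := (le_abs_self _).trans (abs_le_normInf ℓ j)
  refine ⟨?_, ?_, ?_⟩
  · exact scale_le_two_mul hL₀ (fun t => ConvexDomain.supGauge_le fun x hx => hL t x hx)
      (mul_sqrt_div_le hn Q.lam_pos hLhat)
  · refine scale_le_two_mul (normInf_nonneg ℓ)
      (fun t => ConvexDomain.supGauge_le fun x hx => normInf_le (normInf_nonneg ℓ) fun j =>
        (hℓ t x hx j).trans (hle j)) (mul_sqrt_div_le hn hlamd ?_)
    refine normInf_le (mul_nonneg (normInf_nonneg ℓ) (Real.sqrt_nonneg _)) fun j => ?_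
    rw [abs_of_nonneg (Q.lhat_nonneg j)]
    exact (hlhat j).trans (mul_le_mul_of_nonneg_right (hle j) (Real.sqrt_nonneg _))
  · have hsum : ∑ j, Q.lhat j * √(Q.lamd / Q.n) ≤ ∑ j, ℓ j :=
      Finset.sum_le_sum fun j _ => mul_sqrt_div_le hn hlamd (hlhat j)
    have hnorm1 : norm1 ℓ = ∑ j, ℓ j := Finset.sum_congr rfl fun j _ => abs_of_nonneg (hℓ₀ j)
    calc ∑ j, Q.scale (Q.stat y) (some (some j))
        ≤ ∑ j, (ℓ j + 2 * Q.resolution (some (some j))) := Finset.sum_le_sum fun j _ =>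
          scale_le_add (hℓ₀ j) fun t => ConvexDomain.supGauge_le fun x hx => hℓ t x hx j
      _ = norm1 ℓ + 4 * ∑ j, Q.lhat j * √(Q.lamd / Q.n) := by
          rw [Finset.sum_add_distrib, ← Finset.mul_sum, sum_resolution_eq, hnorm1]
          ring
      _ ≤ 5 * norm1 ℓ := by linarith

lemma ScaleBounds.exists_eq_smul_toVec {p : GaugeIdx d → ℕ} {L : ℝ} {ℓ : Fin d → ℝ}
    (h : Q.ScaleBounds p L ℓ) {δ : ℝ} (hlam : Real.log (1 / δ) = Q.lam)
    (hlamd : Real.log (d / δ) = Q.lamd) {y : Vec d} {ρ : ℝ} (hρ : 0 < ρ)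
    (hy : 5 * rate Q.n δ L ℓ y ≤ ρ) : ∃ v ∈ unitBlocks d, y = ρ • (Q.geom p).toVec v := by
  rw [mul_comm, ← le_div_iff₀ (by norm_num), rate, min_le_iff, min_le_iff, hlam, hlamd] at hy
  have hinf := normInf_nonneg y
  have hone := norm1_nonneg y
  rcases hy with hy | hy | hy
  · refine (Q.geom p).exists_eq_smul_toVec_of_norm_le hρ ?_
    calc Q.scale p none * ‖y‖ * √Q.lam / √Q.n ≤ 2 * L * ‖y‖ * √Q.lam / √Q.n := by
          gcongr; exact h.euclidean
      _ = 2 * (L * ‖y‖ * √Q.lam / √Q.n) := by ring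
      _ ≤ ρ := by linarith
  · refine (Q.geom p).exists_eq_smul_toVec_of_norm1_le hρ ?_
    calc Q.scale p (some none) * norm1 y * √Q.lamd / √Q.n
        ≤ 2 * normInf ℓ * norm1 y * √Q.lamd / √Q.n := by gcongr; exact h.sup
      _ = 2 * (normInf ℓ * norm1 y * √Q.lamd / √Q.n) := by ring
      _ ≤ ρ := by linarith
  · refine (Q.geom p).exists_eq_smul_toVec_of_normInf_le hρ ?_
    calc (∑ j, Q.scale p (some (some j))) * normInf y * √Q.lam / √Q.n
        ≤ 5 * norm1 ℓ * normInf y * √Q.lam / √Q.n := by gcongr; exact h.coord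
      _ = 5 * (norm1 ℓ * normInf y * √Q.lam / √Q.n) := by ring
      _ ≤ ρ := by linarith

end Setup

variable {d : ℕ}

lemma continuous_rate (n : ℕ) (δ L : ℝ) (ℓ : Fin d → ℝ) : Continuous (rate n δ L ℓ) := by
  unfold rate norm1 normInf
  fun_prop

lemma rate_nonneg (n : ℕ) (δ : ℝ) {L : ℝ} (hL : 0 ≤ L) (ℓ : Fin d → ℝ) (x : Vec d) :
    0 ≤ rate n δ L ℓ x := by
  have := norm1_nonneg ℓ
  have := normInf_nonneg ℓ
  have := norm1_nonneg x
  have := normInf_nonneg x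
  exact le_min (by positivity) (le_min (by positivity) (by positivity))

section Minimizers

variable {𝒮 : Type*} [MeasurableSpace 𝒮] {X : Set (Vec d)} {P : Measure 𝒮}
  {f : Vec d → 𝒮 → ℝ} {x : Vec d}

lemma isLeast_risk_of_mem_minimizers (hx : x ∈ minimizers X P f) :
    IsLeast (risk P f '' X) (risk P f x) :=
  ⟨Set.mem_image_of_mem _ hx.1, Set.forall_mem_image.2 hx.2⟩

lemma optValue_eq_of_mem_minimizers (hx : x ∈ minimizers X P f) : optValue X P f = risk P f x :=
  (isLeast_risk_of_mem_minimizers hx).csInf_eq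

end Minimizers

lemma measure_lt_le_of_forall_gt {α : Type*} [MeasurableSpace α] {μ : Measure α} {g : α → ℝ}
    {a : ℝ} {b : ℝ≥0∞} (h : ∀ c > a, μ {ω | c < g ω} ≤ b) : μ {ω | a < g ω} ≤ b := by
  obtain ⟨u, hu, hlt, hlim⟩ := exists_seq_strictAnti_tendsto a
  have hglb : IsGLB (Set.range u) a := isGLB_of_tendsto_atTop hu.antitone hlim
  have hunion : {ω | a < g ω} = ⋃ i, {ω | u i < g ω} := by
    change g ⁻¹' Set.Ioi a = ⋃ i, g ⁻¹' Set.Ioi (u i)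
    rw [← Set.preimage_iUnion, hglb.iUnion_Ioi_eq]
  have hmono : Monotone fun i => {ω | u i < g ω} := fun i j hij ω hω =>
    (hu.antitone hij).trans_lt hω
  rw [hunion, hmono.measure_iUnion]
  exact iSup_le fun i => h (u i) (hlt i)

namespace Setup

variable {Q : Setup d} {𝒮 : Type*} [MeasurableSpace 𝒮] {P : Measure 𝒮} [IsProbabilityMeasure P]
  {f : Vec d → 𝒮 → ℝ} {δ L : ℝ} {ℓ : Fin d → ℝ}

lemma Regular.exists_mem_nhds_risk_le (hf : Q.Regular P f) {x : Vec d} (hx : x ∈ Q.X)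
    {U : Set (Vec d)} (hU : U ∈ nhds x) {ε : ℝ} (hε : 0 < ε) :
    ∃ m, Q.D m ∈ U ∧ risk P f (Q.D m) ≤ risk P f x + ε := by
  obtain ⟨r, hr, hball⟩ := Metric.nhds_basis_closedBall.mem_iff.1 hU
  obtain ⟨m, hm⟩ := Q.D_dense x hx (min r (ε / Q.Lhat)) (lt_min hr (div_pos hε Q.Lhat_pos))
  rw [norm_sub_rev, le_min_iff, le_div_iff₀' Q.Lhat_pos] at hm
  refine ⟨m, hball (mem_closedBall_iff_norm.2 hm.1), ?_⟩
  linarith [hf.risk_sub_le (Q.D_mem m) hx]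

lemma Regular.measure_add_lt_risk_outIdx_le (hf : Q.Regular P f) (hδ : 0 < δ) (hδ' : δ ≤ 1 / 2)
    (hlam : Real.log (1 / δ) = Q.lam) (hlamd : Real.log (d / δ) = Q.lamd)
    (hscale : ∀ S, Q.ScaleBounds (Q.stat (Q.sample f S)) L ℓ) {x : Vec d}
    (hx : x ∈ minimizers Q.X P f) {r : ℝ} (hr : 0 < r) (hxr : rate Q.n δ L ℓ x < r) :
    Measure.pi (fun _ : Fin Q.n => P)
      {S | risk P f x + 3200010 * r < risk P f (Q.D (Q.outIdx (Q.sample f S)))} ≤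
      ENNReal.ofReal δ := by
  have hd : (0 : ℝ) < d := Nat.cast_pos.2 Q.d_pos
  obtain ⟨k, hk, hk'⟩ :=
    exists_mem_Ioc_zpow (show 0 < 5 * r by positivity) (one_lt_two (α := ℝ))
  have hpow : (2 : ℝ) ^ (k + 1) < 10 * r := by
    rw [zpow_add_one₀ two_ne_zero]
    linarith
  have hev : ∀ᶠ y in nhds x, 5 * rate Q.n δ L ℓ y < 2 ^ (k + 1) :=
    ((continuous_rate Q.n δ L ℓ).const_mul 5).continuousAt.eventually_lt_const (by linarith)
  obtain ⟨m, hrate, hrisk⟩ := hf.exists_mem_nhds_risk_le hx.1 hev (ε := 2 ^ (k + 1)) (by positivity)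
  have hexp : Real.exp (-Q.lam) = δ := by
    rw [← hlam, one_div, Real.log_inv, neg_neg, Real.exp_log hδ]
  have hexpd : Real.exp (-Q.lamd) = δ / d := by
    rw [← hlamd, ← Real.log_inv, inv_div, Real.exp_log (by positivity)]
  refine (measure_mono fun S hS => ?_).trans (hf.measure_lt_risk_outIdx_le hδ' hexp hexpd
    (m := m) (k := k + 1)
    (fun S => (hscale S).exists_eq_smul_toVec hlam hlamd (by positivity) (le_of_lt hrate))
    fun y hy => hrisk.trans (by linarith [hx.2 y hy]))
  rw [Set.mem_ofPred_eq] at hS ⊢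
  linarith

lemma Regular.measure_not_forall_minimizers_le (hf : Q.Regular P f) (hδ : 0 < δ)
    (hδ' : δ ≤ 1 / 2) (hlam : Real.log (1 / δ) = Q.lam) (hlamd : Real.log (d / δ) = Q.lamd)
    (hL : 0 ≤ L) (hscale : ∀ S, Q.ScaleBounds (Q.stat (Q.sample f S)) L ℓ) :
    Measure.pi (fun _ : Fin Q.n => P)
      {S | ¬ ∀ x ∈ minimizers Q.X P f, risk P f (Q.D (Q.outIdx (Q.sample f S))) -
        optValue Q.X P f ≤ 3200010 * rate Q.n δ L ℓ x} ≤ ENNReal.ofReal δ := by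
  rcases (minimizers Q.X P f).eq_empty_or_nonempty with hempty | ⟨x₀, hx₀⟩
  · simp [hempty]
  have hbdd : BddBelow (rate Q.n δ L ℓ '' minimizers Q.X P f) :=
    ⟨0, Set.forall_mem_image.2 fun x _ => rate_nonneg Q.n δ hL ℓ x⟩
  refine (measure_mono fun S hS => ?_).trans (measure_lt_le_of_forall_gt
    (a := optValue Q.X P f + 3200010 * sInf (rate Q.n δ L ℓ '' minimizers Q.X P f))
    (g := fun S => risk P f (Q.D (Q.outIdx (Q.sample f S)))) fun c hc => ?_)
  · rw [Set.mem_ofPred_eq] at hS ⊢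
    push Not at hS
    obtain ⟨x, hx, hlt⟩ := hS
    linarith [csInf_le hbdd (Set.mem_image_of_mem _ hx)]
  · have hr : sInf (rate Q.n δ L ℓ '' minimizers Q.X P f) <
        (c - optValue Q.X P f) / 3200010 := by
      rw [lt_div_iff₀ (by norm_num)]
      linarith
    obtain ⟨_, ⟨x, hx, rfl⟩, hxr⟩ := exists_lt_of_csInf_lt (Set.Nonempty.image _ ⟨x₀, hx₀⟩) hr
    convert hf.measure_add_lt_risk_outIdx_le hδ hδ' hlam hlamd hscale hx
      ((rate_nonneg Q.n δ hL ℓ x).trans_lt hxr) hxr using 5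
    rw [← optValue_eq_of_mem_minimizers hx]
    ring

end Setup

/-- A convex loss on `X` that satisfies the bounds on the gradients with the parameters `L`
and `ℓ`. -/
structure IsLipschitzLoss (X : Set (Vec d)) (L : ℝ) (ℓ : Fin d → ℝ) (y : Vec d → ℝ) : Prop where
  convexOn : ConvexOn ℝ X y
  differentiableAt : ∀ x ∈ X, DifferentiableAt ℝ y x
  norm_gradient_le : ∀ x ∈ X, ‖gradient y x‖ ≤ L
  abs_gradient_le : ∀ x ∈ X, ∀ j, |gradient y x j| ≤ ℓ j

namespace IsLipschitzLoss

variable {X : Set (Vec d)} {L : ℝ} {ℓ : Fin d → ℝ} {y : Vec d → ℝ}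

lemma nonneg (h : IsLipschitzLoss X L ℓ y) (h₀ : 0 ∈ X) : 0 ≤ L ∧ ∀ j, 0 ≤ ℓ j :=
  ⟨(norm_nonneg _).trans (h.norm_gradient_le 0 h₀),
    fun j => (abs_nonneg _).trans (h.abs_gradient_le 0 h₀ j)⟩

lemma zero (hX : Convex ℝ X) (hL : 0 ≤ L) (hℓ : ∀ j, 0 ≤ ℓ j) :
    IsLipschitzLoss X L ℓ fun _ => 0 where
  convexOn := convexOn_const 0 hX
  differentiableAt x _ := differentiableAt_const 0
  norm_gradient_le x _ := by simpa only [gradient_fun_const, norm_zero] using hL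
  abs_gradient_le x _ j := by
    simpa only [gradient_fun_const, PiLp.zero_apply, abs_zero] using hℓ j

lemma zero_sub_le (h : IsLipschitzLoss X L ℓ y) (h₀ : 0 ∈ X) {x : Vec d} (hx : x ∈ X) :
    y 0 - y x ≤ min (L * ‖x‖) (min (normInf ℓ * norm1 x) (norm1 ℓ * normInf x)) := by
  have hgrad := convexOn_sub_le_inner_gradient h.convexOn h₀ hx (h.differentiableAt 0 h₀)
  rw [zero_sub, inner_neg_right] at hgrad
  have hsum : y 0 - y x ≤ ∑ j, |ℓ j| * |x j| := by
    refine (hgrad.trans (neg_le_abs _)).trans ?_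
    rw [inner_eq_sum]
    refine (Finset.abs_sum_le_sum_abs _ _).trans (Finset.sum_le_sum fun j _ => ?_)
    rw [abs_mul]
    exact mul_le_mul_of_nonneg_right ((h.abs_gradient_le 0 h₀ j).trans (le_abs_self _))
      (abs_nonneg _)
  refine le_min ?_ (le_min (hsum.trans ?_) (hsum.trans ?_))
  · calc y 0 - y x ≤ ‖gradient y 0‖ * ‖x‖ :=
          (hgrad.trans (neg_le_abs _)).trans (abs_real_inner_le_norm _ _)
      _ ≤ L * ‖x‖ := by gcongr; exact h.norm_gradient_le 0 h₀
  · rw [norm1, Finset.mul_sum]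
    gcongr
    exact abs_le_normInf ℓ _
  · rw [norm1, Finset.sum_mul]
    gcongr
    exact abs_le_normInf x _

end IsLipschitzLoss

section StochConvex

variable {𝒮 : Type*} [MeasurableSpace 𝒮] {P : Measure 𝒮} {X : Set (Vec d)} {f : Vec d → 𝒮 → ℝ}
  {L Lhat δ : ℝ} {ℓ ℓhat : Fin d → ℝ}

lemma IsStochConvex.ae_isLipschitzLoss (hc : IsStochConvex X P f)
    (hl : LipschitzEstimates X P f L Lhat ℓ ℓhat) :
    ∀ᵐ s ∂P, IsLipschitzLoss X L ℓ fun x => f x s := by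
  filter_upwards [hc.convex, hl.differentiable, hl.norm_gradient_le, hl.abs_gradient_le]
    with s hconvex hdiff hnorm habs using ⟨hconvex, hdiff, hnorm, habs⟩

lemma exists_forall_isLipschitzLoss_ae_eq (hf : ∀ x, Measurable (f x))
    (h : ∀ᵐ s ∂P, IsLipschitzLoss X L ℓ fun x => f x s) (hX : Convex ℝ X) (hL : 0 ≤ L)
    (hℓ : ∀ j, 0 ≤ ℓ j) :
    ∃ f' : Vec d → 𝒮 → ℝ, (∀ x, Measurable (f' x)) ∧
      (∀ s, IsLipschitzLoss X L ℓ fun x => f' x s) ∧ ∀ᵐ s ∂P, ∀ x, f' x s = f x s := by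
  obtain ⟨A, hA, hAm, h⟩ := h.exists_measurable_mem
  refine ⟨fun x => A.indicator (f x), fun x => (hf x).indicator hAm, fun s => ?_, ?_⟩
  · by_cases hs : s ∈ A
    · simpa only [Set.indicator_of_mem hs] using h s hs
    · simpa only [Set.indicator_of_notMem hs] using IsLipschitzLoss.zero hX hL hℓ
  · filter_upwards [hA] with s hs x using Set.indicator_of_mem hs _

lemma Setup.Regular.of_isLipschitzLoss {Q : Setup d} (hm : ∀ x, Measurable (f x))
    (hi : ∀ x ∈ Q.X, Integrable (f x) P) (h : ∀ s, IsLipschitzLoss Q.X L ℓ fun x => f x s)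
    (hL : L ≤ Q.Lhat) (hℓ : ∀ j, ℓ j ≤ Q.lhat j) : Q.Regular P f where
  measurable := hm
  integrable := hi
  convexOn s := (h s).convexOn
  differentiableAt s := (h s).differentiableAt
  gaugeVal_le s x hx i := by
    have hcoord (j : Fin d) := ((h s).abs_gradient_le x hx j).trans (hℓ j)
    match i with
    | none => exact ((h s).norm_gradient_le x hx).trans hL
    | some none =>
      exact normInf_le (normInf_nonneg _) fun j =>
        (hcoord j).trans ((le_abs_self _).trans (abs_le_normInf Q.lhat j))
    | some (some j) =>
      exact (hcoord j).trans
        (le_add_of_nonneg_right (div_nonneg Q.lhat_sum_pos.le d.cast_nonneg))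

variable [IsProbabilityMeasure P]

lemma Setup.measure_not_forall_minimizers_le (Q : Setup d) (hδ : 0 < δ) (hδ' : δ ≤ 1 / 2)
    (hlam : Real.log (1 / δ) = Q.lam) (hlamd : Real.log (d / δ) = Q.lamd)
    (hc : IsStochConvex Q.X P f) (hl : LipschitzEstimates Q.X P f L Q.Lhat ℓ Q.lhat)
    (hL : Q.Lhat ≤ L * √(Q.n / Q.lam)) (hℓ : ∀ j, Q.lhat j ≤ ℓ j * √(Q.n / Q.lamd)) :
    Measure.pi (fun _ : Fin Q.n => P)
      {S | ¬ ∀ x ∈ minimizers Q.X P f, risk P f (Q.D (Q.outIdx (Q.sample f S))) -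
        optValue Q.X P f ≤ 3200010 * rate Q.n δ L ℓ x} ≤ ENNReal.ofReal δ := by
  have hae := hc.ae_isLipschitzLoss hl
  obtain ⟨hL₀, hℓ₀⟩ := hae.exists.choose_spec.nonneg Q.zero_mem
  obtain ⟨f', hm, hf', heq⟩ :=
    exists_forall_isLipschitzLoss_ae_eq hc.measurable hae Q.convex hL₀ hℓ₀
  have heq' (x : Vec d) : f' x =ᵐ[P] f x := heq.mono fun s hs => hs x
  have hreg : Q.Regular P f' := .of_isLipschitzLoss hm
    (fun x hx => (hc.integrable x hx).congr (heq' x).symm) hf' hl.le_Lhat hl.le_ℓhat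
  have hrisk : risk P f' = risk P f := funext fun x => integral_congr_ae (heq' x)
  refine (measure_mono_ae ?_).trans (hreg.measure_not_forall_minimizers_le hδ hδ' hlam hlamd hL₀
    fun S => Setup.scaleBounds_stat hL₀ hℓ₀ (fun t => (hf' _).norm_gradient_le)
      (fun t => (hf' _).abs_gradient_le) hL hℓ)
  have hall : ∀ᵐ S ∂Measure.pi (fun _ : Fin Q.n => P), ∀ i x, f' x (S i) = f x (S i) :=
    ae_all_iff.2 fun i =>
      (measurePreserving_eval (fun _ : Fin Q.n => P) i).quasiMeasurePreserving.ae heq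
  filter_upwards [hall] with S hS hbad
  have hsample : Q.sample f' S = Q.sample f S := funext₂ fun t x => hS _ x
  change ¬ ∀ x ∈ minimizers Q.X P f', _
  rw [hsample]
  unfold minimizers optValue
  rw [hrisk]
  exact hbad

lemma IsStochConvex.risk_zero_sub_le (hc : IsStochConvex X P f)
    (hl : LipschitzEstimates X P f L Lhat ℓ ℓhat) (h₀ : 0 ∈ X) {x : Vec d} (hx : x ∈ X) :
    risk P f 0 - risk P f x ≤
      min (L * ‖x‖) (min (normInf ℓ * norm1 x) (norm1 ℓ * normInf x)) := by
  have hle : ∀ᵐ s ∂P, f 0 s - f x s ≤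
      min (L * ‖x‖) (min (normInf ℓ * norm1 x) (norm1 ℓ * normInf x)) :=
    (hc.ae_isLipschitzLoss hl).mono fun s hs => hs.zero_sub_le h₀ hx
  have hint := (hc.integrable 0 h₀).sub (hc.integrable x hx)
  unfold risk
  rw [← integral_sub (hc.integrable 0 h₀) (hc.integrable x hx)]
  exact (integral_mono_ae hint (integrable_const _) hle).trans_eq (by simp)

end StochConvex

lemma half_le_log_one_div {δ : ℝ} (hδ : 0 < δ) (hδ' : δ ≤ 1 / 2) :
    1 / 2 ≤ Real.log (1 / δ) := by
  have htwo : (2 : ℝ) ≤ 1 / δ := by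
    rw [le_div_iff₀ hδ]
    linarith
  linarith [Real.log_le_log two_pos htwo, Real.log_two_gt_d9]

lemma log_one_div_le_log_div {δ : ℝ} (hδ : 0 < δ) (hd : 0 < d) :
    Real.log (1 / δ) ≤ Real.log (d / δ) :=
  Real.log_le_log (by positivity) (by gcongr; exact_mod_cast hd)

lemma le_two_mul_mul_sqrt_div_sqrt {n c t : ℝ} (hn : 0 < n) (hn' : n ≤ 2) (hc : 0 ≤ c)
    (ht : 1 / 2 ≤ t) : c ≤ 2 * (c * √t / √n) := by
  have hsqrt : √n ≤ 2 * √t := by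
    rw [← Real.sqrt_sq zero_le_two, ← Real.sqrt_mul (by positivity)]
    exact Real.sqrt_le_sqrt (by linarith)
  rw [← mul_div_assoc, le_div_iff₀ (Real.sqrt_pos.2 hn)]
  nlinarith

lemma min_le_two_mul_rate {n : ℕ} (hn : 0 < n) (hn' : n < 3) (hd : 0 < d) {δ : ℝ} (hδ : 0 < δ)
    (hδ' : δ ≤ 1 / 2) {L : ℝ} (hL : 0 ≤ L) (ℓ : Fin d → ℝ) (x : Vec d) :
    min (L * ‖x‖) (min (normInf ℓ * norm1 x) (norm1 ℓ * normInf x)) ≤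
      2 * rate n δ L ℓ x := by
  have hlam := half_le_log_one_div hδ hδ'
  have hlamd := hlam.trans (log_one_div_le_log_div hδ hd)
  have hle {c t : ℝ} (hc : 0 ≤ c) (ht : 1 / 2 ≤ t) : c ≤ 2 * (c * √t / √(n : ℝ)) :=
    le_two_mul_mul_sqrt_div_sqrt (Nat.cast_pos.2 hn) (by exact_mod_cast Nat.le_of_lt_succ hn') hc ht
  rw [rate, mul_min_of_nonneg _ _ zero_le_two, mul_min_of_nonneg _ _ zero_le_two]
  exact min_le_min (hle (by positivity) hlam) (min_le_min
    (hle (mul_nonneg (normInf_nonneg ℓ) (norm1_nonneg x)) hlamd)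
    (hle (mul_nonneg (norm1_nonneg ℓ) (normInf_nonneg x)) hlam))

lemma exists_dense_seq {X : Set (Vec d)} (h₀ : 0 ∈ X) :
    ∃ D : ℕ → Vec d, (∀ i, D i ∈ X) ∧ (∀ x ∈ X, ∀ ε > 0, ∃ i, ‖x - D i‖ ≤ ε) ∧ D 0 = 0 := by
  have : Nonempty X := ⟨⟨0, h₀⟩⟩
  refine ⟨fun i => Nat.casesOn i 0 fun i => (TopologicalSpace.denseSeq X i : Vec d), ?_, ?_, rfl⟩
  · rintro (_ | i)
    · exact h₀
    · exact (TopologicalSpace.denseSeq X i).2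
  · intro x hx ε hε
    obtain ⟨i, hi⟩ := (TopologicalSpace.denseRange_denseSeq X).exists_dist_lt ⟨x, hx⟩ hε
    rw [Subtype.dist_eq, dist_eq_norm] at hi
    exact ⟨i + 1, hi.le⟩

/-- The inputs for which the algorithm makes use of the losses; for the others, the output `0` is
good enough. -/
structure Nondegenerate (n : ℕ) (δ Lhat : ℝ) (ℓhat : Fin d → ℝ) : Prop where
  three_le : 3 ≤ n
  Lhat_pos : 0 < Lhat
  nonneg : ∀ j, 0 ≤ ℓhat j
  sum_pos : 0 < ∑ j, ℓhat j
  log_le : Real.log (d / δ) ≤ n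

lemma Nondegenerate.exists_setup {n : ℕ} {δ Lhat : ℝ} {ℓhat : Fin d → ℝ}
    (h : Nondegenerate n δ Lhat ℓhat) (hd : 0 < d) (hδ : 0 < δ) (hδ' : δ ≤ 1 / 2)
    {X : Set (Vec d)} (hX : IsClosed X) (hX' : Convex ℝ X) (h₀ : 0 ∈ X) :
    ∃ Q : Setup d, Q.n = n ∧ Q.X = X ∧ Q.Lhat = Lhat ∧ Q.lhat = ℓhat ∧
      Q.lam = Real.log (1 / δ) ∧ Q.lamd = Real.log (d / δ) := by
  obtain ⟨D, hD, hdense, hzero⟩ := exists_dense_seq h₀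
  have hd' : (1 : ℝ) ≤ d := by exact_mod_cast hd
  have hle := h.three_le
  refine ⟨{
    n := n, N := n / 3, X := X, D := D, lam := Real.log (1 / δ), lamd := Real.log (d / δ)
    Lhat := Lhat, lhat := ℓhat, d_pos := hd
    N_pos := by omega
    three_mul_le := by omega
    le_five_mul := by omega
    closed := hX, convex := hX', D_mem := hD, D_dense := hdense, D_zero := hzero
    half_le := half_le_log_one_div hδ hδ'
    lam_le := log_one_div_le_log_div hδ hd
    log_le := Real.log_le_log (by positivity) ?_
    lamd_le := h.log_le, Lhat_pos := h.Lhat_pos, lhat_nonneg := h.nonneg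
    lhat_sum_pos := h.sum_pos }, rfl, rfl, rfl, rfl, rfl, rfl⟩
  rw [le_div_iff₀ hδ]
  nlinarith

lemma LipschitzEstimates.nondegenerate {𝒮 : Type*} [MeasurableSpace 𝒮] {P : Measure 𝒮}
    {X : Set (Vec d)} {f : Vec d → 𝒮 → ℝ} {n : ℕ} {δ L Lhat : ℝ} {ℓ ℓhat : Fin d → ℝ}
    (hl : LipschitzEstimates X P f L Lhat ℓ ℓhat) (hn : 3 ≤ n) (hL : 0 < L)
    (hℓ : ∀ j, 0 ≤ ℓ j) {j : Fin d} (hj : 0 < ℓ j)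
    (hhat : ℓhat j ≤ ℓ j * √((n : ℝ) / Real.log ((d : ℝ) / δ))) :
    Nondegenerate n δ Lhat ℓhat where
  three_le := hn
  Lhat_pos := hL.trans_le hl.le_Lhat
  nonneg j := (hℓ j).trans (hl.le_ℓhat j)
  sum_pos := Finset.sum_pos' (fun i _ => (hℓ i).trans (hl.le_ℓhat i))
    ⟨j, Finset.mem_univ j, hj.trans_le (hl.le_ℓhat j)⟩
  log_le := by
    have hdiv := Real.one_le_sqrt.1 ((le_mul_iff_one_le_right hj).1 ((hl.le_ℓhat j).trans hhat))
    by_contra! hlt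
    rw [one_le_div ((Nat.cast_nonneg n).trans_lt hlt)] at hdiv
    linarith

lemma IsStochConvex.risk_zero_sub_optValue_le {𝒮 : Type*} [MeasurableSpace 𝒮] {P : Measure 𝒮}
    [IsProbabilityMeasure P] {X : Set (Vec d)} {f : Vec d → 𝒮 → ℝ} {n : ℕ} {δ L Lhat : ℝ}
    {ℓ ℓhat : Fin d → ℝ} (hc : IsStochConvex X P f)
    (hl : LipschitzEstimates X P f L Lhat ℓ ℓhat) (hdeg : ¬Nondegenerate n δ Lhat ℓhat)
    (hd : 0 < d) (hn : 0 < n) (h₀ : 0 ∈ X) (hδ : 0 < δ) (hδ' : δ ≤ 1 / 2)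
    (hℓ : ∀ j, ℓhat j ≤ ℓ j * √((n : ℝ) / Real.log ((d : ℝ) / δ))) {x : Vec d}
    (hx : x ∈ minimizers X P f) :
    risk P f 0 - optValue X P f ≤ 2 * rate n δ L ℓ x := by
  obtain ⟨hL₀, hℓ₀⟩ := (hc.ae_isLipschitzLoss hl).exists.choose_spec.nonneg h₀
  rw [optValue_eq_of_mem_minimizers hx]
  refine (hc.risk_zero_sub_le hl h₀ hx.1).trans ?_
  obtain hn' | hn' := lt_or_ge n 3
  · exact min_le_two_mul_rate hn hn' hd hδ hδ' hL₀ ℓ x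
  refine le_trans ?_ (mul_nonneg zero_le_two (rate_nonneg n δ hL₀ ℓ x))
  obtain rfl | hLpos := hL₀.eq_or_lt
  · exact min_le_of_left_le (zero_mul _).le
  have hℓzero (j : Fin d) : ℓ j = 0 := by
    by_contra hj
    exact hdeg (hl.nondegenerate hn' hLpos hℓ₀ ((hℓ₀ j).lt_of_ne' hj) (hℓ j))
  exact min_le_of_right_le (min_le_of_right_le (by simp [norm1, hℓzero]))

end StochOpt

end

/-- The constant `C` is universal. The algorithm is a map from `n` sample functions to `X`; it may
depend only on `d`, `n`, `X`, `δ` and the estimates `Lhat`, `ℓhat`, and not on the distribution of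
the losses, on `L`, `ℓ`, or on the minimizers. The failure event has (outer) measure at most `δ`
for `n` independent samples of law `P`, so that its complement contains a measurable event of
probability at least `1 - δ`. -/
theorem mainTheorem1 :
    ∃ C : ℝ, 0 < C ∧
      ∀ (d n : ℕ), 0 < d → 0 < n →
      ∀ X : Set (StochOpt.Vec d), IsClosed X → Convex ℝ X → (0 : StochOpt.Vec d) ∈ X →
      ∀ δ : ℝ, 0 < δ → δ ≤ 1 / 2 →
      ∀ (Lhat : ℝ) (ℓhat : Fin d → ℝ),
      ∃ alg : (Fin n → StochOpt.Vec d → ℝ) → StochOpt.Vec d,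
        (∀ g, alg g ∈ X) ∧
        ∀ (𝒮 : Type*) [MeasurableSpace 𝒮] (P : MeasureTheory.Measure 𝒮)
          [MeasureTheory.IsProbabilityMeasure P]
          (f : StochOpt.Vec d → 𝒮 → ℝ) (L : ℝ) (ℓ : Fin d → ℝ),
          StochOpt.IsStochConvex X P f →
          StochOpt.LipschitzEstimates X P f L Lhat ℓ ℓhat →
          Lhat ≤ L * √((n : ℝ) / Real.log (1 / δ)) →
          (∀ j, ℓhat j ≤ ℓ j * √((n : ℝ) / Real.log ((d : ℝ) / δ))) →
          (MeasureTheory.Measure.pi fun _ : Fin n => P)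
            {S | ¬ ∀ xstar ∈ StochOpt.minimizers X P f,
              StochOpt.risk P f (alg fun i x => f x (S i)) - StochOpt.optValue X P f ≤
                C * StochOpt.rate n δ L ℓ xstar} ≤ ENNReal.ofReal δ := by
  refine ⟨3200010, by norm_num, fun d n hd hn X hX hX' h₀ δ hδ hδ' Lhat ℓhat => ?_⟩
  by_cases hdeg : StochOpt.Nondegenerate n δ Lhat ℓhat
  · obtain ⟨Q, rfl, rfl, rfl, rfl, hlam, hlamd⟩ := hdeg.exists_setup hd hδ hδ' hX hX' h₀
    refine ⟨fun g => Q.D (Q.outIdx fun t => g (Fin.ofNat Q.n t)), fun g => Q.D_mem _, ?_⟩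
    intro 𝒮 _ P _ f L ℓ hc hl hL hℓ
    rw [← hlam] at hL
    rw [← hlamd] at hℓ
    exact Q.measure_not_forall_minimizers_le hδ hδ' hlam.symm hlamd.symm hc hl hL hℓ
  · refine ⟨fun _ => 0, fun _ => h₀, fun 𝒮 _ P _ f L ℓ hc hl _ hℓ => ?_⟩
    have hzero : ∀ x ∈ StochOpt.minimizers X P f,
        StochOpt.risk P f 0 - StochOpt.optValue X P f ≤ 3200010 * StochOpt.rate n δ L ℓ x := by
      intro x hx
      have hL := ((hc.ae_isLipschitzLoss hl).exists.choose_spec.nonneg h₀).1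
      linarith [hc.risk_zero_sub_optValue_le hl hdeg hd hn h₀ hδ hδ' hℓ hx,
        StochOpt.rate_nonneg n δ hL ℓ x]
    refine (measure_mono_null (t := ∅) (fun S hS => ?_) measure_empty).trans_le zero_le
    exact hS hzero
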